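/- **Definitions.** A *polygonal 2-complex* $X$ is a 2-dimensional CW-complex whose 1-skeleton $X^{(1)}$ is a graph with oriented edges of length one (loops and multiple edges allowed), and in which every 2-cell $D$ is a polygon with $\ell(\partial D)\ge 1$ sides attached along a closed edge path of length $\ell(\partial D)$. It is *acceptable* if 1. $X^{(1)}$ is connected and $\pi_1(X^{(1)})$ has rank at least $2$; 2. no attaching map is a proper power $h^k$ ($k\ge 2$) in $\pi_1(X^{(1)})$ (in particular none is trivial), and for any two distinct 2-cells the attaching maps are not freely homotopic in $X^{(1)}$, even after reversing the direction of one of them. *Random branched cover.* Let $X$ be finite and connected, let $T$ be a spanning tree of $X^{(1)}$, and let $t$ be the number of edges outside $T$ (if $X$ is the presentation complex of $\langle u_1,\dots,u_t\mid r_1,\dots,r_s\rangle$, then $T$ has no edges and the edges are the $t$ generators). Choose $t$ independent uniformly distributed permutations $\sigma_e\in\mathrm{Sym}(n)$, one for each edge $e\notin T$, and put $\sigma_e=1$ for $e\in T$. The 1-skeleton of $X(\sigma)$ is the $n$-sheeted covering graph of $X^{(1)}$ with vertices $(v,j)$ and edges $(e,j)$, $1\le j\le n$, where for an edge $e$ from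 $v$ to $w$ the edge $(e,j)$ goes from $(v,j)$ to $(w,\sigma_e(j))$. For each 2-cell $D$ of $X$, following its boundary word once, starting in each of the $n$ sheets, gives a permutation $D(\sigma)\in\mathrm{Sym}(n)$; for each cycle of $D(\sigma)$, of length $k$ say, one 2-cell of perimeter $k\,\ell(\partial D)$ is attached to the covering graph along the corresponding closed lift of the $k$-fold boundary path of $D$. *Geometric small cancellation.* A *subpiece* of two 2-cells $D,D'$ (possibly equal) is a pair of edge paths, one in $\partial D$ and one in $\partial D'$ (traversed in either direction), each going around its boundary at most once, whose images in the 1-skeleton are the same path; if $D=D'$ and the two directions agree, the initial vertices of the two paths in $\partial D$ must be distinct. A *piece* is a maximal subpiece. A polygonal 2-complex satisfies *geometric $C'(\lambda)$* if all its attaching paths are cyclically reduced (no edge is immediately followed by the same edge backwards, also cyclically) and every piece $b$ in the boundary of a 2-cell $D$ satisfies $\ell(b)<\lambda\,\ell(\partial D)$. **Theorem.** Let $X$ be an acceptable finite polygonal 2-complex, let $T$ be a spanning tree of $X^{(1)}$, and let $\lambda>0$. Then the random $n$-fold branched cover $X(\sigma)$ is asymptotically almost surely homotopy equivalent to a finite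 polygonal 2-complex satisfying geometric $C'(\lambda)$; that is, the probability that $X(\sigma)$ is homotopy equivalent to such a complex tends to $1$ as $n\to\infty$. -/

import Mathlib

open Set Filter Topology

universe u

/-! ### Oriented graphs and their topological realization -/

/-- An oriented graph (loops and multiple edges allowed): every edge `e` has a prescribed
orientation, from `src e` to `tgt e`. -/
structure OrGraph where
  V : Type u
  E : Type u
  src : E → V
  tgt : E → V

namespace OrGraph

/-- A directed edge: `(e, true)` is `e` with its prescribed orientation, `(e, false)` is `e`
traversed backwards. -/
abbrev Dart (G : OrGraph.{u}) : Type u := G.E × Bool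

variable (G : OrGraph.{u})

def tail (d : G.Dart) : G.V := if d.2 then G.src d.1 else G.tgt d.1

def head (d : G.Dart) : G.V := if d.2 then G.tgt d.1 else G.src d.1

def rev (d : G.Dart) : G.Dart := (d.1, !d.2)

/-- The disjoint union of one point for each vertex and one unit interval for each edge. -/
abbrev PreSkeleton : Type u := (Σ _ : G.V, PUnit.{1}) ⊕ (Σ _ : G.E, unitInterval)

inductive SkeletonRel : G.PreSkeleton → G.PreSkeleton → Prop
  | src (e : G.E) : SkeletonRel (Sum.inr ⟨e, 0⟩) (Sum.inl ⟨G.src e, PUnit.unit⟩)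
  | tgt (e : G.E) : SkeletonRel (Sum.inr ⟨e, 1⟩) (Sum.inl ⟨G.tgt e, PUnit.unit⟩)

/-- The topological realization of the graph, a 1-dimensional CW-complex with the quotient
topology. -/
def Skeleton : Type u := Quot G.SkeletonRel

instance : TopologicalSpace G.Skeleton := inferInstanceAs (TopologicalSpace (Quot G.SkeletonRel))

def vertexPoint (v : G.V) : G.Skeleton := Quot.mk _ (Sum.inl ⟨v, PUnit.unit⟩)

def edgePoint (e : G.E) (s : unitInterval) : G.Skeleton := Quot.mk _ (Sum.inr ⟨e, s⟩)

/-- The point at distance `s` from the tail of the directed edge `d`. -/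
def dartPoint (d : G.Dart) (s : unitInterval) : G.Skeleton :=
  if d.2 then G.edgePoint d.1 s else G.edgePoint d.1 (unitInterval.symm s)

theorem continuous_dartPoint (d : G.Dart) : Continuous (G.dartPoint d) := by
  have h : Continuous (G.edgePoint d.1) :=
    continuous_quot_mk.comp (continuous_inr.comp continuous_sigmaMk)
  unfold dartPoint
  split_ifs
  · exact h
  · exact h.comp unitInterval.continuous_symm

theorem dartPoint_zero (d : G.Dart) : G.dartPoint d 0 = G.vertexPoint (G.tail d) := by
  unfold dartPoint tail
  split_ifs
  · exact Quot.sound (.src _)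
  · rw [unitInterval.symm_zero]; exact Quot.sound (.tgt _)

theorem dartPoint_one (d : G.Dart) : G.dartPoint d 1 = G.vertexPoint (G.head d) := by
  unfold dartPoint head
  split_ifs
  · exact Quot.sound (.tgt _)
  · rw [unitInterval.symm_one]; exact Quot.sound (.src _)

/-- A spanning tree of a finite graph, given by its set of edges: these edges connect all the
vertices, and there is one edge fewer than there are vertices. -/
def IsSpanningTree (T : Set G.E) : Prop :=
  (∀ v w : G.V, Relation.EqvGen (fun a b => ∃ e ∈ T, G.src e = a ∧ G.tgt e = b) v w) ∧
    Nat.card T + 1 = Nat.card G.V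

end OrGraph

/-! ### Polygonal 2-complexes -/

/-- A polygonal 2-complex: an oriented graph (the 1-skeleton) together with a family of polygonal
2-cells. The 2-cell `f` is a polygon with `len f ≥ 1` sides, attached along the closed edge path
`bd f 0, bd f 1, …, bd f (len f - 1)`; the boundary labels are recorded as the bi-infinite
periodic edge path `bd f : ℤ → Dart`. -/
structure PolygonalComplex extends OrGraph.{u} where
  F : Type u
  len : F → ℕ
  len_pos : ∀ f, 0 < len f
  bd : F → ℤ → toOrGraph.Dart
  bd_periodic : ∀ f k, bd f (k + len f) = bd f k
  bd_chain : ∀ f k, toOrGraph.head (bd f k) = toOrGraph.tail (bd f (k + 1))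

namespace PolygonalComplex

variable (X : PolygonalComplex.{u})

def IsFinite : Prop := Finite X.V ∧ Finite X.E ∧ Finite X.F

/-- The periodic map `ℝ → X^(1)` which sends each interval `[k, k + 1]` isometrically onto the
directed edge `bd f k`. -/
noncomputable def attachLine (f : X.F) (t : ℝ) : X.Skeleton :=
  X.dartPoint (X.bd f ⌊t⌋) ⟨Int.fract t, Int.fract_nonneg t, (Int.fract_lt_one t).le⟩

theorem attachLine_eq (f : X.F) (k : ℤ) {t : ℝ} (ht : t ∈ Icc (k : ℝ) (k + 1)) :
    X.attachLine f t = X.dartPoint (X.bd f k) (projIcc 0 1 zero_le_one (t - k)) := by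
  rcases ht.2.lt_or_eq with h | h
  · have hk : ⌊t⌋ = k := Int.floor_eq_iff.2 ⟨ht.1, h⟩
    have hf : Int.fract t = t - k := by rw [Int.fract, hk]
    unfold attachLine
    rw [hk]
    congr 1
    apply Subtype.ext
    rw [projIcc_of_mem zero_le_one (show t - k ∈ Icc (0 : ℝ) 1 from
      ⟨by linarith [ht.1], by linarith⟩)]
    exact hf
  · subst h
    have hk : ⌊(k : ℝ) + 1⌋ = k + 1 := by
      rw [Int.floor_eq_iff]; push_cast; constructor <;> linarith
    have e1 : X.attachLine f (k + 1) = X.dartPoint (X.bd f (k + 1)) 0 := by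
      unfold attachLine
      rw [hk]
      congr 1
      apply Subtype.ext
      change Int.fract ((k : ℝ) + 1) = 0
      rw [Int.fract, hk]; push_cast; ring
    have e2 : projIcc (0 : ℝ) 1 zero_le_one ((k : ℝ) + 1 - k) = 1 :=
      projIcc_of_right_le zero_le_one (by linarith)
    rw [e1, e2, X.dartPoint_zero, X.dartPoint_one, X.bd_chain]

theorem continuous_attachLine (f : X.F) : Continuous (X.attachLine f) := by
  have hfin : LocallyFinite (fun k : ℤ => Icc (k : ℝ) (k + 1)) := by
    intro x
    refine ⟨Ioo (x - 1) (x + 1), Ioo_mem_nhds (by linarith) (by linarith), ?_⟩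
    refine (finite_Icc (⌊x⌋ - 2) (⌊x⌋ + 2)).subset ?_
    rintro k ⟨y, hy1, hy2⟩
    have a := Int.floor_le x
    have b := Int.lt_floor_add_one x
    constructor
    · have : ((⌊x⌋ : ℤ) : ℝ) < ((k + 2 : ℤ) : ℝ) := by
        push_cast; linarith [hy1.2, hy2.1]
      have := Int.cast_lt.1 this
      linarith
    · have : (k : ℝ) < ((⌊x⌋ + 2 : ℤ) : ℝ) := by
        push_cast; linarith [hy1.1, hy2.2]
      exact (Int.cast_lt.1 this).le
  refine hfin.continuous ?_ (fun _ => isClosed_Icc) ?_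
  · refine eq_univ_of_forall fun x => mem_iUnion.2 ⟨⌊x⌋, Int.floor_le x, ?_⟩
    exact (Int.lt_floor_add_one x).le
  · intro k
    refine ContinuousOn.congr (f := fun t : ℝ =>
      X.dartPoint (X.bd f k) (projIcc 0 1 zero_le_one (t - k))) ?_ ?_
    · exact ((X.continuous_dartPoint _).comp
        (continuous_projIcc.comp (continuous_id.sub continuous_const))).continuousOn
    · intro t ht
      exact X.attachLine_eq f k ht

theorem attachLine_periodic (f : X.F) :
    Function.Periodic (fun t : ℝ => X.attachLine f (X.len f * t)) 1 := by
  intro t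
  have h : (X.len f : ℝ) * (t + 1) = X.len f * t + ((X.len f : ℤ) : ℝ) := by push_cast; ring
  simp only [attachLine]
  congr 1
  · rw [h, Int.floor_add_intCast, X.bd_periodic]
  · apply Subtype.ext
    simp only
    rw [h, Int.fract_add_intCast]

/-- The attaching map `S¹ → X^(1)` of the 2-cell `f`, where `S¹ = ℝ / ℤ`, at constant speed. -/
noncomputable def attach (f : X.F) : C(UnitAddCircle, X.Skeleton) where
  toFun := (X.attachLine_periodic f).lift
  continuous_toFun := by
    refine continuous_coinduced_dom.2 ?_
    exact (X.continuous_attachLine f).comp (continuous_const.mul continuous_id)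

/-- The attaching map traversed in the opposite direction. -/
noncomputable def attachRev (f : X.F) : C(UnitAddCircle, X.Skeleton) :=
  (X.attach f).comp ⟨fun θ => -θ, continuous_neg⟩

/-- The attaching map of `f` as a based loop, at the initial vertex of its boundary word. -/
noncomputable def attachPath (f : X.F) : Path (X.attach f 0) (X.attach f 0) where
  toFun s := X.attach f ((s : ℝ) : UnitAddCircle)
  continuous_toFun := (X.attach f).continuous.comp
    ((AddCircle.continuous_mk' (1 : ℝ)).comp continuous_subtype_val)
  source' := by simp
  target' := by
    change X.attach f (((1 : ℝ) : ℝ) : UnitAddCircle) = _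
    rw [AddCircle.coe_period]

/-- The class of the attaching map in the fundamental group of the 1-skeleton. -/
noncomputable def attachClass (f : X.F) : FundamentalGroup X.Skeleton (X.attach f 0) :=
  FundamentalGroup.fromPath (Path.Homotopic.Quotient.mk (X.attachPath f))

/-- The disjoint union of the 1-skeleton and one closed unit disk for each 2-cell. -/
abbrev PreRealization : Type u :=
  X.Skeleton ⊕ (Σ _ : X.F, Metric.closedBall (0 : ℂ) 1)

/-- The point of the boundary circle of the closed unit disk with angle `2πθ`. -/
noncomputable def diskBoundary (θ : UnitAddCircle) : Metric.closedBall (0 : ℂ) 1 :=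
  ⟨(AddCircle.toCircle θ : ℂ), by rw [mem_closedBall_zero_iff, Circle.norm_coe]⟩

/-- Boundary points of the disks are glued to the 1-skeleton through the attaching maps. -/
inductive RealizationRel : X.PreRealization → X.PreRealization → Prop
  | glue (f : X.F) (θ : UnitAddCircle) :
      RealizationRel (Sum.inr ⟨f, diskBoundary θ⟩) (Sum.inl (X.attach f θ))

/-- The topological space underlying a polygonal 2-complex (a 2-dimensional CW-complex). -/
def Realization : Type u := Quot X.RealizationRel

instance : TopologicalSpace X.Realization :=
  inferInstanceAs (TopologicalSpace (Quot X.RealizationRel))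

end PolygonalComplex

/-! ### Acceptable complexes -/

/-- `g = h ^ k` for some `h` and some `k ≥ 2`. -/
def IsProperPower {G : Type*} [Monoid G] (g : G) : Prop :=
  ∃ (h : G) (k : ℕ), 2 ≤ k ∧ g = h ^ k

/-- The group cannot be generated by fewer than two elements. -/
def RankAtLeastTwo (G : Type*) [Group G] : Prop :=
  ∀ S : Finset G, Subgroup.closure (S : Set G) = ⊤ → 2 ≤ S.card

/-- Acceptable polygonal 2-complexes: the 1-skeleton is connected with fundamental group of rank
at least two, no attaching map is a proper power in the fundamental group of the 1-skeleton, and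
the attaching maps of distinct 2-cells are not freely homotopic in the 1-skeleton, even after
reversing the direction of one of them. -/
structure PolygonalComplex.IsAcceptable (X : PolygonalComplex.{u}) : Prop where
  connected : PathConnectedSpace X.Skeleton
  rank : ∀ x : X.Skeleton, RankAtLeastTwo (FundamentalGroup X.Skeleton x)
  not_power : ∀ f : X.F, ¬ IsProperPower (X.attachClass f)
  not_homotopic : ∀ f g : X.F, f ≠ g →
    ¬ (X.attach f).Homotopic (X.attach g) ∧ ¬ (X.attach f).Homotopic (X.attachRev g)

/-! ### Geometric small cancellation -/

namespace PolygonalComplex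

variable (X : PolygonalComplex.{u})

/-- Every attaching map is cyclically reduced: it never traverses an edge and then immediately
the same edge backwards. -/
def IsReduced : Prop := ∀ (f : X.F) (k : ℤ), X.bd f (k + 1) ≠ X.rev (X.bd f k)

/-- The `k`-th directed edge of the path in the boundary of `g` that starts at its `j`-th vertex
and runs in the positive direction (`pos = true`) or in the negative direction. -/
def readFrom (g : X.F) (j : ℤ) (pos : Bool) (k : ℕ) : X.Dart :=
  if pos then X.bd g (j + k) else X.rev (X.bd g (j - 1 - k))

/-- A subpiece of length `l` between the 2-cells `f` and `g` (possibly equal): the path of length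
`l` starting at the `i`-th vertex of the boundary of `f` and the path of length `l` starting at
the `j`-th vertex of the boundary of `g`, in either direction, have the same labels. Both paths
go around their boundary at most once. If `f = g` and the directions agree, then the two initial
vertices in the boundary of `f` have to be distinct. -/
def IsSubpiece (f : X.F) (i : ℤ) (g : X.F) (j : ℤ) (pos : Bool) (l : ℕ) : Prop :=
  l ≤ X.len f ∧ l ≤ X.len g ∧
    (f = g → pos = true → ¬ i ≡ j [ZMOD (X.len f)]) ∧
    ∀ k < l, X.bd f (i + k) = X.readFrom g j pos k

/-- Geometric small cancellation `C'(r)`: the attaching maps are cyclically reduced, and every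
piece in the boundary of a 2-cell `f` has length `< r * len f`. Pieces are the maximal subpieces;
as every subpiece is contained in a piece, the bound is imposed on all subpieces. -/
def SmallCancellation (r : ℝ) : Prop :=
  X.IsReduced ∧
    ∀ (f : X.F) (i : ℤ) (g : X.F) (j : ℤ) (pos : Bool) (l : ℕ),
      X.IsSubpiece f i g j pos l → (l : ℝ) < r * X.len f

end PolygonalComplex

/-! ### Branched covers -/

namespace PolygonalComplex

variable (X : PolygonalComplex.{u}) {n : ℕ} (σ : X.E → Equiv.Perm (Fin n))

/-- The permutation of the sheets induced by traversing a directed edge. -/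
def sheetStep (d : X.Dart) : Equiv.Perm (Fin n) := if d.2 then σ d.1 else (σ d.1)⁻¹

/-- The permutation of the sheets induced by the first `k` edges of the boundary word of `f`. -/
def holonomy (f : X.F) : ℕ → Equiv.Perm (Fin n)
  | 0 => 1
  | k + 1 => X.sheetStep σ (X.bd f k) * holonomy f k

/-- The word map: the permutation of the sheets induced by the whole boundary word of `f`. -/
def monodromy (f : X.F) : Equiv.Perm (Fin n) := X.holonomy σ f (X.len f)

/-- The sheet in which the lift of the bi-infinite path `bd f`, starting at time `0` in the sheet
`j`, is at time `k`. -/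
def liftSheet (f : X.F) (j : Fin n) (k : ℤ) : Fin n :=
  X.holonomy σ f (k % X.len f).toNat ((X.monodromy σ f ^ (k / X.len f)) j)

/-- The covering graph: vertices `(v, j)` and edges `(e, j)` with `j` in `Fin n`, where the edge
`(e, j)` goes from `(src e, j)` to `(tgt e, σ e j)`. -/
def coverGraph : OrGraph.{u} where
  V := X.V × Fin n
  E := X.E × Fin n
  src e := (X.src e.1, e.2)
  tgt e := (X.tgt e.1, σ e.1 e.2)

/-- The lift of the directed edge `d` that starts in the sheet `j`. -/
def liftDart (d : X.Dart) (j : Fin n) : (X.coverGraph σ).Dart :=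
  if d.2 then ((d.1, j), true) else ((d.1, (σ d.1)⁻¹ j), false)

theorem tail_liftDart (d : X.Dart) (j : Fin n) :
    (X.coverGraph σ).tail (X.liftDart σ d j) = (X.tail d, j) := by
  rcases d with ⟨e, b⟩
  cases b <;> simp [liftDart, OrGraph.tail, coverGraph]

theorem head_liftDart (d : X.Dart) (j : Fin n) :
    (X.coverGraph σ).head (X.liftDart σ d j) = (X.head d, X.sheetStep σ d j) := by
  rcases d with ⟨e, b⟩
  cases b <;> simp [liftDart, OrGraph.head, coverGraph, sheetStep]

/-- The index of the lift of `f` through the sheet `j`: the length of the cycle of `j` under the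
word map. -/
noncomputable def liftIndex (f : X.F) (j : Fin n) : ℕ :=
  Function.minimalPeriod (X.monodromy σ f) j

theorem liftIndex_pos (f : X.F) (j : Fin n) : 0 < X.liftIndex σ f j :=
  Function.minimalPeriod_pos_of_mem_periodicPts
    ((X.monodromy σ f).injective.mem_periodicPts j)

theorem bd_emod (f : X.F) (k : ℤ) : X.bd f (k % X.len f) = X.bd f k := by
  have h : Function.Periodic (X.bd f) (X.len f : ℤ) := X.bd_periodic f
  have := h.int_mul (k / X.len f) (k % X.len f)
  rw [← this]
  congr 1
  simp only [Int.cast_id]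
  rw [mul_comm]
  exact Int.emod_add_mul_ediv k (X.len f)

theorem liftSheet_succ (f : X.F) (j : Fin n) (k : ℤ) :
    X.liftSheet σ f j (k + 1) = X.sheetStep σ (X.bd f k) (X.liftSheet σ f j k) := by
  have hL : (0 : ℤ) < X.len f := by exact_mod_cast X.len_pos f
  obtain ⟨r, hr⟩ := Int.eq_ofNat_of_zero_le (Int.emod_nonneg k hL.ne')
  have hrL := Int.emod_lt_of_pos k hL
  have hk := Int.emod_add_mul_ediv k (X.len f)
  have hb := X.bd_emod f k
  rw [hr] at hrL hk hb
  set q := k / (X.len f : ℤ) with hq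
  have hs : X.sheetStep σ (X.bd f k) (X.liftSheet σ f j k) =
      X.holonomy σ f (r + 1) ((X.monodromy σ f ^ q) j) := by
    simp only [liftSheet, ← hq, hr, Int.toNat_natCast, holonomy, Equiv.Perm.mul_apply, hb]
  rw [hs]
  by_cases h : (r : ℤ) + 1 < X.len f
  · have h1 : (k + 1) % (X.len f : ℤ) = ((r + 1 : ℕ) : ℤ) := by
      rw [← hk, show (r : ℤ) + X.len f * q + 1 = ((r + 1 : ℕ) : ℤ) + X.len f * q by
        push_cast; ring, Int.add_mul_emod_self_left]
      exact Int.emod_eq_of_lt (by positivity) (by push_cast; exact h)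
    have h2 : (k + 1) / (X.len f : ℤ) = q := by
      rw [← hk, show (r : ℤ) + X.len f * q + 1 = ((r + 1 : ℕ) : ℤ) + X.len f * q by
        push_cast; ring, Int.add_mul_ediv_left _ _ hL.ne',
        Int.ediv_eq_zero_of_lt (by positivity) (by push_cast; exact h), zero_add]
    simp only [liftSheet, h1, h2, Int.toNat_natCast]
  · have h0 : r + 1 = X.len f := by omega
    have e : k + 1 = X.len f * (q + 1) := by
      rw [← hk, ← h0]; push_cast; ring
    have h1 : (k + 1) % (X.len f : ℤ) = 0 := by rw [e, Int.mul_emod_right]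
    have h2 : (k + 1) / (X.len f : ℤ) = 1 + q := by
      rw [e, Int.mul_ediv_cancel_left _ hL.ne', add_comm]
    have hM : X.holonomy σ f (r + 1) = X.monodromy σ f := by rw [h0]; rfl
    rw [hM]
    simp only [liftSheet, h1, h2, Int.toNat_zero, holonomy, zpow_add, zpow_one,
      Equiv.Perm.mul_apply, Equiv.Perm.one_apply]

theorem liftSheet_periodic (f : X.F) (j : Fin n) (k : ℤ) :
    X.liftSheet σ f j (k + (X.len f * X.liftIndex σ f j : ℕ)) = X.liftSheet σ f j k := by
  have hL : (X.len f : ℤ) ≠ 0 := by exact_mod_cast (X.len_pos f).ne'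
  have hp : (X.monodromy σ f ^ X.liftIndex σ f j) j = j := by
    rw [Equiv.Perm.coe_pow]
    exact Function.iterate_minimalPeriod
  unfold liftSheet
  push_cast
  rw [Int.add_mul_emod_self_left, Int.add_mul_ediv_left _ _ hL, zpow_add, Equiv.Perm.mul_apply,
    zpow_natCast, hp]

/-- The branched cover of `X` given by one permutation of the `n` sheets for each edge. Its
1-skeleton is the corresponding `n`-sheeted covering graph. A 2-cell is attached along each lift
of the boundary of each 2-cell `f`: there is one lift for each cycle of the word map of `f`, and
the lift goes around the boundary of `f` as many times as the length of this cycle. -/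
noncomputable def branchedCover : PolygonalComplex.{u} where
  toOrGraph := X.coverGraph σ
  F := Σ f : X.F, Quotient (Equiv.Perm.SameCycle.setoid (X.monodromy σ f))
  len c := X.len c.1 * X.liftIndex σ c.1 c.2.out
  len_pos c := Nat.mul_pos (X.len_pos c.1) (X.liftIndex_pos σ c.1 _)
  bd c k := X.liftDart σ (X.bd c.1 k) (X.liftSheet σ c.1 c.2.out k)
  bd_periodic c k := by
    have h : Function.Periodic (X.bd c.1) (X.len c.1 : ℤ) := X.bd_periodic c.1
    have h2 := h.int_mul (X.liftIndex σ c.1 c.2.out : ℤ) k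
    rw [X.liftSheet_periodic]
    congr 1
    rw [← h2]
    congr 1
    simp only [Int.cast_id]
    push_cast
    ring
  bd_chain c k := by
    rw [X.tail_liftDart, X.head_liftDart, X.liftSheet_succ, X.bd_chain]

open Classical in
/-- Extend a family of permutations, one for each edge outside `T`, by the identity on `T`. -/
noncomputable def extendByOne (T : Set X.E) (τ : {e : X.E // e ∉ T} → Equiv.Perm (Fin n)) :
    X.E → Equiv.Perm (Fin n) :=
  fun e => if h : e ∈ T then 1 else τ ⟨e, h⟩

end PolygonalComplex

/-- The probability of the event `A` for the uniform distribution on the finite type `Ω`. -/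
noncomputable def uniformProb (Ω : Type*) (A : Set Ω) : ℝ := (A.ncard : ℝ) / (Nat.card Ω : ℝ)

/-! The boundary word of every cell of `X(σ)` covers a boundary word of `X`, and this bounds
overlaps uniformly in `n`. First the attaching maps of `X` are made cyclically reduced, which does
not change the homotopy type of any branched cover (`BoundaryData.exists_isReduced`). Acceptability
then says that the periodic boundary lines of `X` have no shorter periods and that different cells
have different lines, even up to reversal. By a Fine–Wilf argument two boundary lines that agree
along `M` edges, with `M` twice a bound for the perimeters, agree everywhere
(`IsIndependent.agreementBound`), and the same `M` works in every cover
(`AgreementBound.branchedCover`). So pieces in the cover have fewer than `M` edges, and small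
cancellation can fail only at cells of bounded perimeter.

These short cells are controlled by randomness. A graph with `v` vertices and `v + 1` edges has
`O(n^v)` placements on the sheets, each realized with probability `O(n^(-v-1))`. Hence
asymptotically almost surely no small set of sheets spans more edges than it has elements
(`tendsto_uniformProb_isSparse`), and small subgraphs without dead ends of the covering graph are
disjoint unions of cycles (`noBranching_coverGraph`). It follows that the short cells have disjoint
embedded boundaries, and that a boundary path which leaves one of these cycles meets none of them
again for a long time. Collapsing each closed short cell, a disk, to a point is a homotopy
equivalence (`nonempty_homotopyEquiv_collapse`).

After the collapse the other attaching maps have constant stretches and may backtrack around them. A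
constant stretch has fewer than `M` edges, since otherwise the cell would agree with a short one,
and fewer than `M` pairs cancel around it, since otherwise the boundary line would agree with its
own reverse. Tightening thus deletes blocks of fewer than `3M` edges that lie far apart
(`HasSparseBlocks.exists_isBlockDeletion`). Perimeters shrink at most by the factor `3M`, and among
any `3M` common edges of two tightened words there are `M` which were consecutive in both original
words. So pieces are now shorter than `3M` (`smallCancellation_tighten`), and collapsing all cells
of perimeter less than `9M²/λ`, rounded up, suffices.

Homotopies on quotient spaces are written as maps into the path space `C(unitInterval, Z)`, so that
the universal property of the quotient applies to them directly. -/

/-! ### Attaching cells to a space -/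

section Attachment

variable {S : Type*} [TopologicalSpace S] {ι : Type*}

/-- The relation that glues a family of disks, given in polar coordinates, to a space along
the attaching maps `φ i`. -/
inductive AttachmentRel (φ : ι → C(UnitAddCircle, S)) :
    S ⊕ (Σ _ : ι, unitInterval × UnitAddCircle) →
    S ⊕ (Σ _ : ι, unitInterval × UnitAddCircle) → Prop
  | glue (i : ι) (θ : UnitAddCircle) :
      AttachmentRel φ (Sum.inr ⟨i, (1, θ)⟩) (Sum.inl (φ i θ))
  | center (i : ι) (θ θ' : UnitAddCircle) :
      AttachmentRel φ (Sum.inr ⟨i, (0, θ)⟩) (Sum.inr ⟨i, (0, θ')⟩)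

/-- The space obtained by attaching disks to `S` along the maps `φ i`. -/
def Attachment (φ : ι → C(UnitAddCircle, S)) := Quot (AttachmentRel φ)

namespace Attachment

variable (φ : ι → C(UnitAddCircle, S))

instance : TopologicalSpace (Attachment φ) :=
  inferInstanceAs (TopologicalSpace (Quot (AttachmentRel φ)))

/-- The inclusion of the space to which the disks are attached. -/
def base : C(S, Attachment φ) :=
  ⟨fun x => Quot.mk _ (Sum.inl x), continuous_quot_mk.comp continuous_inl⟩

/-- The characteristic map of a cell, in polar coordinates. -/
def cell (i : ι) : C(unitInterval × UnitAddCircle, Attachment φ) :=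
  ⟨fun p => Quot.mk _ (Sum.inr ⟨i, p⟩),
    continuous_quot_mk.comp (continuous_inr.comp continuous_sigmaMk)⟩

theorem cell_one (i : ι) (θ : UnitAddCircle) : cell φ i (1, θ) = base φ (φ i θ) :=
  Quot.sound (.glue i θ)

theorem cell_zero (i : ι) (θ θ' : UnitAddCircle) : cell φ i (0, θ) = cell φ i (0, θ') :=
  Quot.sound (.center i θ θ')

variable {φ} {Z : Type*} [TopologicalSpace Z]

/-- The universal property of the attachment of cells. -/
def lift (g : C(S, Z)) (G : ι → C(unitInterval × UnitAddCircle, Z))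
    (h1 : ∀ i θ, G i (1, θ) = g (φ i θ)) (h0 : ∀ i θ θ', G i (0, θ) = G i (0, θ')) :
    C(Attachment φ, Z) where
  toFun := Quot.lift (Sum.elim g (fun x => G x.1 x.2)) (by
    rintro _ _ (⟨i, θ⟩ | ⟨i, θ, θ'⟩)
    · exact h1 i θ
    · exact h0 i θ θ')
  continuous_toFun := by
    refine continuous_quot_lift _ (g.continuous.sumElim ?_)
    exact continuous_sigma fun i => (G i).continuous

@[simp]
theorem lift_cell (g : C(S, Z)) (G : ι → C(unitInterval × UnitAddCircle, Z)) (h1) (h0) (i : ι)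
    (p : unitInterval × UnitAddCircle) : lift (φ := φ) g G h1 h0 (cell φ i p) = G i p := rfl

theorem forall_of {P : Attachment φ → Prop} (hb : ∀ x, P (base φ x))
    (hc : ∀ i p, P (cell φ i p)) (y : Attachment φ) : P y := by
  rcases y with ⟨x | ⟨i, p⟩⟩
  · exact hb x
  · exact hc i p

end Attachment

end Attachment

/-- A homotopy, given by a continuous map to the space of paths. -/
theorem ContinuousMap.homotopic_of_paths {Y Z : Type*} [TopologicalSpace Y] [TopologicalSpace Z]
    {f g : C(Y, Z)} (H : C(Y, C(unitInterval, Z))) (h0 : ∀ y, H y 0 = f y)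
    (h1 : ∀ y, H y 1 = g y) : f.Homotopic g :=
  ⟨{ toFun := fun p => H p.2 p.1
     continuous_toFun := by fun_prop
     map_zero_left := h0
     map_one_left := h1 }⟩

namespace Attachment

variable {S : Type*} [TopologicalSpace S] {ι : Type*} {φ : ι → C(UnitAddCircle, S)}
  {Z : Type*} [TopologicalSpace Z]

/-- Two maps on a disk in polar coordinates, pasted along the circle of radius `1`. -/
theorem continuous_pasteCell {W Y : Type*} [TopologicalSpace W] [TopologicalSpace Y]
    (c k : C(unitInterval × UnitAddCircle, W)) {x τ : Y → ℝ} {θ : Y → UnitAddCircle}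
    (hx : Continuous x) (hτ : Continuous τ) (hθ : Continuous θ)
    (h : ∀ y, x y = 1 → c (1, θ y) = k (projIcc 0 1 zero_le_one (τ y), θ y)) :
    Continuous (fun y => if x y ≤ 1 then c (projIcc 0 1 zero_le_one (x y), θ y)
      else k (projIcc 0 1 zero_le_one (τ y), θ y)) := by
  refine Continuous.if_le ?_ ?_ hx continuous_const ?_
  · exact c.continuous.comp ((continuous_projIcc.comp hx).prodMk hθ)
  · exact k.continuous.comp ((continuous_projIcc.comp hτ).prodMk hθ)
  · intro y hy
    rw [← h y hy, hy, projIcc_right]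
    rfl

section Collar

variable {ψ : ι → C(UnitAddCircle, S)}

/-- The map between attachments that is the identity on the base and fills a collar of each cell
with a homotopy between the attaching maps. -/
noncomputable def collarMap (h : ∀ i, (φ i).Homotopy (ψ i)) : C(Attachment φ, Attachment ψ) :=
  lift (base ψ) (fun i =>
    ⟨fun p => if 2 * (p.1 : ℝ) ≤ 1 then cell ψ i (projIcc 0 1 zero_le_one (2 * (p.1 : ℝ)), p.2)
        else (base ψ).comp (h i).toContinuousMap
          (projIcc 0 1 zero_le_one (2 - 2 * (p.1 : ℝ)), p.2), by
      refine continuous_pasteCell _ _ (by fun_prop) (by fun_prop) (by fun_prop) ?_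
      intro y hy
      rw [show 2 - 2 * (y.1 : ℝ) = 1 by linarith, projIcc_right, cell_one]
      change _ = base ψ (h i (1, y.2))
      rw [(h i).apply_one]⟩)
    (by
      intro i θ
      change (if 2 * ((1 : unitInterval) : ℝ) ≤ 1 then _ else base ψ (h i (_, θ))) = _
      rw [if_neg (by norm_num), show 2 - 2 * ((1 : unitInterval) : ℝ) = 0 by norm_num,
        projIcc_left]
      exact congrArg _ ((h i).apply_zero θ))
    (by
      intro i θ θ'
      change (if 2 * ((0 : unitInterval) : ℝ) ≤ 1 then cell ψ i (_, θ) else _) =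
        (if 2 * ((0 : unitInterval) : ℝ) ≤ 1 then cell ψ i (_, θ') else _)
      rw [if_pos (by norm_num), if_pos (by norm_num),
        show 2 * ((0 : unitInterval) : ℝ) = 0 by norm_num, projIcc_left]
      exact cell_zero _ _ _ _)

theorem collarMap_base (h : ∀ i, (φ i).Homotopy (ψ i)) (x : S) :
    collarMap h (base φ x) = base ψ x := rfl

theorem collarMap_cell (h : ∀ i, (φ i).Homotopy (ψ i)) (i : ι) (ρ : unitInterval)
    (θ : UnitAddCircle) :
    collarMap h (cell φ i (ρ, θ)) =
      if 2 * (ρ : ℝ) ≤ 1 then cell ψ i (projIcc 0 1 zero_le_one (2 * (ρ : ℝ)), θ)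
        else base ψ (h i (projIcc 0 1 zero_le_one (2 - 2 * (ρ : ℝ)), θ)) := rfl

/-- The composite sends the radius `ρ` to the radius `min (4ρ) (1 + 2ρ)` in a disk of radius 3 whose
annulus beyond radius 1 runs `h` forth and back. The homotopy lets the outer radius `1 + 2u` grow
from 1 to 3, with the annulus running `h` only up to time `u`. -/
theorem collarMap_symm_comp (h : ∀ i, (φ i).Homotopy (ψ i)) :
    ((collarMap fun i => (h i).symm).comp (collarMap h)).Homotopic (ContinuousMap.id _) := by
  symm
  let x : (unitInterval × UnitAddCircle) × unitInterval → ℝ := fun y =>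
    (1 - (y.2 : ℝ)) * y.1.1 + y.2 * min (4 * (y.1.1 : ℝ)) (1 + 2 * (y.1.1 : ℝ))
  -- The time of `h` at radius `x`: it rises from 0 at `x = 1` to `u` and falls back to 0 at the
  -- outer radius `1 + 2u`, so the base stays fixed.
  let τ : (unitInterval × UnitAddCircle) × unitInterval → ℝ := fun y =>
    min (x y - 1) (1 + 2 * (y.2 : ℝ) - x y)
  have hx : Continuous x := by fun_prop
  have hτ : Continuous τ := by fun_prop
  let K : ι → C((unitInterval × UnitAddCircle) × unitInterval, Attachment φ) := fun i =>
    ⟨fun y => if x y ≤ 1 then cell φ i (projIcc 0 1 zero_le_one (x y), y.1.2)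
        else (base φ).comp (h i).toContinuousMap
          (projIcc 0 1 zero_le_one (τ y), y.1.2), by
      refine continuous_pasteCell _ _ hx hτ (by fun_prop) ?_
      intro y hy
      have : τ y ≤ 0 := (min_le_left _ _).trans (by rw [hy]; simp)
      rw [projIcc_of_le_left _ this, cell_one]
      exact congrArg _ ((h i).apply_zero _).symm⟩
  have hK : ∀ i y, K i y = if x y ≤ 1 then cell φ i (projIcc 0 1 zero_le_one (x y), y.1.2)
        else base φ (h i (projIcc 0 1 zero_le_one (τ y), y.1.2)) := fun i y => rfl
  refine ContinuousMap.homotopic_of_paths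
    (lift (ContinuousMap.curry ⟨fun y : S × unitInterval => base φ y.1, by fun_prop⟩)
      (fun i => (K i).curry) ?_ ?_) ?_ ?_
  · intro i θ
    ext u
    change K i ((1, θ), u) = base φ (φ i θ)
    have hu := u.2.1
    have hx1 : x ((1, θ), u) = 1 + 2 * (u : ℝ) := by
      simp only [x]
      norm_num
      ring
    have hτ1 : τ ((1, θ), u) ≤ 0 := (min_le_right _ _).trans (by simp [hx1])
    rw [hK, projIcc_of_le_left _ hτ1]
    split_ifs with hle
    · have : x ((1, θ), u) = 1 := le_antisymm hle (by linarith)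
      rw [this, projIcc_right]
      exact cell_one _ _ _
    · exact congrArg _ ((h i).apply_zero _)
  · intro i θ θ'
    ext u
    change K i ((0, θ), u) = K i ((0, θ'), u)
    have hx0 : ∀ θ, x ((0, θ), u) = 0 := fun θ => by simp [x]
    rw [hK, hK, hx0 θ, if_pos zero_le_one, if_pos zero_le_one, projIcc_left]
    exact cell_zero _ _ _ _
  · refine forall_of (fun y => rfl) fun i p => ?_
    obtain ⟨ρ, θ⟩ := p
    change K i ((ρ, θ), 0) = cell φ i (ρ, θ)
    have hx0 : x ((ρ, θ), 0) = ρ := by simp [x]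
    rw [hK, hx0, if_pos ρ.2.2, projIcc_val]
  · refine forall_of (fun y => rfl) fun i p => ?_
    obtain ⟨ρ, θ⟩ := p
    have hρ0 := ρ.2.1
    have hρ1 := ρ.2.2
    change K i ((ρ, θ), 1) = collarMap (fun i => (h i).symm) (collarMap h (cell φ i (ρ, θ)))
    have hx1 : x ((ρ, θ), 1) = min (4 * (ρ : ℝ)) (1 + 2 * (ρ : ℝ)) := by simp [x]
    have hτ1 : τ ((ρ, θ), 1) = min (x ((ρ, θ), 1) - 1) (3 - x ((ρ, θ), 1)) := by
      simp only [τ]; norm_num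
    rw [collarMap_cell, hK, hτ1, hx1]
    split_ifs with h1 h2 h2
    · have h3 : (ρ : ℝ) ≤ 1 / 4 := by
        rcases min_le_iff.1 h1 with h | h <;> linarith
      rw [collarMap_cell, projIcc_of_mem _ (show 2 * (ρ : ℝ) ∈ Icc (0 : ℝ) 1 from
        ⟨by linarith, by linarith⟩)]
      simp only
      rw [if_pos (by linarith), min_eq_left (by linarith)]
      congr 3
      ring
    · exfalso
      rcases min_le_iff.1 h1 with h | h <;> linarith
    · rw [collarMap_cell, projIcc_of_mem _ (show 2 * (ρ : ℝ) ∈ Icc (0 : ℝ) 1 from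
        ⟨by linarith, by linarith⟩)]
      simp only
      rw [min_eq_left (show 4 * (ρ : ℝ) ≤ 1 + 2 * ρ by linarith)] at h1 ⊢
      rw [if_neg (by linarith), min_eq_left (by linarith), ContinuousMap.Homotopy.symm_apply]
      congr 3
      apply Subtype.ext
      rw [unitInterval.coe_symm_eq, projIcc_of_mem _ (show 4 * (ρ : ℝ) - 1 ∈ Icc (0 : ℝ) 1 from
        ⟨by linarith, by linarith⟩), projIcc_of_mem _
          (show 2 - 2 * (2 * (ρ : ℝ)) ∈ Icc (0 : ℝ) 1 from ⟨by linarith, by linarith⟩)]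
      simp only
      ring
    · rw [collarMap_base, min_eq_right (show 1 + 2 * (ρ : ℝ) ≤ 4 * ρ by linarith),
        min_eq_right (by linarith)]
      congr 4
      ring

theorem homotopyEquiv_of_homotopic (h : ∀ i, (φ i).Homotopic (ψ i)) :
    Nonempty (ContinuousMap.HomotopyEquiv (Attachment φ) (Attachment ψ)) := by
  let H := fun i => (h i).some
  refine ⟨⟨collarMap H, collarMap fun i => (H i).symm, collarMap_symm_comp H, ?_⟩⟩
  have := collarMap_symm_comp fun i => (H i).symm
  simpa only [ContinuousMap.Homotopy.symm_symm] using this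

end Collar

/-- Reindexing the cells of an attachment. -/
def reindex {κ : Type*} (e : ι ≃ κ) (ψ : κ → C(UnitAddCircle, S)) :
    Attachment (fun i => ψ (e i)) ≃ₜ Attachment ψ where
  toFun := lift (base ψ) (fun i => cell ψ (e i)) (fun _ _ => cell_one _ _ _)
    (fun _ _ _ => cell_zero _ _ _ _)
  invFun := lift (base _) (fun j => cell (fun i => ψ (e i)) (e.symm j))
    (fun j θ => by rw [cell_one, e.apply_symm_apply]) (fun _ _ _ => cell_zero _ _ _ _)
  left_inv := forall_of (fun _ => rfl) fun i p => by
    simp only [lift_cell]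
    rw [e.symm_apply_apply]
  right_inv := forall_of (fun _ => rfl) fun i p => by
    simp only [lift_cell]
    rw [e.apply_symm_apply]
  continuous_toFun := ContinuousMap.continuous _
  continuous_invFun := ContinuousMap.continuous _

theorem homotopyEquiv_of_equiv {κ : Type*} {ψ : κ → C(UnitAddCircle, S)}
    (e : ι ≃ κ) (h : ∀ i, (φ i).Homotopic (ψ (e i))) :
    Nonempty (ContinuousMap.HomotopyEquiv (Attachment φ) (Attachment ψ)) := by
  obtain ⟨E⟩ := homotopyEquiv_of_homotopic h
  exact ⟨E.trans (reindex e ψ).toHomotopyEquiv⟩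

end Attachment

/-! ### Polar coordinates on the cells of a polygonal complex -/

/-- Polar coordinates on the closed unit disk. -/
noncomputable def polarDisk : C(unitInterval × UnitAddCircle, Metric.closedBall (0 : ℂ) 1) where
  toFun p := ⟨(p.1 : ℝ) * (AddCircle.toCircle p.2 : ℂ), by
    rw [mem_closedBall_zero_iff, norm_mul, Circle.norm_coe, mul_one, Complex.norm_real,
      Real.norm_of_nonneg p.1.2.1]
    exact p.1.2.2⟩
  continuous_toFun := by
    refine Continuous.subtype_mk ?_ _
    have := AddCircle.continuous_toCircle (T := (1 : ℝ))
    fun_prop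

theorem polarDisk_surjective : Function.Surjective polarDisk := by
  rintro ⟨z, hz⟩
  rw [mem_closedBall_zero_iff] at hz
  refine ⟨(⟨‖z‖, norm_nonneg z, hz⟩, ((z.arg / (2 * Real.pi) : ℝ) : UnitAddCircle)), ?_⟩
  apply Subtype.ext
  change ((‖z‖ : ℝ) : ℂ) * (AddCircle.toCircle _ : ℂ) = z
  rw [AddCircle.toCircle_apply_mk, Circle.coe_exp]
  have : (2 * Real.pi / 1 * (z.arg / (2 * Real.pi)) : ℝ) = z.arg := by
    field_simp
  rw [this, Complex.norm_mul_exp_arg_mul_I]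

/-- A continuous map from a compact space to a Hausdorff space is closed. Maps in polar coordinates
that are constant on the circle of radius 0 therefore descend to the disk. -/
theorem isQuotientMap_polarDisk : IsQuotientMap polarDisk :=
  (polarDisk.continuous.isClosedMap).isQuotientMap polarDisk.continuous polarDisk_surjective

theorem polarDisk_one (θ : UnitAddCircle) :
    polarDisk (1, θ) = PolygonalComplex.diskBoundary θ :=
  Subtype.ext (by change ((1 : ℝ) : ℂ) * _ = _; simp [PolygonalComplex.diskBoundary])

theorem polarDisk_zero (θ θ' : UnitAddCircle) : polarDisk (0, θ) = polarDisk (0, θ') :=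
  Subtype.ext (by change ((0 : ℝ) : ℂ) * _ = ((0 : ℝ) : ℂ) * _; simp)

theorem eq_or_of_polarDisk_eq {p q : unitInterval × UnitAddCircle}
    (h : polarDisk p = polarDisk q) : p = q ∨ (p.1 = 0 ∧ q.1 = 0) := by
  have h' := congrArg (fun z : Metric.closedBall (0 : ℂ) 1 => (z : ℂ)) h
  obtain ⟨ρ, θ⟩ := p
  obtain ⟨ρ', θ'⟩ := q
  change ((ρ : ℝ) : ℂ) * (AddCircle.toCircle θ : ℂ) = ((ρ' : ℝ) : ℂ) * (AddCircle.toCircle θ' : ℂ)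
    at h'
  have hn := congrArg norm h'
  rw [norm_mul, norm_mul, Circle.norm_coe, Circle.norm_coe, mul_one, mul_one, Complex.norm_real,
    Complex.norm_real, Real.norm_of_nonneg ρ.2.1, Real.norm_of_nonneg ρ'.2.1] at hn
  have hρ : ρ = ρ' := Subtype.ext hn
  subst hρ
  by_cases h0 : ρ = 0
  · exact Or.inr ⟨h0, h0⟩
  · left
    have h0' : ((ρ : ℝ) : ℂ) ≠ 0 := by
      intro h1
      exact h0 (Subtype.ext (by exact_mod_cast h1))
    have h2 := mul_left_cancel₀ h0' h'
    have h3 := AddCircle.injective_toCircle (T := (1 : ℝ)) one_ne_zero (Subtype.ext h2)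
    rw [h3]

namespace PolygonalComplex

variable (X : PolygonalComplex.{u})

/-- The inclusion of the 1-skeleton. -/
def skeletonMap : C(X.Skeleton, X.Realization) where
  toFun x := Quot.mk _ (Sum.inl x)
  continuous_toFun := continuous_quot_mk.comp continuous_inl

/-- The characteristic map of a 2-cell, in polar coordinates. -/
noncomputable def cellMap (f : X.F) : C(unitInterval × UnitAddCircle, X.Realization) where
  toFun p := Quot.mk _ (Sum.inr ⟨f, polarDisk p⟩)
  continuous_toFun := by
    have h : Continuous fun z : Metric.closedBall (0 : ℂ) 1 =>
        (Quot.mk X.RealizationRel (Sum.inr ⟨f, z⟩)) :=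
      continuous_quot_mk.comp (continuous_inr.comp continuous_sigmaMk)
    exact h.comp polarDisk.continuous

theorem cell_factorsThrough_polarDisk (f : X.F) :
    Function.FactorsThrough (Attachment.cell X.attach f) polarDisk := by
  intro p q h
  rcases eq_or_of_polarDisk_eq h with rfl | ⟨h1, h2⟩
  · rfl
  · obtain ⟨ρ, θ⟩ := p
    obtain ⟨ρ', θ'⟩ := q
    simp only at h1 h2
    subst h1 h2
    exact Attachment.cell_zero _ _ _ _

/-- A closed cell, as a map from the disk to the attachment. -/
noncomputable def diskMap (f : X.F) : C(Metric.closedBall (0 : ℂ) 1, Attachment X.attach) :=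
  isQuotientMap_polarDisk.lift _ (X.cell_factorsThrough_polarDisk f)

theorem diskMap_polarDisk (f : X.F) (p : unitInterval × UnitAddCircle) :
    X.diskMap f (polarDisk p) = Attachment.cell X.attach f p :=
  DFunLike.congr_fun (isQuotientMap_polarDisk.lift_comp _ (X.cell_factorsThrough_polarDisk f)) p

/-- The realization of a polygonal complex, with its cells in polar coordinates. -/
noncomputable def realizationHomeomorph : X.Realization ≃ₜ Attachment X.attach where
  toFun := Quot.lift (Sum.elim (Attachment.base X.attach) (fun x => X.diskMap x.1 x.2)) (by
    rintro _ _ ⟨f, θ⟩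
    simp only [Sum.elim_inr, Sum.elim_inl]
    rw [← Attachment.cell_one, ← polarDisk_one, diskMap_polarDisk])
  invFun := Attachment.lift X.skeletonMap X.cellMap
    (fun f θ => by
      change Quot.mk X.RealizationRel (Sum.inr ⟨f, polarDisk (1, θ)⟩) = _
      rw [polarDisk_one]
      exact Quot.sound (.glue f θ))
    (fun f θ θ' => by
      change Quot.mk X.RealizationRel (Sum.inr ⟨f, polarDisk (0, θ)⟩) =
        Quot.mk X.RealizationRel (Sum.inr ⟨f, polarDisk (0, θ')⟩)
      rw [polarDisk_zero θ θ'])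
  left_inv := by
    rintro ⟨x | ⟨f, z⟩⟩
    · rfl
    · obtain ⟨p, rfl⟩ := polarDisk_surjective z
      simp only [Sum.elim_inr, diskMap_polarDisk]
      rfl
  right_inv := Attachment.forall_of (fun x => rfl) fun f p => X.diskMap_polarDisk f p
  continuous_toFun := by
    refine continuous_quot_lift _ (Continuous.sumElim (ContinuousMap.continuous _) ?_)
    exact continuous_sigma fun i => (X.diskMap i).continuous
  continuous_invFun := ContinuousMap.continuous _

end PolygonalComplex

/-! ### Paths along a line -/

section Segment

variable {Z : Type*} [TopologicalSpace Z]

/-- The straight path in the real line. -/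
def realPath (x y : ℝ) : Path x y where
  toFun t := x + t * (y - x)
  continuous_toFun := by fun_prop
  source' := by simp
  target' := by simp

/-- The image of the straight path from `x` to `y` under a map from the real line. -/
def seg (α : C(ℝ, Z)) (x y : ℝ) : Path (α x) (α y) := (realPath x y).map α.continuous

theorem seg_apply (α : C(ℝ, Z)) (x y : ℝ) (t : unitInterval) :
    seg α x y t = α (x + t * (y - x)) := rfl

theorem homotopic_seg (α : C(ℝ, Z)) {x y : ℝ} (γ : Path x y) :
    (γ.map α.continuous).Homotopic (seg α x y) :=
  (SimplyConnectedSpace.paths_homotopic γ (realPath x y)).map α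

theorem seg_trans (α : C(ℝ, Z)) (x y z : ℝ) :
    ((seg α x y).trans (seg α y z)).Homotopic (seg α x z) := by
  have := homotopic_seg α ((realPath x y).trans (realPath y z))
  rwa [Path.map_trans] at this

/-- The line is simply connected, so the `ρ`-image of a straight path is homotopic to the straight
path between its end points. Folding thus removes backtracking without changing the homotopy class.
-/
theorem seg_homotopic_of_fold {α β : C(ℝ, Z)} {x y x' y' : ℝ} (ρ : C(ℝ, ℝ)) (hx : ρ x = x')
    (hy : ρ y = y') (h : ∀ t ∈ uIcc x y, α t = β (ρ t)) :
    (seg α x y).Homotopic ((seg β x' y').cast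
      (by rw [h x left_mem_uIcc, hx]) (by rw [h y right_mem_uIcc, hy])) := by
  subst hx hy
  have h1 := (homotopic_seg β ((realPath x y).map ρ.continuous)).pathCast
    (h x left_mem_uIcc) (h y right_mem_uIcc)
  convert h1 using 1
  ext t
  refine h _ ?_
  rw [← segment_eq_uIcc]
  exact ⟨1 - t, t, by linarith [t.2.2], t.2.1, by ring, by simp [realPath]; ring⟩

/-- Two maps on the circle which are based loops homotopic relative to the base point are
homotopic. -/
theorem circle_homotopic_of_path {A B : C(UnitAddCircle, Z)} {x y : Z} (hxy : x = y)
    (p q : Path x y) (hpq : p.Homotopic q)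
    (hA : ∀ t : unitInterval, A ((t : ℝ) : UnitAddCircle) = p t)
    (hB : ∀ t : unitInterval, B ((t : ℝ) : UnitAddCircle) = q t) : A.Homotopic B := by
  obtain ⟨F⟩ := hpq
  -- The homotopy with its variables exchanged: `γ t` is the track of the point `t`. The end points
  -- are fixed and equal, so `γ` descends to the circle.
  let γ : C(unitInterval, C(unitInterval, Z)) :=
    ContinuousMap.curry ⟨fun s => F (s.2, s.1), by fun_prop⟩
  have hγ : γ 0 = γ 1 := by
    ext t
    change F (t, 0) = F (t, 1)
    rw [F.source, F.target, hxy]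
  let g : ℝ → C(unitInterval, Z) := fun t => γ (projIcc 0 1 zero_le_one t)
  have hc : Continuous (AddCircle.liftIco (1 : ℝ) 0 g) := by
    refine AddCircle.liftIco_zero_continuous ?_ ?_
    · change γ (projIcc 0 1 zero_le_one 0) = γ (projIcc 0 1 zero_le_one 1)
      rw [projIcc_left, projIcc_right]
      exact hγ
    · exact (γ.continuous.comp continuous_projIcc).continuousOn
  have hval : ∀ t ∈ Ico (0 : ℝ) 1, AddCircle.liftIco (1 : ℝ) 0 g (t : UnitAddCircle) =
      γ (projIcc 0 1 zero_le_one t) := fun t ht => AddCircle.liftIco_zero_coe_apply ht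
  have hrep : ∀ θ : UnitAddCircle, ∃ t ∈ Ico (0 : ℝ) 1, (t : UnitAddCircle) = θ := by
    intro θ
    obtain ⟨t, ht, h⟩ := (AddCircle.coe_image_Ico_eq (1 : ℝ) 0).ge (mem_univ θ)
    exact ⟨t, by simpa using ht, h⟩
  refine ContinuousMap.homotopic_of_paths ⟨_, hc⟩ ?_ ?_
  · intro θ
    obtain ⟨t, ht, rfl⟩ := hrep θ
    change (AddCircle.liftIco (1 : ℝ) 0 g (t : UnitAddCircle)) 0 = _
    rw [hval t ht]
    have ht' : t ∈ Icc (0 : ℝ) 1 := ⟨ht.1, ht.2.le⟩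
    rw [projIcc_of_mem _ ht']
    change F (0, _) = _
    rw [F.apply_zero]
    exact (hA ⟨t, ht'⟩).symm
  · intro θ
    obtain ⟨t, ht, rfl⟩ := hrep θ
    change (AddCircle.liftIco (1 : ℝ) 0 g (t : UnitAddCircle)) 1 = _
    rw [hval t ht]
    have ht' : t ∈ Icc (0 : ℝ) 1 := ⟨ht.1, ht.2.le⟩
    rw [projIcc_of_mem _ ht']
    change F (1, _) = _
    rw [F.apply_one]
    exact (hB ⟨t, ht'⟩).symm

theorem circle_homotopic_rotate (A : C(UnitAddCircle, Z)) (c : ℝ) :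
    A.Homotopic (A.comp ⟨fun θ => θ + (c : UnitAddCircle), by fun_prop⟩) := by
  have hc : Continuous fun p : UnitAddCircle × unitInterval =>
      A (p.1 + (((p.2 : ℝ) * c : ℝ) : UnitAddCircle)) := by
    have : Continuous fun x : ℝ => (x : UnitAddCircle) := AddCircle.continuous_mk' 1
    fun_prop
  refine ContinuousMap.homotopic_of_paths (ContinuousMap.curry ⟨_, hc⟩) ?_ ?_
  · intro θ
    change A (θ + (((0 : unitInterval) : ℝ) * c : ℝ)) = _
    simp
  · intro θ
    change A (θ + (((1 : unitInterval) : ℝ) * c : ℝ)) = _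
    simp

/-- A map `α` of the line which runs, between `m k` and `m (k + 1)`, along the `k`-th unit
segment of `β` up to homotopy, describes the same free homotopy class as `β`. -/
theorem circle_homotopic_of_segments {A B : C(UnitAddCircle, Z)} {α β : C(ℝ, Z)} {N N' : ℕ}
    (hN : 0 < N) (hA : ∀ t : ℝ, A (t : UnitAddCircle) = α (N * t))
    (hB : ∀ t : ℝ, B (t : UnitAddCircle) = β (N' * t)) (m : ℤ → ℤ)
    (hm : ∀ k, m (k + N') = m k + N) (h0 : ∀ k : ℤ, α (m k) = β k)
    (hseg : ∀ k : ℤ, (seg α (m k) (m (k + 1))).Homotopic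
      ((seg β k ((k + 1 : ℤ) : ℝ)).cast (h0 k) (h0 (k + 1)))) : A.Homotopic B := by
  have key : ∀ n : ℕ, (seg α (m 0) (m n)).Homotopic
      ((seg β ((0 : ℤ) : ℝ) ((n : ℤ) : ℝ)).cast (h0 0) (h0 n)) := by
    intro n
    induction n with
    | zero =>
      refine (homotopic_seg α (Path.refl _)).symm.trans ?_
      refine Path.Homotopic.trans ?_ ((homotopic_seg β (Path.refl _)).pathCast (h0 0) (h0 0))
      convert Path.Homotopic.refl _ using 1
      ext t
      change β ((0 : ℤ) : ℝ) = α (m 0)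
      exact (h0 0).symm
    | succ n ih =>
      have h1 := ((ih.hcomp (hseg n)).symm.trans (seg_trans α _ _ _)).symm
      rw [← Path.cast_trans] at h1
      exact h1.trans ((seg_trans β _ _ _).pathCast _ _)
  have hN0 : (N : ℝ) ≠ 0 := by exact_mod_cast hN.ne'
  -- The rotation moves the base point of `A` to position `m 0`, which corresponds to position 0 of
  -- `β`. Over `N'` segments `α` then advances by `N`, exactly one turn.
  refine (circle_homotopic_rotate A ((m 0 : ℝ) / N)).trans ?_
  have h3 : m N' = m 0 + N := by simpa using hm 0
  refine circle_homotopic_of_path ?_ _ _ (key N') ?_ ?_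
  · rw [h0, h0]
    have e1 := hB 0
    have e2 := hB 1
    rw [show ((1 : ℝ) : UnitAddCircle) = 0 from AddCircle.coe_period 1] at e2
    simp only [mul_zero, mul_one, AddCircle.coe_zero] at e1 e2
    simp only [Int.cast_zero, Int.cast_natCast, ← e1, ← e2]
  · intro t
    change A ((t : ℝ) + ((m 0 : ℝ) / N : ℝ)) = _
    rw [← AddCircle.coe_add, hA, seg_apply, h3]
    congr 1
    push_cast
    field_simp
    ring
  · intro t
    rw [hB, Path.cast_coe, seg_apply]
    congr 1
    push_cast
    ring

/-- The loops homotopic to a map `θ ↦ B (k • θ)` of the circle with `k ≥ 2`. -/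
def FreePower (A : C(UnitAddCircle, Z)) : Prop :=
  ∃ (B : C(UnitAddCircle, Z)) (k : ℕ), 2 ≤ k ∧
    A.Homotopic (B.comp ⟨fun θ => k • θ, by fun_prop⟩)

theorem FreePower.of_homotopic {A A' : C(UnitAddCircle, Z)} (h : FreePower A)
    (hA : A.Homotopic A') : FreePower A' := by
  obtain ⟨B, k, hk, hB⟩ := h
  exact ⟨B, k, hk, hA.symm.trans hB⟩

/-- The path that runs once around the circle. -/
noncomputable def circlePath : Path (0 : UnitAddCircle) 0 where
  toFun s := ((s : ℝ) : UnitAddCircle)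
  continuous_toFun := (AddCircle.continuous_mk' (1 : ℝ)).comp continuous_subtype_val
  source' := by simp
  target' := AddCircle.coe_period 1

theorem mk_seg_eq_pow (β : C(ℝ, Z)) (hβ : ∀ t, β (t + 1) = β t) (n : ℕ) (h : β 0 = β n)
    (h1 : β 0 = β 1) :
    FundamentalGroup.fromPath (Path.Homotopic.Quotient.mk ((seg β 0 n).cast rfl h)) =
      (FundamentalGroup.fromPath (Path.Homotopic.Quotient.mk ((seg β 0 1).cast rfl h1))) ^ n := by
  have hper : ∀ (n : ℕ) (t : ℝ), β (n + t) = β t := by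
    intro n t
    induction n with
    | zero => simp
    | succ n ih => rw [← ih, ← hβ (n + t)]; congr 1; push_cast; ring
  induction n with
  | zero =>
    rw [pow_zero, FundamentalGroup.one_def]
    refine Path.Homotopic.Quotient.eq.2 ?_
    have e : (seg β 0 ((0 : ℕ) : ℝ)).cast rfl h = Path.refl (β 0) := by
      ext t
      simp [seg_apply]
    exact e ▸ Path.Homotopic.refl _
  | succ n ih =>
    have hn : β 0 = β n := by have := hper n 0; rw [add_zero] at this; exact this.symm
    rw [pow_succ', FundamentalGroup.mul_def, ← ih hn]
    change _ = (Path.Homotopic.Quotient.mk _).trans (Path.Homotopic.Quotient.mk _)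
    rw [← Path.Homotopic.Quotient.mk_trans]
    refine Path.Homotopic.Quotient.eq.2 ?_
    have h2 := (seg_trans β 0 n ((n + 1 : ℕ) : ℝ)).symm.pathCast rfl h
    rw [Path.cast_trans _ _ rfl hn h] at h2
    convert h2 using 2
    ext t
    change β (0 + t * (1 - 0)) = β (n + t * (((n + 1 : ℕ) : ℝ) - n))
    rw [hper]
    congr 1
    push_cast
    ring

/-- A free homotopy to `θ ↦ B (k • θ)` moves the base point along a path `δ`. Conjugation by `δ`
carries the class of `p` to the `k`-th power of the class of `B`, and the root is pulled back along
this isomorphism. The algebraic hypothesis thereby becomes one on free homotopy classes, which is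
stable under rotation and reduction. -/
theorem FreePower.isProperPower {A : C(UnitAddCircle, Z)} (h : FreePower A) (p : Path (A 0) (A 0))
    (hp : ∀ t : unitInterval, p t = A ((t : ℝ) : UnitAddCircle)) :
    IsProperPower (FundamentalGroup.fromPath (Path.Homotopic.Quotient.mk p)) := by
  obtain ⟨B, k, hk, ⟨F⟩⟩ := h
  let β : C(ℝ, Z) := ⟨fun t => B (t : UnitAddCircle),
    B.continuous.comp (AddCircle.continuous_mk' (1 : ℝ))⟩
  have hβ : ∀ t, β (t + 1) = β t := fun t => by
    change B _ = B _
    rw [AddCircle.coe_add_period]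
  have hk0 : β 0 = β k := by
    change B ((0 : ℝ) : UnitAddCircle) = B ((k : ℝ) : UnitAddCircle)
    have h2 : ((k : ℝ) : UnitAddCircle) = k • ((1 : ℝ) : UnitAddCircle) := by
      rw [← AddCircle.coe_nsmul]; simp
    rw [h2, AddCircle.coe_period]; simp
  have h10 : β 0 = β 1 := by rw [← hβ, zero_add]
  have hb : (B.comp ⟨fun θ => k • θ, by fun_prop⟩ : C(UnitAddCircle, Z)) 0 = β 0 := by
    change B (k • 0) = B ((0 : ℝ) : UnitAddCircle)
    simp
  have hpc : p = circlePath.map A.continuous := by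
    ext t
    exact hp t
  let δ : Path (A 0) (β 0) := (F.evalAt 0).cast rfl hb.symm
  have h3 := Path.Homotopic.map_trans_evalAt F circlePath
  have h4 : (p.trans δ).Homotopic (δ.trans ((seg β 0 k).cast rfl hk0)) := by
    have h5 := h3.pathCast rfl hb.symm
    rw [Path.cast_trans _ _ rfl rfl hb.symm, Path.cast_trans _ _ rfl hb.symm hb.symm,
      Path.cast_rfl_rfl, ← hpc] at h5
    convert h5 using 2
    ext t
    change B _ = B (k • _)
    change _ = B (k • ((t : ℝ) : UnitAddCircle))
    rw [← AddCircle.coe_nsmul]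
    congr 2
    simp [realPath, mul_comm]
  let e := FundamentalGroup.fundamentalGroupMulEquivOfPath δ
  refine ⟨e.symm (FundamentalGroup.fromPath
    (Path.Homotopic.Quotient.mk ((seg β 0 1).cast rfl h10))), k, hk, ?_⟩
  rw [← map_pow, ← mk_seg_eq_pow β hβ k hk0 h10, MulEquiv.eq_symm_apply]
  have h6 := Path.Homotopic.Quotient.eq.2 h4
  rw [Path.Homotopic.Quotient.mk_trans, Path.Homotopic.Quotient.mk_trans] at h6
  change (Path.Homotopic.Quotient.mk δ).symm.trans
    ((Path.Homotopic.Quotient.mk p).trans (Path.Homotopic.Quotient.mk δ)) = _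
  rw [h6, ← Path.Homotopic.Quotient.trans_assoc, Path.Homotopic.Quotient.symm_trans,
    Path.Homotopic.Quotient.refl_trans]

end Segment

/-! ### Deleting backtracks from loops -/

theorem exists_int_add_of_mem_Icc {a b : ℤ} (hab : a < b) {t : ℝ} (ht : t ∈ Icc (a : ℝ) b) :
    ∃ (l : ℤ) (v : unitInterval), a ≤ l ∧ l < b ∧ t = l + v := by
  rcases ht.2.lt_or_eq with h | h
  · exact ⟨⌊t⌋, ⟨Int.fract t, Int.fract_nonneg t, (Int.fract_lt_one t).le⟩,
      Int.le_floor.2 ht.1, Int.floor_lt.2 h, (Int.floor_add_fract t).symm⟩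
  · refine ⟨b - 1, 1, by omega, by omega, ?_⟩
    rw [h]
    push_cast
    ring

/-- Deleting backtracks `x c x⁻¹`, with `c` constant, from a loop does not change its free
homotopy class. -/
theorem circle_homotopic_of_reduction {Z : Type*} [TopologicalSpace Z] {A B : C(UnitAddCircle, Z)}
    {N N' : ℕ} (hN : 0 < N) (hN' : 0 < N') {p p' : ℤ → unitInterval → Z}
    (hA : ∀ (k : ℤ) (t : unitInterval), A ((((k : ℝ) + t) / N : ℝ) : UnitAddCircle) = p k t)
    (hB : ∀ (k : ℤ) (t : unitInterval), B ((((k : ℝ) + t) / N' : ℝ) : UnitAddCircle) = p' k t)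
    (m : ℤ → ℤ) (hm : ∀ k, m (k + N') = m k + N) (hp : ∀ k, p (m k) = p' k)
    (hback : ∀ k, ∃ i j : ℤ, m k + 1 ≤ i ∧ i ≤ j ∧ i - (m k + 1) = m (k + 1) - j ∧
      (∃ z, ∀ l, i ≤ l → l < j → ∀ t, p l t = z) ∧
      ∀ s, 0 ≤ s → s < m (k + 1) - j → ∀ t, p (j + s) t = p (i - 1 - s) (unitInterval.symm t)) :
    A.Homotopic B := by
  have hc : ∀ M : ℕ, Continuous fun t : ℝ => ((t / M : ℝ) : UnitAddCircle) := fun M =>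
    (AddCircle.continuous_mk' (1 : ℝ)).comp (continuous_id.div_const _)
  let α : C(ℝ, Z) := ⟨fun t => A ((t / N : ℝ) : UnitAddCircle), A.continuous.comp (hc N)⟩
  let β : C(ℝ, Z) := ⟨fun t => B ((t / N' : ℝ) : UnitAddCircle), B.continuous.comp (hc N')⟩
  have hα : ∀ (k : ℤ) (t : unitInterval), α (k + t) = p k t := hA
  have hβ : ∀ (k : ℤ) (t : unitInterval), β (k + t) = p' k t := hB
  have hα0 : ∀ k : ℤ, α k = p k 0 := fun k => by rw [← hα]; simp
  have hα1 : ∀ k : ℤ, α (k + 1) = p k 1 := fun k => by rw [← hα]; simp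
  have hβ0 : ∀ k : ℤ, β k = p' k 0 := fun k => by rw [← hβ]; simp
  have h0 : ∀ k : ℤ, α (m k) = β k := fun k => by rw [hα0, hβ0, hp]
  have hNr : (N : ℝ) ≠ 0 := by exact_mod_cast hN.ne'
  have hNr' : (N' : ℝ) ≠ 0 := by exact_mod_cast hN'.ne'
  refine circle_homotopic_of_segments (α := α) (β := β) hN
    (fun t => by change _ = A _; congr 2; field_simp)
    (fun t => by change _ = B _; congr 2; field_simp) m hm h0 fun k => ?_
  obtain ⟨i, j, hi, hij, hlen, ⟨z, hz⟩, hsym⟩ := hback k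
  have hiR : (m k : ℝ) + 1 ≤ i := by exact_mod_cast hi
  have hijR : (i : ℝ) ≤ j := by exact_mod_cast hij
  have hlenR : (i : ℝ) - (m k + 1) = m (k + 1) - j := by exact_mod_cast hlen
  -- The fold runs forward to `i`, rests there during the constant stretch `[i, j]`, and then runs
  -- back. It ends at `i + j - m (k + 1) = m k + 1`, so only the kept segment `[m k, m k + 1]`
  -- survives.
  let ρ : C(ℝ, ℝ) := ⟨fun t => min t (min (i : ℝ) (i + j - t)), by fun_prop⟩
  have hρ : ∀ t, ρ t = min t (min (i : ℝ) (i + j - t)) := fun t => rfl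
  have hρ1 : ρ (m k) = m k := by
    rw [hρ]; exact min_eq_left (le_min (by linarith) (by linarith))
  have hρ2 : ρ (m (k + 1)) = ((m k : ℝ) + 1) := by
    rw [hρ, min_eq_right, min_eq_right]
    · linarith
    · linarith
    · rw [min_eq_right] <;> linarith
  have hmain : ∀ t ∈ uIcc (m k : ℝ) (m (k + 1)), α t = α (ρ t) := by
    intro t ht
    rw [uIcc_of_le (by linarith)] at ht
    rcases le_total t i with h1 | h1
    · rw [hρ, min_eq_left (le_min h1 (by linarith))]
    rcases le_total t j with h2 | h2
    · rw [hρ, min_eq_left (show (i : ℝ) ≤ i + j - t by linarith), min_eq_right h1]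
      rcases hij.lt_or_eq with h3 | h3
      · obtain ⟨l, v, hl1, hl2, rfl⟩ := exists_int_add_of_mem_Icc h3 ⟨h1, h2⟩
        rw [hα, hα0, hz l hl1 hl2, hz i le_rfl h3]
      · rw [h3] at h1 ⊢
        rw [le_antisymm h2 h1]
    · rw [hρ, min_eq_right (show (i : ℝ) + j - t ≤ i by linarith),
        min_eq_right (show (i : ℝ) + j - t ≤ t by linarith)]
      rcases (show j ≤ m (k + 1) by omega).lt_or_eq with h3 | h3
      · obtain ⟨l, v, hl1, hl2, rfl⟩ := exists_int_add_of_mem_Icc h3 ⟨h2, ht.2⟩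
        have h4 := hsym (l - j) (by omega) (by omega) v
        rw [show j + (l - j) = l by ring] at h4
        rw [hα, h4, ← hα]
        congr 1
        rw [unitInterval.coe_symm_eq]
        push_cast
        ring
      · have h4 : t = j := le_antisymm (by rw [h3]; exact ht.2) h2
        rw [h4]
        rcases hij.lt_or_eq with h5 | h5
        · have h6 := hα1 (j - 1)
          have h7 : (((j - 1 : ℤ) : ℝ) + 1) = j := by push_cast; ring
          rw [h7] at h6
          rw [show (i : ℝ) + j - j = i by ring, h6, hα0, hz _ (by omega) (by omega),
            hz i le_rfl h5]
        · rw [h5]; congr 1; ring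
  have hshort : ∀ t ∈ uIcc (m k : ℝ) (m k + 1), α t = β (ContinuousMap.mk
      (fun t : ℝ => t - m k + k) (by fun_prop) t) := by
    intro t ht
    rw [uIcc_of_le (by linarith)] at ht
    obtain ⟨l, v, hl1, hl2, rfl⟩ := exists_int_add_of_mem_Icc (a := m k) (b := m k + 1) (by omega)
      ⟨ht.1, by push_cast; exact ht.2⟩
    obtain rfl : l = m k := by omega
    rw [hα, hp, ← hβ]
    simp only [ContinuousMap.coe_mk]
    congr 1
    ring
  have e1 := seg_homotopic_of_fold (α := α) (β := α) ρ hρ1 hρ2 hmain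
  have e2 := seg_homotopic_of_fold (α := α) (β := β) (x' := k) (y' := ((k + 1 : ℤ) : ℝ))
    _ (by simp) (by push_cast; simp only [ContinuousMap.coe_mk]; ring) hshort
  exact e1.trans (e2.pathCast _ _)

/-! ### Boundary words of cells and their overlaps -/

namespace OrGraph

variable {G : OrGraph.{u}}

theorem rev_rev (d : G.Dart) : G.rev (G.rev d) = d := by simp [rev]

theorem tail_rev (d : G.Dart) : G.tail (G.rev d) = G.head d := by
  rcases d with ⟨e, _ | _⟩ <;> simp [rev, tail, head]

theorem head_rev (d : G.Dart) : G.head (G.rev d) = G.tail d := by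
  rcases d with ⟨e, _ | _⟩ <;> simp [rev, tail, head]

theorem rev_ne (d : G.Dart) : G.rev d ≠ d := by
  rcases d with ⟨e, _ | _⟩ <;> simp [rev]

theorem eq_or_eq_rev_of_fst_eq {d d' : G.Dart} (h : d.1 = d'.1) : d = d' ∨ d = G.rev d' := by
  rcases d with ⟨e, _ | _⟩ <;> rcases d' with ⟨e', _ | _⟩ <;> simp_all [rev]

theorem dartPoint_rev (d : G.Dart) (s : unitInterval) :
    G.dartPoint (G.rev d) s = G.dartPoint d (unitInterval.symm s) := by
  rcases d with ⟨e, _ | _⟩ <;> simp [rev, dartPoint]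

end OrGraph

namespace PolygonalComplex

variable {X : PolygonalComplex.{u}}

theorem attachLine_add (f : X.F) (k : ℤ) (t : unitInterval) :
    X.attachLine f (k + t) = X.dartPoint (X.bd f k) t := by
  rw [X.attachLine_eq f k ⟨by linarith [t.2.1], by linarith [t.2.2]⟩, add_sub_cancel_left,
    projIcc_val]

theorem attach_coe (f : X.F) (t : ℝ) :
    X.attach f (t : UnitAddCircle) = X.attachLine f (X.len f * t) := rfl

theorem len_ne_zero (f : X.F) : (X.len f : ℝ) ≠ 0 := by exact_mod_cast (X.len_pos f).ne'

theorem attach_div (f : X.F) (t : ℝ) :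
    X.attach f ((t / X.len f : ℝ) : UnitAddCircle) = X.attachLine f t := by
  rw [attach_coe, mul_div_cancel₀ _ (len_ne_zero f)]

theorem attach_div_add (f : X.F) (k : ℤ) (t : unitInterval) :
    X.attach f ((((k : ℝ) + t) / X.len f : ℝ) : UnitAddCircle) = X.dartPoint (X.bd f k) t := by
  rw [attach_div, attachLine_add]

/-- No attaching map is freely homotopic to a proper power, and the attaching maps of distinct
cells are not freely homotopic up to direction. -/
structure IsIndependent (X : PolygonalComplex.{u}) : Prop where
  not_power : ∀ f : X.F, ¬ FreePower (X.attach f)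
  not_homotopic : ∀ f g : X.F, f ≠ g →
    ¬ (X.attach f).Homotopic (X.attach g) ∧ ¬ (X.attach f).Homotopic (X.attachRev g)

theorem IsAcceptable.isIndependent (h : X.IsAcceptable) : X.IsIndependent where
  not_power f hf := h.not_power f (hf.isProperPower (X.attachPath f) fun _ => rfl)
  not_homotopic := h.not_homotopic

/-- Otherwise `gcd (len f) d`, which is again a period, would be a proper divisor of `len f`, and
the attaching map would run `k ≥ 2` times around the closed path with this period, against
`not_power`. -/
theorem IsIndependent.len_dvd (hX : X.IsIndependent) (f : X.F) {d : ℤ}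
    (hd : Function.Periodic (X.bd f) d) : (X.len f : ℤ) ∣ d := by
  have hL := X.len_pos f
  set e := Int.gcd (X.len f) d with he
  have hepos : 0 < e := Int.gcd_pos_of_ne_zero_left _ (by exact_mod_cast hL.ne')
  have hper : Function.Periodic (X.bd f) (e : ℤ) := by
    rw [he, Int.gcd_eq_gcd_ab]
    have h1 := (show Function.Periodic (X.bd f) (X.len f : ℤ) from X.bd_periodic f).int_mul
      (Int.gcdA (X.len f) d)
    have h2 := hd.int_mul (Int.gcdB (X.len f) d)
    simp only [Int.cast_id] at h1 h2
    rw [mul_comm (X.len f : ℤ), mul_comm d]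
    exact h1.add_period h2
  obtain ⟨k, hk⟩ : e ∣ X.len f := by exact_mod_cast Int.gcd_dvd_left (X.len f : ℤ) d
  have hed : (e : ℤ) ∣ d := Int.gcd_dvd_right _ _
  by_cases hk1 : k = 1
  · rw [hk, hk1, mul_one]; exact hed
  exfalso
  have hk2 : 2 ≤ k := by
    rcases k with _ | _ | k
    · omega
    · omega
    · omega
  let Y : PolygonalComplex.{u} :=
    { toOrGraph := X.toOrGraph
      F := PUnit
      len := fun _ => e
      len_pos := fun _ => hepos
      bd := fun _ => X.bd f
      bd_periodic := fun _ => hper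
      bd_chain := fun _ => X.bd_chain f }
  refine hX.not_power f ⟨Y.attach PUnit.unit, k, hk2, ?_⟩
  convert ContinuousMap.Homotopic.refl _ using 1
  ext θ
  induction θ using QuotientAddGroup.induction_on with | _ t =>
  change Y.attach PUnit.unit (k • (t : UnitAddCircle)) = X.attach f (t : UnitAddCircle)
  rw [← AddCircle.coe_nsmul, attach_coe, attach_coe]
  change X.attachLine f (e * _) = _
  congr 1
  rw [hk]
  push_cast
  simp
  ring

/-- A weak form of the Fine–Wilf theorem. Agreement on `p + q` letters gives `a` the period of `b`,
because `a (s + q) = b (s + q) = b s = a s` for `0 ≤ s < p`. Two sequences of period `q` that agree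
on one period are equal. -/
theorem eq_of_agree {D : Type*} {a b : ℤ → D} {p q : ℕ} (hp : 0 < p) (hq : 0 < q)
    (ha : Function.Periodic a (p : ℤ)) (hb : Function.Periodic b (q : ℤ))
    (h : ∀ k : ℕ, k < p + q → a k = b k) (k : ℤ) : a k = b k := by
  have red : ∀ {c : ℤ → D} {r : ℕ}, 0 < r → Function.Periodic c (r : ℤ) → ∀ k : ℤ,
      ∃ s : ℕ, s < r ∧ (s : ℤ) = k % r ∧ c k = c s := by
    intro c r hr hc k
    have h0 : (r : ℤ) ≠ 0 := by exact_mod_cast hr.ne'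
    obtain ⟨s, hs⟩ := Int.eq_ofNat_of_zero_le (Int.emod_nonneg k h0)
    refine ⟨s, ?_, hs.symm, ?_⟩
    · have := Int.emod_lt_of_pos k (show (0 : ℤ) < r by exact_mod_cast hr)
      omega
    · have h1 := hc.int_mul (k / r) s
      rw [← h1]
      congr 1
      have h2 := Int.emod_add_mul_ediv k r
      simp only [Int.cast_id]
      rw [← hs]
      linarith [mul_comm (r : ℤ) (k / r)]
  have haq : Function.Periodic a (q : ℤ) := by
    intro k
    obtain ⟨s, hs, hs', hks⟩ := red hp ha k
    have h1 : a (k + q) = a (s + q) := by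
      have h2 := ha.int_mul (k / p) (s + q)
      rw [← h2]
      congr 1
      have h3 := Int.emod_add_mul_ediv k p
      simp only [Int.cast_id]
      rw [hs']
      linarith [mul_comm (p : ℤ) (k / p)]
    rw [h1, hks, h s (by omega)]
    have h4 := h (s + q) (by omega)
    push_cast at h4
    rw [h4, hb]
  obtain ⟨s, hs, hs', hks⟩ := red hq haq k
  obtain ⟨s', hs1, hs1', hks'⟩ := red hq hb k
  have : s = s' := by omega
  rw [hks, hks', ← this, h s (by omega)]

variable (X) in
/-- Two boundary paths that agree along `M` edges are the same. -/
def AgreementBound (M : ℕ) : Prop :=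
  ∀ (f : X.F) (i : ℤ) (g : X.F) (j : ℤ) (pos : Bool),
    (∀ k < M, X.bd f (i + k) = X.readFrom g j pos k) →
      f = g ∧ pos = true ∧ i ≡ j [ZMOD X.len f]

theorem attachLine_eq_of_shift {f g : X.F} {i j : ℤ} (h : ∀ k, X.bd f (i + k) = X.bd g (j + k))
    (t : ℝ) : X.attachLine f (i + t) = X.attachLine g (j + t) := by
  have e : ∀ l : ℤ, (l : ℝ) + t = ((l + ⌊t⌋ : ℤ) : ℝ) +
      (⟨Int.fract t, Int.fract_nonneg t, (Int.fract_lt_one t).le⟩ : unitInterval) := by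
    intro l
    push_cast
    rw [add_assoc, Int.floor_add_fract]
  rw [e, e, attachLine_add, attachLine_add, h]

theorem attachLine_eq_of_reflect {f g : X.F} {i j : ℤ}
    (h : ∀ k, X.bd f (i + k) = X.rev (X.bd g (j - 1 - k))) (t : ℝ) :
    X.attachLine f (i + t) = X.attachLine g (j - t) := by
  set v : unitInterval := ⟨Int.fract t, Int.fract_nonneg t, (Int.fract_lt_one t).le⟩
  have hv : (v : ℝ) = t - ⌊t⌋ := rfl
  have e1 : (i : ℝ) + t = ((i + ⌊t⌋ : ℤ) : ℝ) + v := by push_cast; linarith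
  have e2 : (j : ℝ) - t = ((j - 1 - ⌊t⌋ : ℤ) : ℝ) + (unitInterval.symm v : unitInterval) := by
    rw [unitInterval.coe_symm_eq]; push_cast; linarith
  rw [e1, e2, attachLine_add, attachLine_add, h, OrGraph.dartPoint_rev]

/-- By `eq_of_agree` the two boundary lines, one of them possibly reversed, coincide on all of `ℤ`.
If `f ≠ g`, each length is a period of the other word, so the lengths are equal by `len_dvd` and the
attaching maps differ by a rotation, possibly composed with a reversal; this contradicts
independence. If `f = g` and the directions agree, the shift is a period and hence a multiple of the
length. A reduced word is never its own reverse. -/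
theorem IsIndependent.agreementBound (hX : X.IsIndependent) (hred : X.IsReduced) {L : ℕ}
    (hL : ∀ f, X.len f ≤ L) : X.AgreementBound (2 * L) := by
  intro f i g j pos h
  have hfp : ∀ (f : X.F) (c : ℤ), Function.Periodic (fun k => X.bd f (c + k)) (X.len f : ℤ) := by
    intro f c k
    simp only
    rw [← add_assoc, X.bd_periodic]
  have hlf := X.len_pos f
  have hlg := X.len_pos g
  have hLf := hL f
  have hLg := hL g
  cases pos with
  | true =>
    have h1 : ∀ k, X.bd f (i + k) = X.bd g (j + k) :=
      eq_of_agree hlf hlg (hfp f i) (hfp g j) fun k hk => by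
        have := h k (by omega)
        simpa [readFrom] using this
    have hd1 : (X.len f : ℤ) ∣ X.len g := hX.len_dvd f fun k => by
      have := h1 (k + X.len g - i)
      rw [show i + (k + X.len g - i) = k + X.len g by ring,
        show j + (k + (X.len g : ℤ) - i) = (j + (k - i)) + X.len g by ring, X.bd_periodic,
        ← h1] at this
      rw [this]; congr 1; ring
    have hd2 : (X.len g : ℤ) ∣ X.len f := hX.len_dvd g fun k => by
      have := h1 (k + X.len f - j)
      rw [show j + (k + X.len f - j) = k + X.len f by ring,
        show i + (k + (X.len f : ℤ) - j) = (i + (k - j)) + X.len f by ring, X.bd_periodic,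
        h1] at this
      rw [← this]; congr 1; ring
    have hlen : X.len f = X.len g :=
      Nat.dvd_antisymm (by exact_mod_cast hd1) (by exact_mod_cast hd2)
    by_cases hfg : f = g
    · subst hfg
      refine ⟨rfl, rfl, ?_⟩
      have : (X.len f : ℤ) ∣ j - i := hX.len_dvd f fun k => by
        have := h1 (k - i)
        rw [show i + (k - i) = k by ring] at this
        rw [this]; congr 1; ring
      exact Int.modEq_iff_dvd.2 this
    · exfalso
      refine (hX.not_homotopic f g hfg).1 ?_
      have h2 := circle_homotopic_rotate (X.attach g) (((j - i : ℤ) : ℝ) / X.len g)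
      refine (h2.trans ?_).symm
      convert ContinuousMap.Homotopic.refl _ using 1
      ext θ
      induction θ using QuotientAddGroup.induction_on with | _ t =>
      change X.attach f (t : UnitAddCircle) = X.attach g ((t : UnitAddCircle) +
        ((((j - i : ℤ) : ℝ) / X.len g : ℝ) : UnitAddCircle))
      rw [← AddCircle.coe_add, attach_coe, attach_coe, mul_add, mul_div_cancel₀ _ (len_ne_zero g),
        hlen]
      have h3 := attachLine_eq_of_shift h1 (X.len g * t - i)
      rw [show (i : ℝ) + (X.len g * t - i) = X.len g * t by ring] at h3
      rw [h3]
      congr 1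
      push_cast
      ring
  | false =>
    exfalso
    have h1 : ∀ k, X.bd f (i + k) = X.rev (X.bd g (j - 1 - k)) :=
      eq_of_agree (b := fun k => X.rev (X.bd g (j - 1 - k))) hlf hlg (hfp f i) (fun k => by
        have := X.bd_periodic g (j - 1 - (k + X.len g))
        rw [show j - 1 - (k + (X.len g : ℤ)) + X.len g = j - 1 - k by ring] at this
        simp only
        rw [this]) fun k hk => by
        have := h k (by omega)
        simpa [readFrom] using this
    by_cases hfg : f = g
    · subst hfg
      -- A reflection of the line fixes the midpoint of an edge, which would equal its own reverse,
      -- or a vertex, at which the word would backtrack. The parity decides which.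
      rcases Int.even_or_odd' (j - 1 - i) with ⟨c, hc | hc⟩
      · have := h1 c
        rw [show j - 1 - c = i + c by omega] at this
        exact OrGraph.rev_ne _ this.symm
      · have := h1 (c + 1)
        rw [show j - 1 - (c + 1) = i + c by omega, ← add_assoc] at this
        exact hred f _ this
    · have h1' : ∀ k, X.bd g (j - 1 - k) = X.rev (X.bd f (i + k)) := fun k => by
        rw [h1, OrGraph.rev_rev]
      have hd1 : (X.len f : ℤ) ∣ X.len g := hX.len_dvd f fun k => by
        have := h1 (k + X.len g - i)
        rw [show i + (k + X.len g - i) = k + X.len g by ring] at this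
        rw [this]
        have h4 := X.bd_periodic g (j - 1 - (k + X.len g - i))
        rw [← h4, show j - 1 - (k + (X.len g : ℤ) - i) + X.len g = j - 1 - (k - i) by ring, ← h1]
        congr 1; ring
      have hd2 : (X.len g : ℤ) ∣ X.len f := hX.len_dvd g fun k => by
        have := h1' (j - 1 - (k + X.len f))
        rw [show j - 1 - (j - 1 - (k + (X.len f : ℤ))) = k + X.len f by ring] at this
        rw [this]
        have h4 := X.bd_periodic f (i + (j - 1 - (k + X.len f)))
        rw [← h4, show i + (j - 1 - (k + (X.len f : ℤ))) + X.len f = i + (j - 1 - k) by ring,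
          ← h1']
        congr 1; ring
      have hlen : X.len f = X.len g :=
        Nat.dvd_antisymm (by exact_mod_cast hd1) (by exact_mod_cast hd2)
      refine (hX.not_homotopic f g hfg).2 ?_
      have h2 := circle_homotopic_rotate (X.attachRev g) (((- (j + i) : ℤ) : ℝ) / X.len g)
      refine (h2.trans ?_).symm
      convert ContinuousMap.Homotopic.refl _ using 1
      ext θ
      induction θ using QuotientAddGroup.induction_on with | _ t =>
      change X.attach f (t : UnitAddCircle) = X.attach g (-((t : UnitAddCircle) +
        ((((-(j + i) : ℤ) : ℝ) / X.len g : ℝ) : UnitAddCircle)))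
      rw [← AddCircle.coe_add, ← AddCircle.coe_neg, attach_coe, attach_coe, mul_neg, mul_add,
        mul_div_cancel₀ _ (len_ne_zero g), hlen]
      have h3 := attachLine_eq_of_reflect h1 (X.len g * t - i)
      rw [show (i : ℝ) + (X.len g * t - i) = X.len g * t by ring] at h3
      rw [h3]
      congr 1
      push_cast
      ring

end PolygonalComplex

/-! ### Cyclic reduction of the attaching maps -/

/-- Deleting edges and their immediate reversals from a closed edge path does not change its free
homotopy class. -/
theorem OrGraph.circle_homotopic_of_backtracks {G : OrGraph.{u}} {A B : C(UnitAddCircle, G.Skeleton)}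
    {N N' : ℕ} (hN : 0 < N) (hN' : 0 < N') {a b : ℤ → G.Dart}
    (hA : ∀ (k : ℤ) (t : unitInterval),
      A ((((k : ℝ) + t) / N : ℝ) : UnitAddCircle) = G.dartPoint (a k) t)
    (hB : ∀ (k : ℤ) (t : unitInterval),
      B ((((k : ℝ) + t) / N' : ℝ) : UnitAddCircle) = G.dartPoint (b k) t)
    (m : ℤ → ℤ) (hm : ∀ k, m (k + N') = m k + N) (hab : ∀ k, b k = a (m k))
    (hback : ∀ k, m (k + 1) = m k + 1 ∨
      (m (k + 1) = m k + 3 ∧ a (m k + 2) = G.rev (a (m k + 1)))) : A.Homotopic B := by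
  refine circle_homotopic_of_reduction hN hN' hA hB m hm (fun k => by rw [hab]) fun k => ?_
  rcases hback k with h | ⟨h, h'⟩
  · exact ⟨m k + 1, m k + 1, le_rfl, le_rfl, by omega, ⟨G.dartPoint (a 0) 0, by omega⟩, by omega⟩
  · refine ⟨m k + 2, m k + 2, by omega, le_rfl, by omega, ⟨G.dartPoint (a 0) 0, by omega⟩, ?_⟩
    intro s hs hs' t
    obtain rfl : s = 0 := by omega
    rw [add_zero, h', show m k + 2 - 1 - 0 = m k + 1 by ring, dartPoint_rev]

/-- The positions that are left when one deletes two letters out of every `N + 2`. -/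
theorem skipTwo_spec {N : ℕ} (hN : 0 < N) (c : ℤ) (m : ℤ → ℤ)
    (hm : ∀ k, m k = k + 2 * ((k - c) / N)) :
    (∀ k, m (k + N) = m k + (N + 2 : ℕ)) ∧
      ∀ k, m (k + 1) = m k + 1 ∨ (m (k + 1) = m k + 3 ∧ ((N + 2 : ℕ) : ℤ) ∣ m k + 3 - c) := by
  have h0 : (N : ℤ) ≠ 0 := by exact_mod_cast hN.ne'
  have hpos : (0 : ℤ) < N := by exact_mod_cast hN
  constructor
  · intro k
    rw [hm, hm, show k + (N : ℤ) - c = k - c + N * 1 by ring, Int.add_mul_ediv_left _ _ h0]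
    push_cast
    ring
  · intro k
    rw [hm, hm]
    have e1 := Int.emod_add_mul_ediv (k - c) N
    have r0 := Int.emod_nonneg (k - c) h0
    have r1 := Int.emod_lt_of_pos (k - c) hpos
    set q := (k - c) / (N : ℤ)
    set r := (k - c) % (N : ℤ)
    -- A jump occurs only at the end of a run of `N` letters, where `r = N - 1`. The two skipped
    -- positions are congruent to `c - 2` and `c - 1` modulo `N + 2`.
    by_cases h : r + 1 < N
    · left
      have : (k + 1 - c) / (N : ℤ) = q := by
        rw [show k + 1 - c = r + 1 + N * q by linarith, Int.add_mul_ediv_left _ _ h0,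
          Int.ediv_eq_zero_of_lt (by omega) h, zero_add]
      rw [this]
      ring
    · right
      have hr : r = N - 1 := by omega
      have : (k + 1 - c) / (N : ℤ) = q + 1 := by
        rw [show k + 1 - c = 0 + N * (q + 1) by rw [hr] at e1; linarith,
          Int.add_mul_ediv_left _ _ h0, Int.zero_ediv, zero_add]
      rw [this]
      refine ⟨by ring, q + 1, ?_⟩
      push_cast
      rw [hr] at e1
      linarith

/-- A family of closed edge paths in a graph, along which cells can be attached. -/
structure BoundaryData (G : OrGraph.{u}) (F : Type u) where
  len : F → ℕ
  len_pos : ∀ f, 0 < len f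
  bd : F → ℤ → G.Dart
  bd_periodic : ∀ f k, bd f (k + len f) = bd f k
  bd_chain : ∀ f k, G.head (bd f k) = G.tail (bd f (k + 1))

namespace BoundaryData

variable {G : OrGraph.{u}} {F : Type u}

/-- The polygonal complex obtained by attaching cells along the given paths. -/
abbrev toComplex (D : BoundaryData G F) : PolygonalComplex.{u} where
  toOrGraph := G
  F := F
  len := D.len
  len_pos := D.len_pos
  bd := D.bd
  bd_periodic := D.bd_periodic
  bd_chain := D.bd_chain

/-- The closed paths of `D'` result from those of `D` by the deletion of backtracks and by
rotation. -/
def Reduces (D D' : BoundaryData G F) : Prop :=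
  ∀ f, ∃ m : ℤ → ℤ, (∀ k, m (k + D'.len f) = m k + D.len f) ∧ (∀ k, D'.bd f k = D.bd f (m k)) ∧
    ∀ k, m (k + 1) = m k + 1 ∨
      (m (k + 1) = m k + 3 ∧ D.bd f (m k + 2) = G.rev (D.bd f (m k + 1)))

theorem Reduces.attach_homotopic {D D' : BoundaryData G F} (h : D.Reduces D') (f : F) :
    ContinuousMap.Homotopic (D.toComplex.attach f) (D'.toComplex.attach f) := by
  obtain ⟨m, hm, hb, hback⟩ := h f
  exact OrGraph.circle_homotopic_of_backtracks (G := G) (D.len_pos f) (D'.len_pos f)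
    (PolygonalComplex.attach_div_add (X := D.toComplex) f)
    (PolygonalComplex.attach_div_add (X := D'.toComplex) f) m hm hb hback

theorem Reduces.isIndependent {D D' : BoundaryData G F} (h : D.Reduces D')
    (hD : D.toComplex.IsIndependent) : D'.toComplex.IsIndependent where
  not_power f hf := hD.not_power f (hf.of_homotopic (h.attach_homotopic f).symm)
  not_homotopic f g hfg := by
    refine ⟨fun h' => (hD.not_homotopic f g hfg).1 ?_, fun h' => (hD.not_homotopic f g hfg).2 ?_⟩
    · exact ((h.attach_homotopic f).trans h').trans (h.attach_homotopic g).symm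
    · refine ((h.attach_homotopic f).trans h').trans ?_
      exact (h.attach_homotopic g).symm.comp (ContinuousMap.Homotopic.refl _)

end BoundaryData

namespace PolygonalComplex

variable (X : PolygonalComplex.{u}) {n : ℕ} (σ : X.E → Equiv.Perm (Fin n))

theorem liftSheet_zero (f : X.F) (j : Fin n) : X.liftSheet σ f j 0 = j := by
  simp [liftSheet, holonomy]

theorem sheetStep_rev (d : X.Dart) : X.sheetStep σ (X.rev d) = (X.sheetStep σ d)⁻¹ := by
  rcases d with ⟨e, _ | _⟩ <;> simp [sheetStep, OrGraph.rev]

theorem liftDart_rev (d : X.Dart) (j : Fin n) :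
    X.liftDart σ (X.rev d) (X.sheetStep σ d j) = (X.coverGraph σ).rev (X.liftDart σ d j) := by
  rcases d with ⟨e, _ | _⟩ <;> simp [sheetStep, OrGraph.rev, liftDart]

theorem eq_liftSheet (f : X.F) (s : ℤ → Fin n)
    (hs : ∀ k, s (k + 1) = X.sheetStep σ (X.bd f k) (s k)) (k : ℤ) :
    s k = X.liftSheet σ f (s 0) k := by
  induction k using Int.induction_on with
  | zero => rw [liftSheet_zero]
  | succ k ih => rw [hs, liftSheet_succ, ih]
  | pred k ih =>
    have h1 := hs (-k - 1)
    have h2 := X.liftSheet_succ σ f (s 0) (-k - 1)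
    rw [sub_add_cancel] at h1 h2
    rw [h1, h2] at ih
    exact (X.sheetStep σ _).injective ih

theorem liftSheet_add_mul (f : X.F) (j : Fin n) (k r : ℤ) :
    X.liftSheet σ f j (k + r * X.len f) = X.liftSheet σ f ((X.monodromy σ f ^ r) j) k := by
  have hL : (X.len f : ℤ) ≠ 0 := by exact_mod_cast (X.len_pos f).ne'
  unfold liftSheet
  rw [Int.add_mul_emod_self_right, Int.add_mul_ediv_right _ _ hL, zpow_add,
    Equiv.Perm.mul_apply]

/-- The permutation of the sheets given by the lifts of the boundary of `f` up to time `k`. -/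
def liftPerm (f : X.F) (k : ℤ) : Equiv.Perm (Fin n) :=
  X.holonomy σ f (k % X.len f).toNat * X.monodromy σ f ^ (k / X.len f)

theorem liftPerm_apply (f : X.F) (k : ℤ) (j : Fin n) :
    X.liftPerm σ f k j = X.liftSheet σ f j k := rfl

theorem bd_add_mul (f : X.F) (k r : ℤ) : X.bd f (k + r * X.len f) = X.bd f k := by
  have h := (show Function.Periodic (X.bd f) (X.len f : ℤ) from X.bd_periodic f).int_mul r k
  simpa using h

end PolygonalComplex

namespace BoundaryData

variable {G : OrGraph.{u}} {F : Type u}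

-- A backtrack lifts to a backtrack, so the reduction can be carried out in all sheets at once.
-- Transport along the boundary of `D` from time `0` to time `m f 0` identifies the starting sheets
-- of the two families of lifts and conjugates the two monodromies, so it matches the cells of the
-- two covers. Matched attaching maps are freely homotopic, and `Attachment.homotopyEquiv_of_equiv`
-- applies.
open PolygonalComplex in
theorem Reduces.branchedCover_homotopyEquiv {D D' : BoundaryData G F} (h : D.Reduces D') {n : ℕ}
    (σ : G.E → Equiv.Perm (Fin n)) :
    Nonempty (ContinuousMap.HomotopyEquiv (D'.toComplex.branchedCover σ).Realization
      (D.toComplex.branchedCover σ).Realization) := by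
  choose m hm hb hback using h
  -- `Φ f j'` is the sheet from which the lift for `D` must start in order to be in sheet `j'` at
  -- time `m f 0`, where the lift for `D'` begins.
  let Φ : F → Equiv.Perm (Fin n) := fun f => (D.toComplex.liftPerm σ f (m f 0))⁻¹
  have hΦ0 : ∀ f j', D.toComplex.liftSheet σ f (Φ f j') (m f 0) = j' := fun f j' =>
    (D.toComplex.liftPerm σ f (m f 0)).apply_symm_apply j'
  have hΦ : ∀ f j' k, D.toComplex.liftSheet σ f (Φ f j') (m f k) = D'.toComplex.liftSheet σ f j' k := by
    intro f j' k
    have := D'.toComplex.eq_liftSheet σ f (fun k => D.toComplex.liftSheet σ f (Φ f j') (m f k)) (fun k => by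
      have e : D'.toComplex.bd f k = D.toComplex.bd f (m f k) := hb f k
      rcases hback f k with h1 | ⟨h1, h2⟩
      · rw [h1, liftSheet_succ, e]
        rfl
      · have h2' : D.toComplex.bd f (m f k + 1 + 1) = D.toComplex.rev (D.toComplex.bd f (m f k + 1)) := by
          rw [add_assoc]; exact h2
        rw [h1, show m f k + 3 = m f k + 1 + 1 + 1 by ring, liftSheet_succ, liftSheet_succ, h2',
          sheetStep_rev, Equiv.Perm.inv_def, Equiv.symm_apply_apply, liftSheet_succ, e]
        rfl) k
    rw [this, hΦ0]
  have hconj : ∀ f j', Φ f (D'.toComplex.monodromy σ f j') = D.toComplex.monodromy σ f (Φ f j') := by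
    intro f j'
    have hinj : Function.Injective fun j => D.toComplex.liftSheet σ f j (m f 0) :=
      (D.toComplex.liftPerm σ f (m f 0)).injective
    apply hinj
    simp only
    rw [hΦ0]
    have h1 := D.toComplex.liftSheet_add_mul σ f (Φ f j') (m f 0) 1
    have h2 : m f 0 + 1 * (D.toComplex.len f : ℤ) = m f (0 + 1 * D'.toComplex.len f) := by
      rw [one_mul, one_mul]; exact (hm f 0).symm
    have h3 := D'.toComplex.liftSheet_add_mul σ f j' 0 1
    rw [h2, hΦ, h3, liftSheet_zero, zpow_one, zpow_one] at h1
    exact h1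
  have hpow : ∀ f (r : ℤ) j', Φ f ((D'.toComplex.monodromy σ f ^ r) j') = (D.toComplex.monodromy σ f ^ r) (Φ f j') := by
    intro f r j'
    have h1 : D.toComplex.monodromy σ f = Φ f * D'.toComplex.monodromy σ f * (Φ f)⁻¹ := by
      ext j
      simp [hconj]
    rw [h1, conj_zpow]
    simp
  have hindex : ∀ f j' b (r : ℤ), (D.toComplex.monodromy σ f ^ r) b = Φ f j' →
      D.toComplex.liftIndex σ f b = D'.toComplex.liftIndex σ f j' := by
    intro f j' b r hr
    refine Function.minimalPeriod_eq_minimalPeriod_iff.2 fun k => ?_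
    unfold Function.IsPeriodicPt Function.IsFixedPt
    rw [← Equiv.Perm.coe_pow, ← Equiv.Perm.coe_pow, ← (D.toComplex.monodromy σ f ^ r).injective.eq_iff,
      ← Equiv.Perm.mul_apply, ← zpow_natCast, ← zpow_add, add_comm, zpow_add, Equiv.Perm.mul_apply,
      hr, ← hpow, (Φ f).injective.eq_iff, zpow_natCast]
  let e : (D'.toComplex.branchedCover σ).F ≃ (D.toComplex.branchedCover σ).F :=
    Equiv.sigmaCongrRight fun f : F => Quotient.congr (Φ f) (by
      intro a b
      constructor
      · rintro ⟨r, hr⟩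
        exact ⟨r, by rw [← hpow, hr]⟩
      · rintro ⟨r, hr⟩
        exact ⟨r, by rwa [← hpow, (Φ f).injective.eq_iff] at hr⟩)
  let ψ : (D.toComplex.branchedCover σ).F → C(UnitAddCircle, (D.toComplex.coverGraph σ).Skeleton) :=
    (D.toComplex.branchedCover σ).attach
  let φ : (D'.toComplex.branchedCover σ).F → C(UnitAddCircle, (D.toComplex.coverGraph σ).Skeleton) :=
    (D'.toComplex.branchedCover σ).attach
  let R : (D.toComplex.branchedCover σ).Realization ≃ₜ Attachment ψ := realizationHomeomorph _
  let R' : (D'.toComplex.branchedCover σ).Realization ≃ₜ Attachment φ := realizationHomeomorph _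
  obtain ⟨E⟩ := Attachment.homotopyEquiv_of_equiv (φ := φ) (ψ := ψ) e (by
    rintro ⟨f, q⟩
    -- The representatives chosen by `Quotient.out` on matched cycles may differ by a power `r` of
    -- the monodromy. Shifting positions by `r` turns around the boundary of `f` compensates for
    -- this.
    obtain ⟨r, hr⟩ : ∃ r : ℤ, (D.toComplex.monodromy σ f ^ r) (e ⟨f, q⟩).2.out = Φ f q.out := by
      have h1 : (e ⟨f, q⟩).2 = Quotient.mk _ (Φ f q.out) := by
        conv_lhs => rw [← Quotient.out_eq q]
        rfl
      rw [h1]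
      exact Quotient.mk_out (s := Equiv.Perm.SameCycle.setoid (D.toComplex.monodromy σ f)) (Φ f q.out)
    have hsheet : ∀ k, D.toComplex.liftSheet σ f (e ⟨f, q⟩).2.out (k + r * D.toComplex.len f) =
        D.toComplex.liftSheet σ f (Φ f q.out) k := fun k => by rw [liftSheet_add_mul, hr]
    have hdart : ∀ k, (D.toComplex.branchedCover σ).bd (e ⟨f, q⟩) (k + r * D.toComplex.len f) =
        D.toComplex.liftDart σ (D.toComplex.bd f k) (D.toComplex.liftSheet σ f (Φ f q.out) k) := by
      intro k
      change D.toComplex.liftDart σ (D.toComplex.bd f _) (D.toComplex.liftSheet σ f _ _) = _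
      rw [hsheet, bd_add_mul]
    have hind : (D.toComplex.branchedCover σ).len (e ⟨f, q⟩) = D.toComplex.len f * D'.toComplex.liftIndex σ f q.out := by
      change D.toComplex.len f * _ = _
      rw [← hindex f q.out _ r hr]
      rfl
    symm
    refine OrGraph.circle_homotopic_of_backtracks (G := D.toComplex.coverGraph σ)
      ((D.toComplex.branchedCover σ).len_pos (e ⟨f, q⟩)) ((D'.toComplex.branchedCover σ).len_pos ⟨f, q⟩)
      (attach_div_add (X := D.toComplex.branchedCover σ) (e ⟨f, q⟩))
      (attach_div_add (X := D'.toComplex.branchedCover σ) ⟨f, q⟩) (fun k => m f k + r * D.toComplex.len f) ?_ ?_ ?_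
    · intro k
      have h1 : ∀ (i : ℕ) k, m f (k + (D'.toComplex.len f * i : ℕ)) = m f k + (D.toComplex.len f * i : ℕ) := by
        intro i
        induction i with
        | zero => simp
        | succ i ih =>
          intro k
          have h2 := hm f (k + (D'.toComplex.len f * i : ℕ))
          rw [ih] at h2
          rw [show k + ((D'.toComplex.len f * (i + 1) : ℕ) : ℤ) = k + (D'.toComplex.len f * i : ℕ) + D'.len f by
            change _ = k + (D'.toComplex.len f * i : ℕ) + D'.toComplex.len f
            push_cast
            ring, h2]
          change _ + ((D.toComplex.len f : ℕ) : ℤ) = _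
          push_cast
          ring
      rw [hind]
      change m f (k + (D'.toComplex.len f * D'.toComplex.liftIndex σ f q.out : ℕ)) + _ = _
      rw [h1]
      ring
    · intro k
      rw [hdart]
      change D'.toComplex.liftDart σ (D'.toComplex.bd f k) (D'.toComplex.liftSheet σ f q.out k) = _
      rw [hΦ]
      exact congrArg (fun d => D'.toComplex.liftDart σ d _) (hb f k)
    · intro k
      rcases hback f k with h1 | ⟨h1, h2⟩
      · left
        rw [h1]
        ring
      · right
        refine ⟨by rw [h1]; ring, ?_⟩
        rw [show m f k + r * D.toComplex.len f + 2 = (m f k + 1 + 1) + r * D.toComplex.len f by ring,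
          show m f k + r * D.toComplex.len f + 1 = (m f k + 1) + r * D.toComplex.len f by ring, hdart, hdart,
          liftSheet_succ, show D.toComplex.bd f (m f k + 1 + 1) = D.toComplex.rev (D.toComplex.bd f (m f k + 1)) by
            rw [add_assoc]; exact h2, liftDart_rev])
  exact ⟨(R'.toHomotopyEquiv.trans E).trans R.symm.toHomotopyEquiv⟩

/-- The letters at `i` and `i + 1` are cut out of the word. Independence is needed to ensure that a
nonempty word remains. -/
theorem exists_reduces_of_backtrack [Fintype F] (D : BoundaryData G F)
    (hD : D.toComplex.IsIndependent) (f : F) (i : ℤ)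
    (hi : D.bd f (i + 1) = G.rev (D.bd f i)) :
    ∃ D' : BoundaryData G F, D.Reduces D' ∧ ∑ g, D'.len g < ∑ g, D.len g := by
  classical
  have hper : ∀ {k l : ℤ}, (D.len f : ℤ) ∣ k - l → D.bd f k = D.bd f l := by
    rintro k l ⟨c, hc⟩
    have := D.toComplex.bd_add_mul f l c
    change D.bd f (l + c * D.len f) = D.bd f l at this
    rw [← this]
    congr 1
    linarith [mul_comm (D.len f : ℤ) c]
  have h1 : D.len f ≠ 1 := by
    intro h1
    rw [hper (k := i + 1) (l := i) (by rw [h1]; simp)] at hi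
    exact OrGraph.rev_ne _ hi.symm
  have h0 := D.len_pos f
  -- Deleting one backtrack from a word `d d⁻¹` run twice, of length 4, gives this word itself. It
  -- would be homotopic to its own square, against `not_power`.
  have h2 : D.len f ≠ 2 := by
    intro h2
    refine hD.not_power f ⟨D.toComplex.attach f, 2, le_rfl, ?_⟩
    symm
    obtain ⟨m, hm⟩ : ∃ m : ℤ → ℤ, ∀ k, m k = k + 2 * ((k - (i + 2)) / (2 : ℕ)) :=
      ⟨_, fun _ => rfl⟩
    obtain ⟨hm1, hm2⟩ := skipTwo_spec (N := 2) two_pos (i + 2) m hm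
    refine OrGraph.circle_homotopic_of_backtracks (G := G) (N := 4) (N' := 2) (by norm_num)
      two_pos (a := D.bd f) (b := D.bd f) (fun k t => ?_) (fun k t => ?_) m hm1 (fun k => ?_)
      (fun k => (hm2 k).imp id fun h => ⟨h.1, ?_⟩)
    · have := PolygonalComplex.attach_div_add (X := D.toComplex) f k t
      refine Eq.trans ?_ this
      change D.toComplex.attach f (2 • ((_ : ℝ) : UnitAddCircle)) = _
      rw [← AddCircle.coe_nsmul]
      congr 2
      change _ = _ / (D.len f : ℝ)
      rw [h2]
      simp
      ring
    · have := PolygonalComplex.attach_div_add (X := D.toComplex) f k t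
      refine Eq.trans ?_ this
      congr 3
      change _ = (D.len f : ℝ)
      rw [h2]
    · refine hper ?_
      rw [h2, hm]
      simp
    · have h3 := h.2
      rw [hper (k := m k + 2) (l := i + 1), hi, hper (k := m k + 1) (l := i)]
      · rw [h2]; push_cast at h3 ⊢; omega
      · rw [h2]; push_cast at h3 ⊢; omega
  obtain ⟨N', hN'⟩ : ∃ N', D.len f = N' + 2 := ⟨D.len f - 2, by omega⟩
  have hpos : 0 < N' := by omega
  -- With the offset `i + 2` the skipped positions are those congruent to `i` and `i + 1` modulo the
  -- length.
  obtain ⟨m, hm⟩ : ∃ m : ℤ → ℤ, ∀ k, m k = k + 2 * ((k - (i + 2)) / N') := ⟨_, fun _ => rfl⟩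
  obtain ⟨hm1, hm2⟩ := skipTwo_spec hpos (i + 2) m hm
  have hm2' : ∀ k, m (k + 1) = m k + 1 ∨
      (m (k + 1) = m k + 3 ∧ D.bd f (m k + 2) = G.rev (D.bd f (m k + 1))) := by
    intro k
    refine (hm2 k).imp id fun h => ⟨h.1, ?_⟩
    obtain ⟨c, hc⟩ := h.2
    rw [hper (k := m k + 2) (l := i + 1) ⟨c, by rw [hN', ← hc]; ring⟩, hi,
      hper (k := m k + 1) (l := i) ⟨c, by rw [hN', ← hc]; ring⟩]
  refine ⟨{ len := Function.update D.len f N'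
            bd := Function.update D.bd f (fun k => D.bd f (m k))
            len_pos := fun g => ?_
            bd_periodic := fun g k => ?_
            bd_chain := fun g k => ?_ }, fun g => ?_, ?_⟩
  · by_cases hg : g = f
    · subst hg; simpa using hpos
    · simpa [hg] using D.len_pos g
  · by_cases hg : g = f
    · subst hg
      simp only [Function.update_self]
      rw [hm1]
      refine hper ⟨1, ?_⟩
      rw [hN']
      ring
    · simpa [hg] using D.bd_periodic g k
  · by_cases hg : g = f
    · subst hg
      simp only [Function.update_self]
      rcases hm2' k with h | ⟨h, h'⟩
      · rw [h, D.bd_chain]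
      · rw [h, D.bd_chain, show m k + 3 = m k + 2 + 1 by ring, ← D.bd_chain g (m k + 2), h',
          OrGraph.head_rev]
    · simpa [hg] using D.bd_chain g k
  · by_cases hg : g = f
    · subst hg
      refine ⟨m, ?_, ?_, hm2'⟩
      · simp only [Function.update_self]
        rw [hN']
        exact hm1
      · simp
    · exact ⟨id, by simp [hg], by simp [hg], by simp⟩
  · refine Finset.sum_lt_sum (fun g _ => ?_) ⟨f, Finset.mem_univ f, ?_⟩
    · by_cases hg : g = f
      · subst hg; simp only [Function.update_self]; omega
      · simp [hg]
    · simp only [Function.update_self]; omega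

/-- An independent family of closed edge paths can be made cyclically reduced, and this does not
change the homotopy types of the branched covers. -/
theorem exists_isReduced [Fintype F] (D : BoundaryData G F) (hD : D.toComplex.IsIndependent) :
    ∃ D' : BoundaryData G F, D'.toComplex.IsIndependent ∧ D'.toComplex.IsReduced ∧
      ∀ (n : ℕ) (σ : G.E → Equiv.Perm (Fin n)),
        Nonempty (ContinuousMap.HomotopyEquiv (D.toComplex.branchedCover σ).Realization
          (D'.toComplex.branchedCover σ).Realization) := by
  induction hs : ∑ g, D.len g using Nat.strong_induction_on generalizing D with
  | _ s ih =>
    by_cases hred : D.toComplex.IsReduced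
    · exact ⟨D, hD, hred, fun n σ => ⟨.refl _⟩⟩
    · unfold PolygonalComplex.IsReduced at hred
      push Not at hred
      obtain ⟨f, i, hi⟩ := hred
      obtain ⟨D₁, hr, hlt⟩ := exists_reduces_of_backtrack D hD f i hi
      obtain ⟨D', h1, h2, h3⟩ := ih _ (hs ▸ hlt) D₁ (hr.isIndependent hD) rfl
      refine ⟨D', h1, h2, fun n σ => ?_⟩
      obtain ⟨E⟩ := hr.branchedCover_homotopyEquiv σ
      obtain ⟨E'⟩ := h3 n σ
      exact ⟨E.symm.trans E'⟩

end BoundaryData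

/-! ### Reducedness and overlaps in branched covers -/

namespace PolygonalComplex

variable {X : PolygonalComplex.{u}} {n : ℕ} {σ : X.E → Equiv.Perm (Fin n)}

/-- The image in the base of a directed edge of the covering graph. -/
def projDart (d : (X.coverGraph σ).Dart) : X.Dart := (d.1.1, d.2)

theorem projDart_liftDart (d : X.Dart) (j : Fin n) : projDart (X.liftDart σ d j) = d := by
  rcases d with ⟨e, _ | _⟩ <;> simp [projDart, liftDart]

theorem projDart_rev (d : (X.coverGraph σ).Dart) :
    projDart ((X.coverGraph σ).rev d) = X.rev (projDart d) := rfl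

theorem projDart_bd (c : (X.branchedCover σ).F) (k : ℤ) :
    projDart ((X.branchedCover σ).bd c k) = X.bd c.1 k := projDart_liftDart _ _

theorem IsReduced.branchedCover (h : X.IsReduced) : (X.branchedCover σ).IsReduced := by
  intro c k hc
  have := congrArg projDart hc
  rw [projDart_bd] at this
  refine h c.1 k (this.trans ?_)
  exact (projDart_rev _).trans (congrArg X.rev (projDart_bd c k))

/-- Projection to `X` shows that both words lift the same boundary, at congruent positions. A common
lifted edge, which exists as `0 < M`, puts the two lifts into the same sheet, so they belong to the
same cycle of the monodromy and the positions differ by a multiple of the lifted perimeter. -/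
theorem AgreementBound.branchedCover {M : ℕ} (hM : 0 < M) (h : X.AgreementBound M) :
    (X.branchedCover σ).AgreementBound M := by
  rintro ⟨f, q⟩ i ⟨g, q'⟩ j pos hag
  obtain ⟨rfl, rfl, hij⟩ := h f i g j pos (fun k hk => by
    have h1 := congrArg projDart (hag k hk)
    refine (projDart_bd ⟨f, q⟩ _).symm.trans (h1.trans ?_)
    cases pos
    · exact (projDart_rev _).trans (congrArg X.rev (projDart_bd _ _))
    · exact projDart_bd _ _)
  obtain ⟨r, hr⟩ := hij.dvd
  have h0 := hag 0 hM
  have h1 : X.liftDart σ (X.bd f i) (X.liftSheet σ f q.out i) =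
      X.liftDart σ (X.bd f j) (X.liftSheet σ f q'.out j) := by
    simp only [readFrom, Nat.cast_zero, add_zero, if_true] at h0
    exact h0
  have h2 := congrArg (X.coverGraph σ).tail h1
  rw [tail_liftDart, tail_liftDart] at h2
  have h3 : X.liftSheet σ f q.out i = X.liftSheet σ f q'.out j := congrArg Prod.snd h2
  rw [show j = i + r * X.len f by linarith [mul_comm (X.len f : ℤ) r], liftSheet_add_mul] at h3
  have h4 : q.out = (X.monodromy σ f ^ r) q'.out := (X.liftPerm σ f i).injective h3
  have h5 : q = q' := by
    rw [← Quotient.out_eq q, ← Quotient.out_eq q']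
    exact (Quotient.sound (s := Equiv.Perm.SameCycle.setoid (X.monodromy σ f)) ⟨r, h4.symm⟩).symm
  subst h5
  refine ⟨rfl, rfl, ?_⟩
  have h6 : Function.IsPeriodicPt (X.monodromy σ f) r.natAbs q.out := by
    unfold Function.IsPeriodicPt Function.IsFixedPt
    rw [← Equiv.Perm.coe_pow]
    rcases Int.natAbs_eq r with hr' | hr'
    · rw [hr', zpow_natCast] at h4
      exact h4.symm
    · rw [hr', zpow_neg, zpow_natCast, Equiv.Perm.eq_inv_iff_eq] at h4
      exact h4
  have h7 : ((X.liftIndex σ f q.out : ℕ) : ℤ) ∣ r :=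
    Int.natCast_dvd.2 h6.minimalPeriod_dvd
  refine Int.modEq_iff_dvd.2 ?_
  change ((X.len f * X.liftIndex σ f q.out : ℕ) : ℤ) ∣ j - i
  rw [hr]
  push_cast
  exact mul_dvd_mul_left _ h7

end PolygonalComplex

/-! ### Small subgraphs of the covering graph -/

namespace OrGraph

variable (G : OrGraph.{u})

/-- Every small finite subgraph without dead ends is a disjoint union of cycles. -/
def NoBranching (R : ℕ) : Prop :=
  ∀ A : Finset G.E, A.card ≤ R →
    (∀ d : G.Dart, d.1 ∈ A → ∃ d' : G.Dart, d'.1 ∈ A ∧ G.tail d' = G.head d ∧ d' ≠ G.rev d) →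
    ∀ d₁ d₂ d₃ : G.Dart, d₁.1 ∈ A → d₂.1 ∈ A → d₃.1 ∈ A → G.tail d₁ = G.tail d₂ →
      G.tail d₁ = G.tail d₃ → d₁ = d₂ ∨ d₂ = d₃ ∨ d₁ = d₃

open Classical in
/-- The end points of a finite set of edges. -/
noncomputable def ends (A : Finset G.E) : Finset G.V := A.image G.src ∪ A.image G.tgt

variable {G}

theorem tail_mem_ends {A : Finset G.E} {d : G.Dart} (hd : d.1 ∈ A) : G.tail d ∈ G.ends A := by
  classical
  unfold tail ends
  split_ifs
  · exact Finset.mem_union_left _ (Finset.mem_image_of_mem _ hd)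
  · exact Finset.mem_union_right _ (Finset.mem_image_of_mem _ hd)

theorem mem_ends {A : Finset G.E} {v : G.V} :
    v ∈ G.ends A ↔ (∃ e ∈ A, G.src e = v) ∨ ∃ e ∈ A, G.tgt e = v := by
  simp [ends]

theorem card_ends_le (A : Finset G.E) : (G.ends A).card ≤ 2 * A.card := by
  classical
  have h1 : (A.image G.src).card ≤ A.card := Finset.card_image_le
  have h2 : (A.image G.tgt).card ≤ A.card := Finset.card_image_le
  have h3 : (G.ends A).card ≤ (A.image G.src).card + (A.image G.tgt).card := by
    unfold ends
    convert! Finset.card_union_le _ _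
  omega

/-- Directed edges are counted by their tails. Without dead ends each end point has at least two of
them, and there are only `2 |A| ≤ 2 |ends A|` in total, so no end point has three. -/
theorem noBranching_of_card_le {R : ℕ}
    (h : ∀ A : Finset G.E, A.card ≤ R → A.card ≤ (G.ends A).card) : G.NoBranching R := by
  classical
  intro A hA hdead d₁ d₂ d₃ h1 h2 h3 h12 h13
  by_contra! hne
  let Δ : Finset G.Dart := A ×ˢ Finset.univ
  have hΔ : ∀ d : G.Dart, d ∈ Δ ↔ d.1 ∈ A := fun d => by simp [Δ]
  have hΔc : Δ.card = A.card * 2 := by simp [Δ, Finset.card_product]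
  have hfib : Δ.card = ∑ v ∈ G.ends A, (Δ.filter fun d => G.tail d = v).card :=
    Finset.card_eq_sum_card_fiberwise fun d hd => tail_mem_ends ((hΔ d).1 hd)
  have htwo : ∀ d : G.Dart, d.1 ∈ A → 2 ≤ (Δ.filter fun d' => G.tail d' = G.tail d).card := by
    intro d hd
    obtain ⟨d', hd', ht, hne⟩ := hdead (G.rev d) hd
    rw [head_rev] at ht
    rw [rev_rev] at hne
    refine Finset.one_lt_card.2 ⟨d, ?_, d', ?_, hne.symm⟩
    · simp [hΔ, hd]
    · simp [hΔ, hd', ht]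
  have hge : ∀ v ∈ G.ends A, 2 ≤ (Δ.filter fun d => G.tail d = v).card := by
    intro v hv
    rcases Finset.mem_union.1 hv with hv | hv
    · obtain ⟨e, he, rfl⟩ := Finset.mem_image.1 hv
      exact htwo (e, true) he
    · obtain ⟨e, he, rfl⟩ := Finset.mem_image.1 hv
      exact htwo (e, false) he
  have hgt : 2 < (Δ.filter fun d => G.tail d = G.tail d₁).card :=
    Finset.two_lt_card.2 ⟨d₁, by simp [hΔ, h1], d₂, by simp [hΔ, h2, h12], d₃,
      by simp [hΔ, h3, h13], hne.1, hne.2.2, hne.2.1⟩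
  have hlt : ∑ _v ∈ G.ends A, 2 < ∑ v ∈ G.ends A, (Δ.filter fun d => G.tail d = v).card :=
    Finset.sum_lt_sum hge ⟨G.tail d₁, tail_mem_ends h1, hgt⟩
  rw [← hfib, hΔc, Finset.sum_const, smul_eq_mul] at hlt
  have := h A hA
  omega

/-- Induction on the number of vertices outside `W`, starting from the whole vertex set, where the
count is part of the definition. If `W` is smaller, connectedness provides a tree edge from `W` to
its complement; adding its outer end point to `W` adds one vertex and at least one edge. -/
theorem IsSpanningTree.card_lt [Finite G.V] [Finite G.E] {T : Set G.E} (hT : G.IsSpanningTree T)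
    {W : Finset G.V} (hW : W.Nonempty) {A : Finset G.E}
    (hA : ∀ e ∈ A, e ∈ T ∧ G.src e ∈ W ∧ G.tgt e ∈ W) : A.card < W.card := by
  classical
  obtain ⟨hconn, hcard⟩ := hT
  have : Fintype G.V := Fintype.ofFinite _
  have : Fintype G.E := Fintype.ofFinite _
  rw [Nat.card_eq_fintype_card, Nat.card_eq_fintype_card] at hcard
  let B : Finset G.V → Finset G.E := fun W =>
    Finset.univ.filter fun e => e ∈ T ∧ G.src e ∈ W ∧ G.tgt e ∈ W
  have hB : ∀ W e, e ∈ B W ↔ e ∈ T ∧ G.src e ∈ W ∧ G.tgt e ∈ W := fun W e => by simp [B]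
  have key : ∀ (k : ℕ) (W : Finset G.V), W.Nonempty → Fintype.card G.V = W.card + k →
      (B W).card < W.card := by
    intro k
    induction k with
    | zero =>
      intro W _ hk
      have h1 : (B W).card ≤ Fintype.card T := by
        rw [← Set.toFinset_card]
        exact Finset.card_le_card fun e he => Set.mem_toFinset.2 ((hB W e).1 he).1
      omega
    | succ k ih =>
      intro W hW hk
      obtain ⟨v, hv⟩ : ∃ v, v ∉ W := by
        by_contra! hall
        have := Finset.eq_univ_iff_forall.2 hall
        rw [this, Finset.card_univ] at hk
        omega
      obtain ⟨w, hw⟩ := hW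
      have hcross : ∃ e ∈ T, ¬ (G.src e ∈ W ↔ G.tgt e ∈ W) := by
        by_contra! hno
        have : ∀ a b, Relation.EqvGen (fun a b => ∃ e ∈ T, G.src e = a ∧ G.tgt e = b) a b →
            (a ∈ W ↔ b ∈ W) := by
          intro a b hab
          induction hab with
          | rel a b h => obtain ⟨e, he, rfl, rfl⟩ := h; exact hno e he
          | refl => rfl
          | symm _ _ _ h => exact h.symm
          | trans _ _ _ _ _ h h' => exact h.trans h'
        exact hv ((this w v (hconn w v)).1 hw)
      obtain ⟨e, he, hne⟩ := hcross
      obtain ⟨x, hx, hx'⟩ : ∃ x, x ∉ W ∧ G.src e ∈ insert x W ∧ G.tgt e ∈ insert x W := by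
        by_cases h1 : G.src e ∈ W
        · exact ⟨G.tgt e, by tauto, by simp [h1], by simp⟩
        · exact ⟨G.src e, h1, by simp, by simp; tauto⟩
      have h2 := ih (insert x W) (Finset.insert_nonempty _ _)
        (by rw [Finset.card_insert_of_notMem hx]; omega)
      have h3 : (B W).card < (B (insert x W)).card := by
        refine Finset.card_lt_card ⟨fun e' he' => ?_, fun hsub => ?_⟩
        · obtain ⟨h4, h5, h6⟩ := (hB _ _).1 he'
          exact (hB _ _).2 ⟨h4, Finset.mem_insert_of_mem h5, Finset.mem_insert_of_mem h6⟩
        · have := (hB _ _).1 (hsub ((hB _ _).2 ⟨he, hx'⟩))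
          tauto
      rw [Finset.card_insert_of_notMem hx] at h2
      omega
  have hle : W.card ≤ Fintype.card G.V := Finset.card_le_univ W
  refine lt_of_le_of_lt (Finset.card_le_card fun e he => (hB W e).2 (hA e he))
    (key (Fintype.card G.V - W.card) W hW (by omega))

end OrGraph

/-- Every small set `U` of sheets contains at most `|U|` edges of the Schreier graph of the
family of permutations. -/
def IsSparse {ι : Type*} {n : ℕ} (R : ℕ) (τ : ι → Equiv.Perm (Fin n)) : Prop :=
  ∀ U : Finset (Fin n), U.card ≤ R → ∀ A : Finset (ι × Fin n),
    (∀ x ∈ A, x.2 ∈ U ∧ τ x.1 x.2 ∈ U) → A.card ≤ U.card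

/-- Contracting the `n` lifts of `T` turns the covering graph into the Schreier graph on the sheets.
Edges over `T` stay in their sheet, and in each of the sheets in `U` they are fewer than the end
points, so `|A₂| + |U| ≤ |W|`. Sparseness gives `|A₁| ≤ |U|` for the other edges. The factor 2
arises because `R` edges have at most `2R` end points. -/
theorem PolygonalComplex.noBranching_coverGraph (X : PolygonalComplex.{u}) [Finite X.V] [Finite X.E]
    {T : Set X.E} (hT : X.IsSpanningTree T) {n R : ℕ}
    {τ : {e : X.E // e ∉ T} → Equiv.Perm (Fin n)} (hτ : IsSparse (2 * R) τ) :
    (X.coverGraph (X.extendByOne T τ)).NoBranching R := by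
  classical
  set σ := X.extendByOne T τ with hσ
  suffices main : ∀ A : Finset (X.E × Fin n), A.card ≤ R →
      A.card ≤ Finset.card (α := X.V × Fin n) ((X.coverGraph σ).ends A) from
    OrGraph.noBranching_of_card_le main
  intro A hA
  let W : Finset (X.V × Fin n) := (X.coverGraph σ).ends A
  change A.card ≤ W.card
  have hsrc : ∀ e ∈ A, (X.src e.1, e.2) ∈ W := fun e he => by
    exact OrGraph.mem_ends.2 (Or.inl ⟨e, he, rfl⟩)
  have htgt : ∀ e ∈ A, (X.tgt e.1, σ e.1 e.2) ∈ W := fun e he => by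
    exact OrGraph.mem_ends.2 (Or.inr ⟨e, he, rfl⟩)
  let U : Finset (Fin n) := W.image Prod.snd
  have hU : U.card ≤ 2 * R := by
    have h : W.card ≤ 2 * A.card := OrGraph.card_ends_le (G := X.coverGraph σ) A
    exact Finset.card_image_le.trans (h.trans (Nat.mul_le_mul_left 2 hA))
  have hmemU : ∀ v ∈ W, v.2 ∈ U := fun v hv => Finset.mem_image_of_mem _ hv
  have hσT : ∀ e ∈ T, σ e = 1 := fun e he => by simp [hσ, extendByOne, he]
  let A₁ := A.filter fun e => e.1 ∉ T
  let A₂ := A.filter fun e => e.1 ∈ T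
  have hA12 : A.card = A₂.card + A₁.card :=
    (Finset.card_filter_add_card_filter_not fun e : X.E × Fin n => e.1 ∈ T).symm
  have hA₁ : A₁.card ≤ U.card := by
    let B : Finset ({e : X.E // e ∉ T} × Fin n) :=
      A₁.attach.image fun e : {e // e ∈ A₁} => (⟨e.1.1, (Finset.mem_filter.1 e.2).2⟩, e.1.2)
    have hB : B.card = A₁.card := by
      rw [Finset.card_image_of_injective, Finset.card_attach]
      intro a b hab
      simp only [Prod.mk.injEq, Subtype.mk.injEq] at hab
      exact Subtype.ext (Prod.ext hab.1 hab.2)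
    rw [← hB]
    refine hτ U hU B fun x hx => ?_
    obtain ⟨e, -, rfl⟩ := Finset.mem_image.1 hx
    have h1 := Finset.mem_filter.1 e.2
    refine ⟨hmemU _ (hsrc _ h1.1), ?_⟩
    have h2 := hmemU _ (htgt _ h1.1)
    simpa [hσ, extendByOne, h1.2] using h2
  have hA₂ : A₂.card + U.card ≤ W.card := by
    have e1 : A₂.card = ∑ j ∈ U, (A₂.filter fun e => e.2 = j).card :=
      Finset.card_eq_sum_card_fiberwise fun e he =>
        hmemU _ (hsrc _ (Finset.mem_filter.1 he).1)
    have e2 : W.card = ∑ j ∈ U, (W.filter fun v => v.2 = j).card :=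
      Finset.card_eq_sum_card_fiberwise fun v hv => hmemU v hv
    rw [e1, e2, Finset.card_eq_sum_ones U, ← Finset.sum_add_distrib]
    refine Finset.sum_le_sum fun j hj => ?_
    have e3 : (A₂.filter fun e => e.2 = j).card =
        ((A₂.filter fun e => e.2 = j).image Prod.fst).card := by
      refine (Finset.card_image_of_injOn ?_).symm
      intro a ha b hb hab
      have ha' := (Finset.mem_filter.1 ha).2
      have hb' := (Finset.mem_filter.1 hb).2
      exact Prod.ext hab (ha'.trans hb'.symm)
    have e4 : (W.filter fun v => v.2 = j).card =
        ((W.filter fun v => v.2 = j).image Prod.fst).card := by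
      refine (Finset.card_image_of_injOn ?_).symm
      intro a ha b hb hab
      have ha' := (Finset.mem_filter.1 ha).2
      have hb' := (Finset.mem_filter.1 hb).2
      exact Prod.ext hab (ha'.trans hb'.symm)
    rw [e3, e4]
    refine hT.card_lt ?_ fun e he => ?_
    · obtain ⟨v, hv, rfl⟩ := Finset.mem_image.1 hj
      exact ⟨v.1, Finset.mem_image.2 ⟨v, Finset.mem_filter.2 ⟨hv, rfl⟩, rfl⟩⟩
    · obtain ⟨x, hx, rfl⟩ := Finset.mem_image.1 he
      obtain ⟨hx1, rfl⟩ := Finset.mem_filter.1 hx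
      obtain ⟨hxA, hxT⟩ := Finset.mem_filter.1 hx1
      refine ⟨hxT, ?_, ?_⟩
      · exact Finset.mem_image.2 ⟨_, Finset.mem_filter.2 ⟨hsrc x hxA, rfl⟩, rfl⟩
      · refine Finset.mem_image.2 ⟨_, Finset.mem_filter.2 ⟨htgt x hxA, ?_⟩, rfl⟩
        simp [hσT _ hxT]
  omega

/-! ### Counting families of permutations -/

section Counting

variable {ι : Type*} [Fintype ι] [DecidableEq ι] {n : ℕ}

/-- The families of permutations with prescribed values at the points of `A`. -/
def prescribed (A : Finset (ι × Fin n)) (k : ι × Fin n → Fin n) :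
    Finset (ι → Equiv.Perm (Fin n)) :=
  Finset.univ.filter fun τ => ∀ x ∈ A, τ x.1 x.2 = k x

theorem mem_prescribed {A : Finset (ι × Fin n)} {k : ι × Fin n → Fin n}
    {τ : ι → Equiv.Perm (Fin n)} : τ ∈ prescribed A k ↔ ∀ x ∈ A, τ x.1 x.2 = k x := by
  simp [prescribed]

/-- A switching argument: `τ a.1` is followed by the transposition of `k a` with a value `c` that is
not prescribed on `A`. This preserves the other constraints and moves the value at `a` to `c`, so
`τ` and `c` can be recovered from the result. At least `n - |A|` values `c` are available. -/
theorem card_prescribed_insert_mul_le {A : Finset (ι × Fin n)} (k : ι × Fin n → Fin n)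
    {a : ι × Fin n} (ha : a ∉ A) :
    (prescribed (insert a A) k).card * (n - A.card) ≤ (prescribed A k).card := by
  let K : Finset (Fin n) := (A.image k)ᶜ
  have hK : n - A.card ≤ K.card := by
    rw [Finset.card_compl, Fintype.card_fin]
    exact Nat.sub_le_sub_left Finset.card_image_le n
  refine (Nat.mul_le_mul_left _ hK).trans ?_
  rw [← Finset.card_product]
  refine Finset.card_le_card_of_injOn
    (fun p => Function.update p.1 a.1 (Equiv.swap (k a) p.2 * p.1 a.1)) ?_ ?_
  · rintro ⟨τ, c⟩ hp
    obtain ⟨hτ, hc⟩ := Finset.mem_product.1 hp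
    have hτ' := mem_prescribed.1 hτ
    refine mem_prescribed.2 fun x hx => ?_
    have hx' := hτ' x (Finset.mem_insert_of_mem hx)
    by_cases h1 : x.1 = a.1
    · simp only [h1, Function.update_self, Equiv.Perm.mul_apply]
      rw [h1] at hx'
      rw [hx']
      refine Equiv.swap_apply_of_ne_of_ne ?_ ?_
      · rw [← hx', ← hτ' a (Finset.mem_insert_self _ _)]
        intro h2
        refine ha ?_
        rwa [← Prod.ext h1 ((τ a.1).injective h2)]
      · rintro h2
        simp only [K, Finset.mem_compl, Finset.mem_image, not_exists, not_and] at hc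
        exact hc x hx h2
    · simpa [Function.update_of_ne h1] using hx'
  · rintro ⟨τ, c⟩ hp ⟨τ', c'⟩ hp' heq
    have h1 := mem_prescribed.1 (Finset.mem_product.1 hp).1 a (Finset.mem_insert_self _ _)
    have h2 := mem_prescribed.1 (Finset.mem_product.1 hp').1 a (Finset.mem_insert_self _ _)
    simp only at heq h1 h2
    have h3 := congrFun heq a.1
    simp only [Function.update_self] at h3
    have h4 := Equiv.congr_fun h3 a.2
    simp only [Equiv.Perm.mul_apply, h1, h2, Equiv.swap_apply_left] at h4
    subst h4
    have h5 := mul_left_cancel h3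
    have h6 : τ = τ' := by
      funext e
      by_cases he : e = a.1
      · rw [he, h5]
      · have := congrFun heq e
        simpa [Function.update_of_ne he] using this
    rw [h6]

theorem card_prescribed_mul_le (A : Finset (ι × Fin n)) (k : ι × Fin n → Fin n) :
    (prescribed A k).card * (n - A.card) ^ A.card ≤ Fintype.card (ι → Equiv.Perm (Fin n)) := by
  induction A using Finset.induction_on with
  | empty => simpa using Finset.card_le_univ (prescribed ∅ k)
  | insert a A ha ih =>
    rw [Finset.card_insert_of_notMem ha, pow_succ']
    refine le_trans ?_ ih
    calc (prescribed (insert a A) k).card * ((n - (A.card + 1)) * (n - (A.card + 1)) ^ A.card)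
        ≤ (prescribed (insert a A) k).card * ((n - A.card) * (n - A.card) ^ A.card) := by
          gcongr <;> omega
      _ = (prescribed (insert a A) k).card * (n - A.card) * (n - A.card) ^ A.card := by ring
      _ ≤ _ := Nat.mul_le_mul_right _ (card_prescribed_insert_mul_le k ha)

/-- The families of permutations that realize a given graph `c` with `v` vertices and `v + 1`
edges on the sheets `u 0, …, u (v - 1)`. -/
def realizing (v : ℕ) (u : Fin v → Fin n) (c : Fin (v + 1) → ι × Fin v × Fin v) :
    Finset (ι → Equiv.Perm (Fin n)) :=
  Finset.univ.filter fun τ => Function.Injective (fun x => ((c x).1, u (c x).2.1)) ∧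
    ∀ x, τ (c x).1 (u (c x).2.1) = u (c x).2.2

theorem card_realizing_mul_le (v : ℕ) (u : Fin v → Fin n) (c : Fin (v + 1) → ι × Fin v × Fin v) :
    (realizing v u c).card * (n - (v + 1)) ^ (v + 1) ≤
      Fintype.card (ι → Equiv.Perm (Fin n)) := by
  by_cases hinj : Function.Injective (fun x => ((c x).1, u (c x).2.1))
  · let A : Finset (ι × Fin n) := Finset.univ.image fun x => ((c x).1, u (c x).2.1)
    -- The default `Prod.snd` plays no role, since only the values at points of `A` are prescribed.
    let k := Function.extend (fun x => ((c x).1, u (c x).2.1)) (fun x => u (c x).2.2) Prod.snd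
    have hA : A.card = v + 1 := by
      rw [Finset.card_image_of_injective _ hinj, Finset.card_univ, Fintype.card_fin]
    have h := card_prescribed_mul_le A k
    rw [hA] at h
    refine (Nat.mul_le_mul_right _ (Finset.card_le_card fun τ hτ => ?_)).trans h
    refine mem_prescribed.2 fun x hx => ?_
    obtain ⟨y, -, rfl⟩ := Finset.mem_image.1 hx
    simp only [k]
    rw [hinj.extend_apply (fun x => u (c x).2.2) Prod.snd y]
    exact (Finset.mem_filter.1 hτ).2.2 y
  · have : realizing v u c = ∅ := Finset.filter_eq_empty_iff.2 fun τ _ h => hinj h.1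
    simp [this]

/-- Of the edges inside a violating set `U`, exactly `|U| + 1` are kept. Numbering these edges and
the sheets in `U` produces one of the patterns for the union bound. -/
theorem exists_mem_realizing {R : ℕ} {τ : ι → Equiv.Perm (Fin n)} (h : ¬ IsSparse R τ) :
    ∃ v ∈ Finset.range (R + 1), ∃ u : Fin v → Fin n, ∃ c : Fin (v + 1) → ι × Fin v × Fin v,
      τ ∈ realizing v u c := by
  unfold IsSparse at h
  push Not at h
  obtain ⟨U, hU, A, hA, hlt⟩ := h
  obtain ⟨B, hBA, hB⟩ := Finset.exists_subset_card_eq (show U.card + 1 ≤ A.card by omega)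
  let φ : U ≃ Fin U.card := U.equivFin
  let ψ : B ≃ Fin (U.card + 1) := B.equivFinOfCardEq hB
  have hm : ∀ y : Fin (U.card + 1), (ψ.symm y).1.2 ∈ U ∧ τ (ψ.symm y).1.1 (ψ.symm y).1.2 ∈ U :=
    fun y => hA _ (hBA (ψ.symm y).2)
  refine ⟨U.card, Finset.mem_range.2 (by omega), fun i => (φ.symm i).1, fun y =>
    ((ψ.symm y).1.1, φ ⟨_, (hm y).1⟩, φ ⟨_, (hm y).2⟩), ?_⟩
  refine Finset.mem_filter.2 ⟨Finset.mem_univ _, ?_, ?_⟩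
  · intro y z hyz
    simp only [Equiv.symm_apply_apply, Prod.mk.injEq] at hyz
    exact ψ.symm.injective (Subtype.ext (Prod.ext hyz.1 hyz.2))
  · intro y
    simp only [Equiv.symm_apply_apply]

-- The union bound: for each `v` there are `n^v` placements of `(|ι| v²)^(v+1)` graphs, each
-- realized with probability at most `(2/n)^(v+1)`, because `n - (v + 1) ≥ n/2`. The one surplus
-- edge leaves a factor `1/n`.
open Classical in
theorem card_not_isSparse_le (R : ℕ) (hn : 2 * (R + 1) ≤ n) :
    ((Finset.univ.filter fun τ : ι → Equiv.Perm (Fin n) => ¬ IsSparse R τ).card : ℝ) ≤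
      (∑ v ∈ Finset.range (R + 1),
        ((Fintype.card ι * (v * v) : ℕ) : ℝ) ^ (v + 1) * 2 ^ (v + 1)) / n *
        Fintype.card (ι → Equiv.Perm (Fin n)) := by
  set M := Fintype.card (ι → Equiv.Perm (Fin n))
  have hnpos : (0 : ℝ) < n := by
    have : 0 < n := by omega
    exact_mod_cast this
  have hsub : (Finset.univ.filter fun τ : ι → Equiv.Perm (Fin n) => ¬ IsSparse R τ) ⊆
      (Finset.range (R + 1)).biUnion fun v =>
        (Finset.univ : Finset ((Fin v → Fin n) × (Fin (v + 1) → ι × Fin v × Fin v))).biUnion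
          fun p => realizing v p.1 p.2 := by
    intro τ hτ
    obtain ⟨v, hv, u, c, h⟩ := exists_mem_realizing (Finset.mem_filter.1 hτ).2
    exact Finset.mem_biUnion.2 ⟨v, hv, Finset.mem_biUnion.2 ⟨(u, c), Finset.mem_univ _, h⟩⟩
  have hone : ∀ v ∈ Finset.range (R + 1), ∀ (u : Fin v → Fin n)
      (c : Fin (v + 1) → ι × Fin v × Fin v),
      ((realizing v u c).card : ℝ) ≤ M * (2 / n) ^ (v + 1) := by
    intro v hv u c
    have hv' := Finset.mem_range.1 hv
    have h1 : ((realizing v u c).card : ℝ) * ((n - (v + 1) : ℕ) : ℝ) ^ (v + 1) ≤ M := by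
      exact_mod_cast card_realizing_mul_le v u c
    have h2 : (n : ℝ) / 2 ≤ ((n - (v + 1) : ℕ) : ℝ) := by
      have : n ≤ 2 * (n - (v + 1)) := by omega
      have : (n : ℝ) ≤ 2 * ((n - (v + 1) : ℕ) : ℝ) := by exact_mod_cast this
      linarith
    have h3 : ((realizing v u c).card : ℝ) * ((n : ℝ) / 2) ^ (v + 1) ≤ M :=
      le_trans (by gcongr) h1
    have h4 : ((n : ℝ) / 2) ^ (v + 1) * (2 / n) ^ (v + 1) = 1 := by
      rw [← mul_pow, div_mul_div_comm, mul_comm, div_self (by positivity), one_pow]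
    calc ((realizing v u c).card : ℝ)
        = (realizing v u c).card * ((n : ℝ) / 2) ^ (v + 1) * (2 / n) ^ (v + 1) := by
          rw [mul_assoc, h4, mul_one]
      _ ≤ M * (2 / n) ^ (v + 1) := by gcongr
  have hle : (Finset.univ.filter fun τ : ι → Equiv.Perm (Fin n) => ¬ IsSparse R τ).card ≤
      ∑ v ∈ Finset.range (R + 1), ∑ p : (Fin v → Fin n) × (Fin (v + 1) → ι × Fin v × Fin v),
        (realizing v p.1 p.2).card :=
    (Finset.card_le_card hsub).trans (Finset.card_biUnion_le.trans
      (Finset.sum_le_sum fun v _ => Finset.card_biUnion_le))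
  calc ((Finset.univ.filter fun τ : ι → Equiv.Perm (Fin n) => ¬ IsSparse R τ).card : ℝ)
      ≤ ∑ v ∈ Finset.range (R + 1), ∑ p : (Fin v → Fin n) × (Fin (v + 1) → ι × Fin v × Fin v),
        ((realizing v p.1 p.2).card : ℝ) := by exact_mod_cast hle
    _ ≤ ∑ v ∈ Finset.range (R + 1), ∑ p : (Fin v → Fin n) × (Fin (v + 1) → ι × Fin v × Fin v),
        (M * (2 / n) ^ (v + 1) : ℝ) :=
        Finset.sum_le_sum fun v hv => Finset.sum_le_sum fun p _ => hone v hv p.1 p.2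
    _ = _ := by
        rw [Finset.sum_div, Finset.sum_mul]
        refine Finset.sum_congr rfl fun v _ => ?_
        rw [Finset.sum_const, Finset.card_univ, nsmul_eq_mul]
        simp only [Fintype.card_prod, Fintype.card_fun, Fintype.card_fin]
        push_cast
        rw [div_pow]
        field_simp
        ring

end Counting

theorem tendsto_uniformProb_isSparse (ι : Type*) [Finite ι] (R : ℕ) :
    Tendsto (fun n : ℕ => uniformProb (ι → Equiv.Perm (Fin n)) {τ | IsSparse R τ}) atTop (𝓝 1) := by
  classical
  have : Fintype ι := Fintype.ofFinite ι
  set C : ℝ := ∑ v ∈ Finset.range (R + 1),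
    ((Fintype.card ι * (v * v) : ℕ) : ℝ) ^ (v + 1) * 2 ^ (v + 1)
  have hlim : Tendsto (fun n : ℕ => 1 - C / n) atTop (𝓝 1) := by
    have := (tendsto_const_div_atTop_nhds_zero_nat C).const_sub 1
    simpa using this
  have hcard : ∀ n : ℕ, uniformProb (ι → Equiv.Perm (Fin n)) {τ | IsSparse R τ} =
      ((Finset.univ.filter fun τ : ι → Equiv.Perm (Fin n) => IsSparse R τ).card : ℝ) /
        Fintype.card (ι → Equiv.Perm (Fin n)) := by
    intro n
    rw [uniformProb, Nat.card_eq_fintype_card]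
    congr 2
    rw [← Set.ncard_coe_finset]
    congr 1
    ext τ
    simp
  have hpos : ∀ n : ℕ, (0 : ℝ) < Fintype.card (ι → Equiv.Perm (Fin n)) := fun n => by
    exact_mod_cast Fintype.card_pos
  refine tendsto_of_tendsto_of_tendsto_of_le_of_le' hlim tendsto_const_nhds ?_ ?_
  · filter_upwards [eventually_ge_atTop (2 * (R + 1))] with n hn
    rw [hcard, le_div_iff₀ (hpos n)]
    have h1 := card_not_isSparse_le (ι := ι) R hn
    have h2 := Finset.card_filter_add_card_filter_not (s := Finset.univ)
      fun τ : ι → Equiv.Perm (Fin n) => IsSparse R τ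
    rw [Finset.card_univ] at h2
    have h3 : ((Finset.univ.filter fun τ : ι → Equiv.Perm (Fin n) => IsSparse R τ).card : ℝ) +
        (Finset.univ.filter fun τ : ι → Equiv.Perm (Fin n) => ¬ IsSparse R τ).card =
        Fintype.card (ι → Equiv.Perm (Fin n)) := by exact_mod_cast h2
    rw [sub_mul, one_mul]
    linarith
  · filter_upwards with n
    rw [hcard, div_le_one (hpos n)]
    exact_mod_cast Finset.card_le_univ _

theorem uniformProb_mono {Ω : Type*} [Finite Ω] {A B : Set Ω} (h : A ⊆ B) :
    uniformProb Ω A ≤ uniformProb Ω B := by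
  unfold uniformProb
  gcongr
  exact Set.toFinite B

theorem uniformProb_le_one {Ω : Type*} [Finite Ω] (A : Set Ω) : uniformProb Ω A ≤ 1 := by
  unfold uniformProb
  refine div_le_one_of_le₀ ?_ (Nat.cast_nonneg _)
  rw [← Set.ncard_univ]
  exact_mod_cast Set.ncard_le_ncard (subset_univ A) (Set.toFinite _)

/-! ### Extension of homotopies over edges and disks -/

namespace OrGraph

variable {G : OrGraph.{u}} {Z : Type*} [TopologicalSpace Z]

namespace Skeleton

/-- The universal property of the realization of a graph. -/
def lift (a : G.V → Z) (p : G.E → C(unitInterval, Z)) (h0 : ∀ e, p e 0 = a (G.src e))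
    (h1 : ∀ e, p e 1 = a (G.tgt e)) : C(G.Skeleton, Z) where
  toFun := Quot.lift (Sum.elim (fun v => a v.1) (fun x => p x.1 x.2)) (by
    rintro _ _ (e | e)
    · exact h0 e
    · exact h1 e)
  continuous_toFun := by
    refine continuous_quot_lift _ (Continuous.sumElim ?_ ?_)
    · exact continuous_sigma fun v => (by
        change Continuous fun _ : PUnit.{1} => a v
        exact continuous_const)
    · exact continuous_sigma fun e => (p e).continuous

@[simp]
theorem lift_edgePoint (a : G.V → Z) (p : G.E → C(unitInterval, Z)) (h0) (h1) (e : G.E)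
    (s : unitInterval) : lift a p h0 h1 (G.edgePoint e s) = p e s := rfl

theorem forall_of {P : G.Skeleton → Prop} (hv : ∀ v, P (G.vertexPoint v))
    (he : ∀ e s, P (G.edgePoint e s)) (x : G.Skeleton) : P x := by
  rcases x with ⟨⟨v, ⟨⟩⟩ | ⟨e, s⟩⟩
  · exact hv v
  · exact he e s

end Skeleton

theorem edgePoint_zero (e : G.E) : G.edgePoint e 0 = G.vertexPoint (G.src e) :=
  Quot.sound (.src e)

theorem edgePoint_one (e : G.E) : G.edgePoint e 1 = G.vertexPoint (G.tgt e) :=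
  Quot.sound (.tgt e)

/-- An edge as a continuous path. -/
def edgeMap (G : OrGraph.{u}) (e : G.E) : C(unitInterval, G.Skeleton) where
  toFun := G.edgePoint e
  continuous_toFun := continuous_quot_mk.comp (continuous_inr.comp continuous_sigmaMk)

end OrGraph

section Extension

variable {Z : Type*} [TopologicalSpace Z]

/-- The concatenation of the reverse of `P`, of `γ` and of `Q`, parametrized by `[-1, 2]`. -/
noncomputable def extendEdge (P γ Q : C(unitInterval, Z)) (h0 : γ 0 = P 0) (h1 : γ 1 = Q 0) :
    C(ℝ, Z) where
  toFun u := if u ≤ 0 then P (projIcc 0 1 zero_le_one (-u)) else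
    if u ≤ 1 then γ (projIcc 0 1 zero_le_one u) else Q (projIcc 0 1 zero_le_one (u - 1))
  continuous_toFun := by
    have hp : Continuous (projIcc (0 : ℝ) 1 zero_le_one) := continuous_projIcc
    refine Continuous.if_le (by fun_prop) ?_ continuous_id continuous_const ?_
    · refine Continuous.if_le (by fun_prop) (by fun_prop) continuous_id continuous_const ?_
      intro u hu
      rw [hu, sub_self, projIcc_left, projIcc_right]
      exact h1
    · intro u hu
      rw [hu, if_pos zero_le_one, neg_zero, projIcc_left]
      exact h0.symm

variable {P γ Q : C(unitInterval, Z)} {h0 : γ 0 = P 0} {h1 : γ 1 = Q 0}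

theorem extendEdge_neg (t : unitInterval) : extendEdge P γ Q h0 h1 (-t) = P t := by
  change (if -(t : ℝ) ≤ 0 then _ else _) = _
  rw [if_pos (by linarith [t.2.1]), neg_neg, projIcc_val]

theorem extendEdge_coe (s : unitInterval) : extendEdge P γ Q h0 h1 s = γ s := by
  change (if (s : ℝ) ≤ 0 then _ else if (s : ℝ) ≤ 1 then _ else _) = _
  split_ifs with h h'
  · have : s = 0 := Subtype.ext (le_antisymm h s.2.1)
    subst this
    rw [h0]
    congr 1
    simp
  · rw [projIcc_val]
  · exact absurd s.2.2 h'

theorem extendEdge_one_add (t : unitInterval) : extendEdge P γ Q h0 h1 (1 + t) = Q t := by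
  have ht := t.2.1
  change (if 1 + (t : ℝ) ≤ 0 then _ else if 1 + (t : ℝ) ≤ 1 then _ else _) = _
  rw [if_neg (by linarith)]
  split_ifs with h
  · have : t = 0 := Subtype.ext (le_antisymm (by change (t : ℝ) ≤ 0; linarith) ht)
    subst this
    rw [← h1]
    congr 1
    simp
  · rw [add_sub_cancel_left, projIcc_val]

theorem map_extendEdge {Z' : Type*} [TopologicalSpace Z'] (F : C(Z, Z')) (δ : C(unitInterval, Z'))
    (hP : ∀ t, F (P t) = δ 0) (hγ : ∀ s, F (γ s) = δ s) (hQ : ∀ t, F (Q t) = δ 1) (u : ℝ) :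
    F (extendEdge P γ Q h0 h1 u) = δ (projIcc 0 1 zero_le_one u) := by
  change F (if u ≤ 0 then _ else if u ≤ 1 then _ else _) = _
  split_ifs with h h'
  · rw [hP, projIcc_of_le_left _ h]; rfl
  · rw [hγ]
  · rw [hQ, projIcc_of_right_le _ (not_le.1 h').le]; rfl

/-- The homotopy of a disk that extends the homotopy `K` of its boundary, in polar
coordinates. -/
noncomputable def extendDisk (c : C(unitInterval × UnitAddCircle, Z))
    (K : C(UnitAddCircle, C(unitInterval, Z))) (h : ∀ θ, c (1, θ) = K θ 0) :
    C(unitInterval × UnitAddCircle, C(unitInterval, Z)) :=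
  ContinuousMap.curry ⟨fun y : (unitInterval × UnitAddCircle) × unitInterval =>
    -- At time `t` the disk is enlarged to radius `1 + t`, and its part beyond radius 1 is mapped
    -- along the tracks of the boundary points.
    if (y.1.1 : ℝ) * (1 + y.2) ≤ 1 then
      c (projIcc 0 1 zero_le_one ((y.1.1 : ℝ) * (1 + y.2)), y.1.2)
    else (⟨fun p : unitInterval × UnitAddCircle => K p.2 p.1, by fun_prop⟩ :
        C(unitInterval × UnitAddCircle, Z))
      (projIcc 0 1 zero_le_one ((y.1.1 : ℝ) * (1 + y.2) - 1), y.1.2), by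
    refine Attachment.continuous_pasteCell _ _ (by fun_prop) (by fun_prop) (by fun_prop) ?_
    intro y hy
    rw [hy, sub_self, projIcc_left]
    exact h _⟩

variable {c : C(unitInterval × UnitAddCircle, Z)} {K : C(UnitAddCircle, C(unitInterval, Z))}
  {h : ∀ θ, c (1, θ) = K θ 0}

theorem extendDisk_apply (ρ : unitInterval) (θ : UnitAddCircle) (t : unitInterval) :
    extendDisk c K h (ρ, θ) t = if (ρ : ℝ) * (1 + t) ≤ 1 then
      c (projIcc 0 1 zero_le_one ((ρ : ℝ) * (1 + t)), θ)
    else K θ (projIcc 0 1 zero_le_one ((ρ : ℝ) * (1 + t) - 1)) := rfl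

theorem extendDisk_one (θ : UnitAddCircle) : extendDisk c K h (1, θ) = K θ := by
  ext t
  have ht := t.2.1
  rw [extendDisk_apply]
  simp only [Icc.coe_one, one_mul, add_sub_cancel_left, projIcc_val]
  split_ifs with h'
  · have : t = 0 := Subtype.ext (le_antisymm (by change (t : ℝ) ≤ 0; linarith) ht)
    subst this
    rw [← h]
    congr 2
    simp
  · rfl

theorem extendDisk_zero (hc : ∀ θ θ', c (0, θ) = c (0, θ')) (θ θ' : UnitAddCircle) :
    extendDisk c K h (0, θ) = extendDisk c K h (0, θ') := by
  ext t
  rw [extendDisk_apply, extendDisk_apply]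
  simp only [Icc.coe_zero, zero_mul, zero_le_one, if_true, projIcc_left]
  exact hc _ _

theorem extendDisk_start (p : unitInterval × UnitAddCircle) : extendDisk c K h p 0 = c p := by
  obtain ⟨ρ, θ⟩ := p
  rw [extendDisk_apply]
  simp only [Icc.coe_zero, add_zero, mul_one, projIcc_val]
  rw [if_pos ρ.2.2]

/-- Naturality of the extension. It identifies the composite of `expand` and `collapse` on a cell
with `collapsedTrack` at time 1. -/
theorem map_extendDisk {Z' : Type*} [TopologicalSpace Z'] (F : C(Z, Z'))
    {c' : C(unitInterval × UnitAddCircle, Z')} {K' : C(UnitAddCircle, C(unitInterval, Z'))}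
    {h' : ∀ θ, c' (1, θ) = K' θ 0} (hc : ∀ p, F (c p) = c' p) (hK : ∀ θ t, F (K θ t) = K' θ t)
    (p : unitInterval × UnitAddCircle) (t : unitInterval) :
    F (extendDisk c K h p t) = extendDisk c' K' h' p t := by
  obtain ⟨ρ, θ⟩ := p
  rw [extendDisk_apply, extendDisk_apply]
  split_ifs
  · exact hc _
  · exact hK _ _

end Extension

/-! ### Collapsing disjoint closed cells -/

namespace PolygonalComplex

variable {W : PolygonalComplex.{u}}

/-- The boundaries of the cells in `S` are disjoint embedded cycles. -/
def DisjointCycles (W : PolygonalComplex.{u}) (S : Set W.F) : Prop :=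
  ∀ f ∈ S, ∀ g ∈ S, ∀ i j : ℤ, W.tail (W.bd f i) = W.tail (W.bd g j) →
    f = g ∧ i ≡ j [ZMOD W.len f]

theorem bd_eq_of_modEq {f : W.F} {i j : ℤ} (h : i ≡ j [ZMOD W.len f]) : W.bd f i = W.bd f j := by
  obtain ⟨r, hr⟩ := h.dvd
  rw [show j = i + r * W.len f by linarith [mul_comm (W.len f : ℤ) r], bd_add_mul]

theorem angle_eq_of_modEq {f : W.F} {i j : ℤ} (h : i ≡ j [ZMOD W.len f]) (s : ℝ) :
    ((((i : ℝ) + s) / W.len f : ℝ) : UnitAddCircle) =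
      ((((j : ℝ) + s) / W.len f : ℝ) : UnitAddCircle) := by
  obtain ⟨r, hr⟩ := h.dvd
  have h1 : (j : ℝ) = i + W.len f * r := by
    have : j = i + W.len f * r := by linarith
    exact_mod_cast this
  have h2 : ((j : ℝ) + s) / W.len f = ((i : ℝ) + s) / W.len f + r := by
    rw [h1]
    field_simp [len_ne_zero f]
    ring
  rw [h2, AddCircle.coe_add]
  have h3 : ((r : ℝ) : UnitAddCircle) = 0 := by
    have := AddCircle.coe_eq_zero_iff (1 : ℝ) (x := (r : ℝ))
    rw [this]
    exact ⟨r, by simp⟩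
  rw [h3, add_zero]

/-- If the edge were traversed in opposite directions, the tail of `bd f i` would be the vertex at
position `j + 1` of `g`. Disjointness then gives `f = g` and `i ≡ j + 1`, so the boundary word would
backtrack at this vertex. -/
theorem DisjointCycles.edge_inj {S : Set W.F} (hS : W.DisjointCycles S) (hred : W.IsReduced)
    {f g : W.F} (hf : f ∈ S) (hg : g ∈ S) {i j : ℤ} (h : (W.bd f i).1 = (W.bd g j).1) :
    f = g ∧ i ≡ j [ZMOD W.len f] := by
  rcases OrGraph.eq_or_eq_rev_of_fst_eq h with h | h
  · exact hS f hf g hg i j (by rw [h])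
  · exfalso
    obtain ⟨rfl, h1⟩ := hS f hf g hg i (j + 1) (by rw [h, OrGraph.tail_rev, W.bd_chain])
    rw [bd_eq_of_modEq h1] at h
    exact hred f j h

theorem exists_angle (f : W.F) (θ : UnitAddCircle) :
    ∃ (k : ℤ) (s : unitInterval), θ = ((((k : ℝ) + s) / W.len f : ℝ) : UnitAddCircle) := by
  induction θ using QuotientAddGroup.induction_on with | _ t =>
  refine ⟨⌊W.len f * t⌋, ⟨Int.fract (W.len f * t), Int.fract_nonneg _, (Int.fract_lt_one _).le⟩, ?_⟩
  simp only [Int.floor_add_fract]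
  rw [mul_div_cancel_left₀ _ (len_ne_zero f)]

variable (W) in
/-- The vertices `v` and `w` lie on the boundary of the same cell in `S`. -/
def CollapseRel (S : Set W.F) (v w : W.V) : Prop :=
  ∃ f ∈ S, ∃ i j : ℤ, v = W.tail (W.bd f i) ∧ w = W.tail (W.bd f j)

variable (W) in
/-- The edge `e` lies on the boundary of a cell in `S`. -/
def IsCollapsed (S : Set W.F) (e : W.E) : Prop := ∃ f ∈ S, ∃ i : ℤ, (W.bd f i).1 = e

variable (W) in
/-- The graph in which the boundary of each cell in `S` is collapsed to a vertex. -/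
def collapseGraph (S : Set W.F) : OrGraph.{u} where
  V := Quot (W.CollapseRel S)
  E := {e : W.E // ¬ W.IsCollapsed S e}
  src e := Quot.mk _ (W.src e.1)
  tgt e := Quot.mk _ (W.tgt e.1)

theorem IsCollapsed.mk_src_eq_tgt {S : Set W.F} {e : W.E} (h : W.IsCollapsed S e) :
    Quot.mk (W.CollapseRel S) (W.src e) = Quot.mk (W.CollapseRel S) (W.tgt e) := by
  obtain ⟨f, hf, i, rfl⟩ := h
  have h1 : Quot.mk (W.CollapseRel S) (W.tail (W.bd f i)) =
      Quot.mk (W.CollapseRel S) (W.head (W.bd f i)) :=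
    Quot.sound ⟨f, hf, i, i + 1, rfl, W.bd_chain f i⟩
  unfold OrGraph.tail OrGraph.head at h1
  split_ifs at h1
  · exact h1
  · exact h1.symm

open Classical in
/-- The collapse of the boundaries of the cells in `S`. -/
noncomputable def collapseMap (S : Set W.F) : C(W.Skeleton, (W.collapseGraph S).Skeleton) :=
  OrGraph.Skeleton.lift (fun v => (W.collapseGraph S).vertexPoint (Quot.mk _ v))
    (fun e => if h : W.IsCollapsed S e then
        ContinuousMap.const _ ((W.collapseGraph S).vertexPoint (Quot.mk _ (W.src e)))
      else (W.collapseGraph S).edgeMap ⟨e, h⟩)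
    (fun e => by
      split_ifs with h
      · rfl
      · exact OrGraph.edgePoint_zero (G := W.collapseGraph S) ⟨e, h⟩)
    (fun e => by
      split_ifs with h
      · rw [h.mk_src_eq_tgt]; rfl
      · exact OrGraph.edgePoint_one (G := W.collapseGraph S) ⟨e, h⟩)

theorem collapseMap_edgePoint_of_not (S : Set W.F) {e : W.E} (h : ¬ W.IsCollapsed S e)
    (s : unitInterval) :
    collapseMap S (W.edgePoint e s) = (W.collapseGraph S).edgePoint ⟨e, h⟩ s := by
  simp only [collapseMap, OrGraph.Skeleton.lift_edgePoint, h, dif_neg, not_false_eq_true]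
  rfl

theorem collapseMap_edgePoint_of_isCollapsed (S : Set W.F) {e : W.E} (h : W.IsCollapsed S e)
    (s : unitInterval) :
    collapseMap S (W.edgePoint e s) =
      (W.collapseGraph S).vertexPoint (Quot.mk _ (W.src e)) := by
  simp [collapseMap, h]

theorem collapseMap_dartPoint_of_not (S : Set W.F) {d : W.Dart} (h : ¬ W.IsCollapsed S d.1)
    (s : unitInterval) :
    collapseMap S (W.dartPoint d s) = (W.collapseGraph S).dartPoint (⟨d.1, h⟩, d.2) s := by
  unfold OrGraph.dartPoint
  split_ifs <;> exact collapseMap_edgePoint_of_not S h _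

theorem collapseMap_dartPoint_of_isCollapsed (S : Set W.F) {d : W.Dart} (h : W.IsCollapsed S d.1)
    (s : unitInterval) :
    collapseMap S (W.dartPoint d s) =
      (W.collapseGraph S).vertexPoint (Quot.mk _ (W.tail d)) := by
  unfold OrGraph.dartPoint OrGraph.tail
  split_ifs
  · exact collapseMap_edgePoint_of_isCollapsed S h _
  · rw [collapseMap_edgePoint_of_isCollapsed S h, h.mk_src_eq_tgt]

theorem collapseMap_attach {S : Set W.F} {f : W.F} (hf : f ∈ S) (θ : UnitAddCircle) :
    collapseMap S (W.attach f θ) =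
      (W.collapseGraph S).vertexPoint (Quot.mk _ (W.tail (W.bd f 0))) := by
  obtain ⟨k, s, rfl⟩ := exists_angle f θ
  rw [attach_div_add, collapseMap_dartPoint_of_isCollapsed S ⟨f, hf, k, rfl⟩]
  congr 1
  exact Quot.sound ⟨f, hf, k, 0, rfl, rfl⟩

end PolygonalComplex

namespace PolygonalComplex

variable {W : PolygonalComplex.{u}} {S : Set W.F}

/-- A vertex on the boundary of a cell in `S`. -/
def IsCollapsedVertex (S : Set W.F) (v : W.V) : Prop := ∃ f ∈ S, ∃ i : ℤ, W.tail (W.bd f i) = v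

open Classical in
/-- The path from a vertex to the center of the cell in `S` on whose boundary it lies. -/
noncomputable def vertexTrack (S : Set W.F) (v : W.V) :
    C(unitInterval, Attachment W.attach) :=
  if h : IsCollapsedVertex S v then
    ⟨fun t => Attachment.cell W.attach h.choose
      (unitInterval.symm t, ((((h.choose_spec.2.choose : ℝ) + 0) / W.len h.choose : ℝ) :
        UnitAddCircle)), by fun_prop⟩
  else ContinuousMap.const _ (Attachment.base W.attach (W.vertexPoint v))

/-- Disjointness makes the cell unique and the position unique modulo the perimeter, so the angle
does not depend on the choices in `vertexTrack`. -/
theorem vertexTrack_of_mem (hS : W.DisjointCycles S) {f : W.F} (hf : f ∈ S) (i : ℤ)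
    (t : unitInterval) :
    vertexTrack S (W.tail (W.bd f i)) t = Attachment.cell W.attach f
      (unitInterval.symm t, ((((i : ℝ) + 0) / W.len f : ℝ) : UnitAddCircle)) := by
  have h : IsCollapsedVertex S (W.tail (W.bd f i)) := ⟨f, hf, i, rfl⟩
  obtain ⟨h1, h2⟩ := hS _ h.choose_spec.1 f hf _ _ h.choose_spec.2.choose_spec
  rw [vertexTrack, dif_pos h]
  change Attachment.cell W.attach h.choose (_, _) = _
  rw [angle_eq_of_modEq h2, h1]

theorem vertexTrack_of_not {v : W.V} (h : ¬ IsCollapsedVertex S v) (t : unitInterval) :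
    vertexTrack S v t = Attachment.base W.attach (W.vertexPoint v) := by
  rw [vertexTrack, dif_neg h]
  rfl

theorem vertexTrack_zero (hS : W.DisjointCycles S) (v : W.V) :
    vertexTrack S v 0 = Attachment.base W.attach (W.vertexPoint v) := by
  by_cases h : IsCollapsedVertex S v
  · obtain ⟨f, hf, i, rfl⟩ := h
    have h1 := attach_div_add f i (0 : unitInterval)
    rw [W.dartPoint_zero] at h1
    rw [vertexTrack_of_mem hS hf, unitInterval.symm_zero, Attachment.cell_one, ← h1]
    simp
  · exact vertexTrack_of_not h 0

theorem vertexTrack_one_congr (hS : W.DisjointCycles S) {v w : W.V} (h : W.CollapseRel S v w) :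
    vertexTrack S v 1 = vertexTrack S w 1 := by
  obtain ⟨f, hf, i, j, rfl, rfl⟩ := h
  rw [vertexTrack_of_mem hS hf, vertexTrack_of_mem hS hf, unitInterval.symm_one]
  exact Attachment.cell_zero _ _ _ _

/-- An edge outside of the cells in `S` together with the tracks of its end points. -/
noncomputable def edgeTrack (hS : W.DisjointCycles S) (e : W.E) : C(ℝ, Attachment W.attach) :=
  extendEdge (vertexTrack S (W.src e)) ((Attachment.base W.attach).comp (W.edgeMap e))
    (vertexTrack S (W.tgt e))
    (by rw [vertexTrack_zero hS, ← OrGraph.edgePoint_zero]; rfl)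
    (by rw [vertexTrack_zero hS, ← OrGraph.edgePoint_one]; rfl)

/-- The reparametrization that makes room for the tracks of the end points. -/
noncomputable def stretch : C(unitInterval × unitInterval, ℝ) :=
  -- At time `t` the unit interval is mapped onto `[-t, 1 + t]`: the edge together with the parts of
  -- both tracks covered up to time `t`.
  ⟨fun p => (p.1 : ℝ) * (1 + 2 * p.2) - p.2, by fun_prop⟩

/-- The angle in the boundary of `f` of the point `s` of the edge `(bd f i).1`. -/
noncomputable def edgeAngle (f : W.F) (i : ℤ) : C(unitInterval, UnitAddCircle) :=
  ⟨fun s => ((((i : ℝ) + (if (W.bd f i).2 then s else unitInterval.symm s : unitInterval)) /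
      W.len f : ℝ) : UnitAddCircle), by
    have : Continuous fun x : ℝ => (x : UnitAddCircle) := AddCircle.continuous_mk' 1
    split_ifs <;> fun_prop⟩

theorem attach_edgeAngle (f : W.F) (i : ℤ) (s : unitInterval) :
    W.attach f (edgeAngle f i s) = W.edgePoint (W.bd f i).1 s := by
  change W.attach f ((_ : ℝ) : UnitAddCircle) = _
  rw [attach_div_add]
  unfold OrGraph.dartPoint
  split_ifs
  · rfl
  · rw [unitInterval.symm_symm]

open Classical in
/-- The homotopy of the 1-skeleton that contracts the boundaries of the cells in `S`. -/
noncomputable def skeletonTrack (hS : W.DisjointCycles S) :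
    C(W.Skeleton, C(unitInterval, Attachment W.attach)) :=
  OrGraph.Skeleton.lift (vertexTrack S)
    (fun e => if h : W.IsCollapsed S e then
        ContinuousMap.curry ⟨fun p : unitInterval × unitInterval =>
          Attachment.cell W.attach h.choose
            (unitInterval.symm p.2, edgeAngle h.choose h.choose_spec.2.choose p.1), by fun_prop⟩
      else ContinuousMap.curry ((edgeTrack hS e).comp stretch))
    (fun e => by
      split_ifs with h
      · ext t
        have hs := h.choose_spec.2.choose_spec
        set f := h.choose
        set i := h.choose_spec.2.choose
        change Attachment.cell W.attach f (unitInterval.symm t, edgeAngle f i 0) = _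
        rw [← hs]
        by_cases hb : (W.bd f i).2
        · rw [show W.src (W.bd f i).1 = W.tail (W.bd f i) by simp [OrGraph.tail, hb],
            vertexTrack_of_mem hS h.choose_spec.1]
          simp [edgeAngle, hb, f]
        · rw [show W.src (W.bd f i).1 = W.tail (W.bd f (i + 1)) by
            rw [← W.bd_chain]; simp [OrGraph.head, hb], vertexTrack_of_mem hS h.choose_spec.1]
          simp [edgeAngle, hb, f]
      · ext t
        change edgeTrack hS e (stretch (0, t)) = _
        rw [show stretch (0, t) = -(t : ℝ) by simp [stretch]]
        exact extendEdge_neg t)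
    (fun e => by
      split_ifs with h
      · ext t
        have hs := h.choose_spec.2.choose_spec
        set f := h.choose
        set i := h.choose_spec.2.choose
        change Attachment.cell W.attach f (unitInterval.symm t, edgeAngle f i 1) = _
        rw [← hs]
        by_cases hb : (W.bd f i).2
        · rw [show W.tgt (W.bd f i).1 = W.tail (W.bd f (i + 1)) by
            rw [← W.bd_chain]; simp [OrGraph.head, hb], vertexTrack_of_mem hS h.choose_spec.1]
          simp [edgeAngle, hb, f]
        · rw [show W.tgt (W.bd f i).1 = W.tail (W.bd f i) by simp [OrGraph.tail, hb],
            vertexTrack_of_mem hS h.choose_spec.1]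
          simp [edgeAngle, hb, f]
      · ext t
        change edgeTrack hS e (stretch (1, t)) = _
        rw [show stretch (1, t) = 1 + (t : ℝ) by simp [stretch]; ring]
        exact extendEdge_one_add t)

section Track

variable (hS : W.DisjointCycles S)

theorem skeletonTrack_edgePoint_of_not {e : W.E} (h : ¬ W.IsCollapsed S e) (s t : unitInterval) :
    skeletonTrack hS (W.edgePoint e s) t = edgeTrack hS e (stretch (s, t)) := by
  simp only [skeletonTrack, OrGraph.Skeleton.lift_edgePoint, h, dif_neg, not_false_eq_true]
  rfl

/-- On the boundary of a collapsing cell the homotopy is the radial contraction; `edge_inj` removes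
the choice of cell and position made for each edge. -/
theorem skeletonTrack_attach (hred : W.IsReduced) {f : W.F} (hf : f ∈ S) (θ : UnitAddCircle) (t : unitInterval) :
    skeletonTrack hS (W.attach f θ) t =
      Attachment.cell W.attach f (unitInterval.symm t, θ) := by
  obtain ⟨k, s, rfl⟩ := exists_angle f θ
  have h : W.IsCollapsed S (W.bd f k).1 := ⟨f, hf, k, rfl⟩
  have key : ∀ s', skeletonTrack hS (W.edgePoint (W.bd f k).1 s') t =
      Attachment.cell W.attach f (unitInterval.symm t, edgeAngle f k s') := by
    intro s'
    simp only [skeletonTrack, OrGraph.Skeleton.lift_edgePoint, h, dif_pos]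
    change Attachment.cell W.attach h.choose
      (unitInterval.symm t, edgeAngle h.choose h.choose_spec.2.choose s') = _
    obtain ⟨h1, h2⟩ := hS.edge_inj hred h.choose_spec.1 hf h.choose_spec.2.choose_spec
    generalize h.choose_spec.2.choose = i at h2 ⊢
    generalize h.choose = g at h1 h2 ⊢
    subst h1
    have h3 : edgeAngle g i s' = edgeAngle g k s' := by
      change ((_ : ℝ) : UnitAddCircle) = ((_ : ℝ) : UnitAddCircle)
      rw [bd_eq_of_modEq h2, angle_eq_of_modEq h2]
    rw [h3]
  rw [attach_div_add]
  unfold OrGraph.dartPoint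
  split_ifs with hb
  · rw [key]
    simp [edgeAngle, hb]
  · rw [key]
    simp [edgeAngle, hb]

theorem skeletonTrack_zero (hred : W.IsReduced) (x : W.Skeleton) :
    skeletonTrack hS x 0 = Attachment.base W.attach x := by
  refine OrGraph.Skeleton.forall_of (P := fun x => skeletonTrack hS x 0 = _)
    (fun v => vertexTrack_zero hS v) (fun e s => ?_) x
  by_cases h : W.IsCollapsed S e
  · obtain ⟨f, hf, i, rfl⟩ := h
    rw [← attach_edgeAngle, skeletonTrack_attach hS hred hf, unitInterval.symm_zero,
      Attachment.cell_one]
  · rw [skeletonTrack_edgePoint_of_not hS h,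
      show stretch (s, 0) = s by simp [stretch]]
    exact extendEdge_coe s

variable (S) in
/-- The attaching maps of the cells outside `S` in the collapsed graph. -/
noncomputable def collapseAttach (f : {f : W.F // f ∉ S}) :
    C(UnitAddCircle, (W.collapseGraph S).Skeleton) := (collapseMap S).comp (W.attach f.1)

variable (S) in
open Classical in
/-- The collapse of the closed cells in `S`. -/
noncomputable def collapse : C(Attachment W.attach, Attachment (collapseAttach S)) :=
  Attachment.lift ((Attachment.base _).comp (collapseMap S))
    (fun f => if h : f ∈ S then
        ContinuousMap.const _ (Attachment.base _ ((W.collapseGraph S).vertexPoint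
          (Quot.mk _ (W.tail (W.bd f 0)))))
      else Attachment.cell (collapseAttach S) ⟨f, h⟩)
    (fun f θ => by
      split_ifs with h
      · exact congrArg (Attachment.base (collapseAttach S)) (collapseMap_attach h θ).symm
      · exact Attachment.cell_one _ _ _)
    (fun f θ θ' => by
      split_ifs with h
      · rfl
      · exact Attachment.cell_zero _ _ _ _)

theorem collapse_base (x : W.Skeleton) :
    collapse S (Attachment.base _ x) = Attachment.base _ (collapseMap S x) := rfl

theorem collapse_cell_of_mem {f : W.F} (h : f ∈ S) (p : unitInterval × UnitAddCircle) :
    collapse S (Attachment.cell _ f p) = Attachment.base _ ((W.collapseGraph S).vertexPoint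
      (Quot.mk _ (W.tail (W.bd f 0)))) := by
  simp [collapse, h]

theorem collapse_cell_of_notMem {f : W.F} (h : f ∉ S) (p : unitInterval × UnitAddCircle) :
    collapse S (Attachment.cell _ f p) = Attachment.cell (collapseAttach S) ⟨f, h⟩ p := by
  simp [collapse, h]

theorem cell_one_eq_skeletonTrack (hred : W.IsReduced) (f : W.F) (θ : UnitAddCircle) :
    Attachment.cell W.attach f (1, θ) = ((skeletonTrack hS).comp (W.attach f)) θ 0 := by
  change _ = skeletonTrack hS (W.attach f θ) 0
  rw [Attachment.cell_one, skeletonTrack_zero hS hred]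

open Classical in
/-- The homotopy that contracts the closed cells in `S` to their centers. -/
noncomputable def track (hred : W.IsReduced) :
    C(Attachment W.attach, C(unitInterval, Attachment W.attach)) :=
  Attachment.lift (skeletonTrack hS)
    (fun f => if f ∈ S then
        ContinuousMap.curry ⟨fun p : (unitInterval × UnitAddCircle) × unitInterval =>
          Attachment.cell W.attach f (p.1.1 * unitInterval.symm p.2, p.1.2), by fun_prop⟩
      else extendDisk (Attachment.cell W.attach f) ((skeletonTrack hS).comp (W.attach f))
        (cell_one_eq_skeletonTrack hS hred f))
    (fun f θ => by
      split_ifs with h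
      · ext t
        rw [skeletonTrack_attach hS hred h]
        change Attachment.cell W.attach f (1 * unitInterval.symm t, θ) = _
        rw [one_mul]
      · exact extendDisk_one θ)
    (fun f θ θ' => by
      split_ifs with h
      · ext t
        change Attachment.cell W.attach f (0 * unitInterval.symm t, θ) =
          Attachment.cell W.attach f (0 * unitInterval.symm t, θ')
        rw [zero_mul]
        exact Attachment.cell_zero _ _ _ _
      · exact extendDisk_zero (Attachment.cell_zero _ _) θ θ')

theorem track_zero (hred : W.IsReduced) (y : Attachment W.attach) : track hS hred y 0 = y := by
  refine Attachment.forall_of (P := fun y => track hS hred y 0 = y)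
    (skeletonTrack_zero hS hred) (fun f p => ?_) y
  by_cases h : f ∈ S
  · simp only [track, Attachment.lift_cell, h, if_true]
    change Attachment.cell W.attach f (p.1 * unitInterval.symm 0, p.2) = _
    rw [unitInterval.symm_zero, mul_one]
  · simp only [track, Attachment.lift_cell, h, if_false]
    exact extendDisk_start p

/-- The homotopy inverse of the collapse, on the 1-skeleton. -/
noncomputable def expandSkeleton : C((W.collapseGraph S).Skeleton, Attachment W.attach) :=
  OrGraph.Skeleton.lift
    (Quot.lift (fun v => vertexTrack S v 1) fun _ _ h => vertexTrack_one_congr hS h)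
    (fun e => (edgeTrack hS e.1).comp
      ⟨fun s => stretch (s, 1), stretch.continuous.comp (by fun_prop)⟩)
    (fun e => by
      change edgeTrack hS e.1 (stretch (0, 1)) = vertexTrack S (W.src e.1) 1
      rw [show stretch (0, 1) = -((1 : unitInterval) : ℝ) by simp [stretch]]
      exact extendEdge_neg 1)
    (fun e => by
      change edgeTrack hS e.1 (stretch (1, 1)) = vertexTrack S (W.tgt e.1) 1
      rw [show stretch (1, 1) = 1 + ((1 : unitInterval) : ℝ) by simp [stretch]; ring]
      exact extendEdge_one_add 1)

theorem expandSkeleton_collapseMap (hred : W.IsReduced) (x : W.Skeleton) :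
    expandSkeleton hS (collapseMap S x) = skeletonTrack hS x 1 := by
  refine OrGraph.Skeleton.forall_of
    (P := fun x => expandSkeleton hS (collapseMap S x) = skeletonTrack hS x 1)
    (fun v => rfl) (fun e s => ?_) x
  by_cases h : W.IsCollapsed S e
  · rw [collapseMap_edgePoint_of_isCollapsed S h]
    change vertexTrack S (W.src e) 1 = _
    have h1 : vertexTrack S (W.src e) 1 = skeletonTrack hS (W.edgePoint e 0) 1 := by
      rw [OrGraph.edgePoint_zero]; rfl
    obtain ⟨f, hf, i, rfl⟩ := h
    rw [h1, ← attach_edgeAngle, ← attach_edgeAngle, skeletonTrack_attach hS hred hf,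
      skeletonTrack_attach hS hred hf, unitInterval.symm_one]
    exact Attachment.cell_zero _ _ _ _
  · rw [collapseMap_edgePoint_of_not S h, skeletonTrack_edgePoint_of_not hS h]
    rfl

/-- The homotopy inverse of the collapse. -/
noncomputable def expand (hred : W.IsReduced) : C(Attachment (collapseAttach S), Attachment W.attach) :=
  Attachment.lift (expandSkeleton hS)
    (fun f => ⟨fun p => extendDisk (Attachment.cell W.attach f.1)
        ((skeletonTrack hS).comp (W.attach f.1)) (cell_one_eq_skeletonTrack hS hred f.1) p 1,
        by fun_prop⟩)
    (fun f θ => (DFunLike.congr_fun (extendDisk_one (h := cell_one_eq_skeletonTrack hS hred f.1) θ)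
      1).trans (expandSkeleton_collapseMap hS hred (W.attach f.1 θ)).symm)
    (fun f θ θ' => DFunLike.congr_fun (extendDisk_zero
      (h := cell_one_eq_skeletonTrack hS hred f.1) (Attachment.cell_zero _ _) θ θ') 1)

theorem expand_collapse (hred : W.IsReduced) (y : Attachment W.attach) :
    expand hS hred (collapse S y) = track hS hred y 1 := by
  refine Attachment.forall_of
    (P := fun y => expand hS hred (collapse S y) = track hS hred y 1)
    (expandSkeleton_collapseMap hS hred) (fun f p => ?_) y
  by_cases h : f ∈ S
  · rw [collapse_cell_of_mem h]
    simp only [track, Attachment.lift_cell, h, if_true]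
    change vertexTrack S (W.tail (W.bd f 0)) 1 =
      Attachment.cell W.attach f (p.1 * unitInterval.symm 1, p.2)
    rw [vertexTrack_of_mem hS h, unitInterval.symm_one, mul_zero]
    exact Attachment.cell_zero _ _ _ _
  · rw [collapse_cell_of_notMem h]
    simp only [track, Attachment.lift_cell, h, if_false]
    rfl

variable (S) in
/-- The homotopy of the collapsed graph induced by `skeletonTrack`. -/
noncomputable def collapsedSkeletonTrack :
    C((W.collapseGraph S).Skeleton, C(unitInterval, (W.collapseGraph S).Skeleton)) :=
  OrGraph.Skeleton.lift (fun v => ContinuousMap.const _ ((W.collapseGraph S).vertexPoint v))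
    (fun e => ContinuousMap.curry (((W.collapseGraph S).edgeMap e).comp
      ⟨fun p => projIcc 0 1 zero_le_one (stretch p), by
        exact continuous_projIcc.comp stretch.continuous⟩))
    (fun e => by
      ext t
      change (W.collapseGraph S).edgePoint e (projIcc 0 1 zero_le_one (stretch (0, t))) = _
      rw [projIcc_of_le_left _ (by simp [stretch, t.2.1])]
      exact OrGraph.edgePoint_zero e)
    (fun e => by
      ext t
      change (W.collapseGraph S).edgePoint e (projIcc 0 1 zero_le_one (stretch (1, t))) = _
      rw [projIcc_of_right_le _ (by simp [stretch]; linarith [t.2.1])]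
      exact OrGraph.edgePoint_one e)

theorem collapse_vertexTrack (hS : W.DisjointCycles S) (v : W.V) (t : unitInterval) :
    collapse S (vertexTrack S v t) =
      Attachment.base _ ((W.collapseGraph S).vertexPoint (Quot.mk _ v)) := by
  by_cases h : IsCollapsedVertex S v
  · obtain ⟨f, hf, i, rfl⟩ := h
    rw [vertexTrack_of_mem hS hf, collapse_cell_of_mem hf]
    congr 2
    exact Quot.sound ⟨f, hf, 0, i, rfl, rfl⟩
  · rw [vertexTrack_of_not h, collapse_base]
    rfl

theorem collapse_edgeTrack {e : W.E} (h : ¬ W.IsCollapsed S e) (x : ℝ) :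
    collapse S (edgeTrack hS e x) = Attachment.base _
      ((W.collapseGraph S).edgePoint ⟨e, h⟩ (projIcc 0 1 zero_le_one x)) := by
  refine map_extendEdge (collapse S)
    ((Attachment.base (collapseAttach S)).comp ((W.collapseGraph S).edgeMap ⟨e, h⟩))
    (fun t => ?_) (fun s => ?_) (fun t => ?_) x
  · exact (collapse_vertexTrack hS _ t).trans (congrArg (Attachment.base (collapseAttach S))
      (OrGraph.edgePoint_zero (G := W.collapseGraph S) ⟨e, h⟩).symm)
  · exact congrArg (Attachment.base (collapseAttach S)) (collapseMap_edgePoint_of_not S h s)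
  · exact (collapse_vertexTrack hS _ t).trans (congrArg (Attachment.base (collapseAttach S))
      (OrGraph.edgePoint_one (G := W.collapseGraph S) ⟨e, h⟩).symm)

/-- The collapse makes the tracks of the vertices constant, so the homotopy descends to a
reparametrization of the surviving edges. -/
theorem collapse_skeletonTrack (hred : W.IsReduced) (x : W.Skeleton) (t : unitInterval) :
    collapse S (skeletonTrack hS x t) =
      Attachment.base _ (collapsedSkeletonTrack S (collapseMap S x) t) := by
  refine OrGraph.Skeleton.forall_of (P := fun x => collapse S (skeletonTrack hS x t) =
      Attachment.base _ (collapsedSkeletonTrack S (collapseMap S x) t))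
    (fun v => collapse_vertexTrack hS v t) (fun e s => ?_) x
  by_cases h : W.IsCollapsed S e
  · rw [collapseMap_edgePoint_of_isCollapsed S h]
    obtain ⟨f, hf, i, rfl⟩ := h
    rw [← attach_edgeAngle, skeletonTrack_attach hS hred hf, collapse_cell_of_mem hf]
    have h2 := collapseMap_attach hf (edgeAngle f i s)
    rw [attach_edgeAngle, collapseMap_edgePoint_of_isCollapsed S ⟨f, hf, i, rfl⟩] at h2
    rw [← h2]
    rfl
  · rw [collapseMap_edgePoint_of_not S h, skeletonTrack_edgePoint_of_not hS h,
      collapse_edgeTrack hS h]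
    rfl

theorem collapsedSkeletonTrack_zero (x : (W.collapseGraph S).Skeleton) :
    collapsedSkeletonTrack S x 0 = x := by
  refine OrGraph.Skeleton.forall_of (P := fun x => collapsedSkeletonTrack S x 0 = x)
    (fun v => rfl) (fun e s => ?_) x
  change (W.collapseGraph S).edgePoint e (projIcc 0 1 zero_le_one (stretch (s, 0))) = _
  rw [show stretch (s, 0) = s by simp [stretch], projIcc_val]

theorem cell_one_eq_collapsedSkeletonTrack (f : {f : W.F // f ∉ S}) (θ : UnitAddCircle) :
    Attachment.cell (collapseAttach S) f (1, θ) =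
      (ContinuousMap.curry ((Attachment.base _).comp (ContinuousMap.uncurry
        (collapsedSkeletonTrack S)))).comp (collapseAttach S f) θ 0 := by
  change _ = Attachment.base _ (collapsedSkeletonTrack S (collapseAttach S f θ) 0)
  rw [collapsedSkeletonTrack_zero, Attachment.cell_one]

variable (S) in
/-- The homotopy of the collapsed complex induced by `track`. -/
noncomputable def collapsedTrack :
    C(Attachment (collapseAttach S), C(unitInterval, Attachment (collapseAttach S))) :=
  Attachment.lift
    (ContinuousMap.curry ((Attachment.base _).comp (ContinuousMap.uncurry
      (collapsedSkeletonTrack S))))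
    (fun f => extendDisk (Attachment.cell (collapseAttach S) f)
      ((ContinuousMap.curry ((Attachment.base _).comp (ContinuousMap.uncurry
        (collapsedSkeletonTrack S)))).comp (collapseAttach S f))
      (cell_one_eq_collapsedSkeletonTrack f))
    (fun _ θ => extendDisk_one θ)
    (fun _ θ θ' => extendDisk_zero (Attachment.cell_zero _ _) θ θ')

/-- Collapsing closed 2-cells with disjoint embedded boundaries is a homotopy equivalence. -/
theorem nonempty_homotopyEquiv_collapse (hS : W.DisjointCycles S) (hred : W.IsReduced) :
    Nonempty (ContinuousMap.HomotopyEquiv W.Realization (Attachment (collapseAttach S))) := by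
  refine ⟨W.realizationHomeomorph.toHomotopyEquiv.trans
    ⟨collapse S, expand hS hred, ?_, ?_⟩⟩
  -- Both composites are the final stages of homotopies that start at the identity: `track` here and
  -- `collapsedTrack` for the other one.
  · exact (ContinuousMap.homotopic_of_paths (track hS hred) (track_zero hS hred)
      fun y => (expand_collapse hS hred y).symm).symm
  · refine (ContinuousMap.homotopic_of_paths (collapsedTrack S) ?_ ?_).symm
    · refine Attachment.forall_of (fun x => ?_) fun f p => ?_
      · exact congrArg (Attachment.base (collapseAttach S)) (collapsedSkeletonTrack_zero x)
      · exact extendDisk_start (h := cell_one_eq_collapsedSkeletonTrack f) p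
    · refine Attachment.forall_of ?_ fun f p => ?_
      · refine OrGraph.Skeleton.forall_of (fun v => ?_) fun e s => ?_
        · obtain ⟨v, rfl⟩ := Quot.exists_rep v
          exact (collapse_vertexTrack hS v 1).symm
        · exact (collapse_edgeTrack hS e.2 _).symm
      · symm
        exact map_extendDisk (h := cell_one_eq_skeletonTrack hS hred f.1)
          (h' := cell_one_eq_collapsedSkeletonTrack f) (collapse S) (collapse_cell_of_notMem f.2)
          (fun θ t => collapse_skeletonTrack hS hred _ _) p 1

end Track

end PolygonalComplex

/-! ### Deleting blocks from periodic sequences -/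

theorem OrderIso.int_apply_eq (φ : ℤ ≃o ℤ) (k : ℤ) : φ k = φ 0 + k := by
  have h : ∀ k, φ (k + 1) = φ k + 1 := fun k => φ.map_succ k
  induction k using Int.induction_on with
  | zero => simp
  | succ i ih => rw [h, ih]; ring
  | pred i ih =>
    have := h (-(i : ℤ) - 1)
    rw [sub_add_cancel] at this
    linarith

/-- A nonempty periodic set of integers is enumerated by an increasing quasi-periodic map. -/
theorem exists_enumeration {K : Set ℤ} (hK : K.Nonempty) {N : ℕ} (hN : 0 < N)
    (hper : ∀ k : ℤ, k + N ∈ K ↔ k ∈ K) :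
    ∃ (N' : ℕ) (m : ℤ → ℤ), 0 < N' ∧ StrictMono m ∧ range m = K ∧
      ∀ k, m (k + N') = m k + N := by
  classical
  have : Nonempty K := hK.to_subtype
  have : NoMaxOrder K := ⟨fun a => ⟨⟨a + N, (hper _).2 a.2⟩, by
    rw [← Subtype.coe_lt_coe]; change (a : ℤ) < a + N; omega⟩⟩
  have : NoMinOrder K := ⟨fun a => ⟨⟨a - N, (hper _).1 (by simp)⟩, by
    rw [← Subtype.coe_lt_coe]; change (a : ℤ) - N < a; omega⟩⟩
  let : SuccOrder K := LinearLocallyFiniteOrder.succOrder K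
  let : PredOrder K := LinearLocallyFiniteOrder.predOrder K
  let e : K ≃o ℤ := orderIsoIntOfLinearSuccPredArch
  let s : K ≃o K :=
    { toFun := fun a => ⟨a + N, (hper _).2 a.2⟩
      invFun := fun a => ⟨a - N, (hper _).1 (by simp)⟩
      left_inv := fun a => by simp
      right_inv := fun a => by simp
      map_rel_iff' := by
        intro a b
        change (⟨a + N, _⟩ : K) ≤ ⟨b + N, _⟩ ↔ _
        rw [Subtype.mk_le_mk, ← Subtype.coe_le_coe]
        omega }
  -- The shift of `K` by `N`, read in the enumeration, is an order automorphism of `ℤ`, hence a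
  -- translation. Its amount is `N'`.
  let φ : ℤ ≃o ℤ := (e.symm.trans s).trans e
  have hφ : 0 < φ 0 := by
    have h1 : e.symm 0 < s (e.symm 0) := by
      rw [← Subtype.coe_lt_coe]
      change (e.symm 0 : ℤ) < e.symm 0 + N
      omega
    have h2 := e.strictMono h1
    rwa [e.apply_symm_apply] at h2
  obtain ⟨N', hN'⟩ := Int.eq_ofNat_of_zero_le hφ.le
  refine ⟨N', fun k => e.symm k, by omega, fun a b h => ?_, ?_, fun k => ?_⟩
  · exact e.symm.strictMono h
  · ext k
    constructor
    · rintro ⟨x, rfl⟩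
      exact (e.symm x).2
    · intro hk
      exact ⟨e ⟨k, hk⟩, by simp⟩
  · have h1 : φ k = k + N' := by rw [φ.int_apply_eq, hN', add_comm]
    have h2 : e.symm (φ k) = s (e.symm k) := e.symm_apply_apply _
    change (e.symm (k + N') : ℤ) = e.symm k + N
    rw [← h1, h2]
    rfl

theorem apply_add_le {m : ℤ → ℤ} {c : ℤ} (h : ∀ k, m (k + 1) ≤ m k + c) (k : ℤ) (r : ℕ) :
    m (k + r) ≤ m k + c * r := by
  induction r with
  | zero => simp
  | succ r ih =>
    have := h (k + r)
    push_cast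
    rw [← add_assoc]
    linarith

section Blocks

variable {C : ℤ → Prop} {E : ℤ → ℤ → Prop} {M S : ℕ}

/-- A maximal interval `[p, q)` in `C` such that exactly `m` steps before `p` and after `q`
cancel. -/
structure IsBlock (C : ℤ → Prop) (E : ℤ → ℤ → Prop) (p q : ℤ) (m : ℕ) : Prop where
  lt : p < q
  mem : ∀ k, p ≤ k → k < q → C k
  left : ¬ C (p - 1)
  right : ¬ C q
  cancel : ∀ i : ℕ, i < m → E (p - 1 - i) (q + i)
  maximal : ¬ E (p - 1 - m) (q + m)

/-- The integers that do not lie in an extended block. -/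
def keptSet (C : ℤ → Prop) (E : ℤ → ℤ → Prop) : Set ℤ :=
  {k | ∀ p q m, IsBlock C E p q m → k < p - m ∨ q + m ≤ k}

/-- Intervals in `C` and cancellations are short, intervals in `C` are far apart. -/
structure HasSparseBlocks (C : ℤ → Prop) (E : ℤ → ℤ → Prop) (M S : ℕ) : Prop where
  interval : ∀ i : ℤ, ∃ k, i ≤ k ∧ k < i + M ∧ ¬ C k
  cancel : ∀ p q : ℤ, ∃ i : ℕ, i < M ∧ ¬ E (p - 1 - i) (q + i)
  spaced : ∀ q p, q < p → C (q - 1) → ¬ C q → C p → q + S ≤ p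

variable {p q p' q' : ℤ} {m m' : ℕ}

theorem HasSparseBlocks.length_lt (h : HasSparseBlocks C E M S) (b : IsBlock C E p q m) : q < p + M := by
  obtain ⟨k, hk, hk', hC⟩ := h.interval p
  by_contra hq
  exact hC (b.mem k hk (by omega))

theorem HasSparseBlocks.cancel_lt (h : HasSparseBlocks C E M S) (b : IsBlock C E p q m) : m < M := by
  obtain ⟨i, hi, hE⟩ := h.cancel p q
  by_contra hm
  exact hE (b.cancel i (by omega))

theorem HasSparseBlocks.separated (h : HasSparseBlocks C E M S) (b : IsBlock C E p q m) (b' : IsBlock C E p' q' m')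
    (hp : p < p') : q + S ≤ p' := by
  have h1 : q ≤ p' := by
    by_contra hq
    exact b'.left (b.mem _ (by omega) (by omega))
  have h2 : q ≠ p' := by
    rintro rfl
    exact b.right (b'.mem _ le_rfl b'.lt)
  exact h.spaced q p' (by omega) (b.mem _ (by have := b.lt; omega) (by omega)) b.right
    (b'.mem _ le_rfl b'.lt)

theorem IsBlock.unique (b : IsBlock C E p q m) (b' : IsBlock C E p q' m') : q = q' ∧ m = m' := by
  have h1 : q = q' := by
    rcases lt_trichotomy q q' with hq | hq | hq
    · exact absurd (b'.mem q b.lt.le hq) b.right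
    · exact hq
    · exact absurd (b.mem q' b'.lt.le hq) b'.right
  subst h1
  refine ⟨rfl, ?_⟩
  rcases lt_trichotomy m m' with hm | hm | hm
  · exact absurd (b'.cancel m hm) b.maximal
  · exact hm
  · exact absurd (b.cancel m' hm) b'.maximal

theorem HasSparseBlocks.exists_isBlock (h : HasSparseBlocks C E M S) {k : ℤ} (hk : C k) :
    ∃ p q m, IsBlock C E p q m ∧ p ≤ k ∧ k < q := by
  classical
  have hr : ∃ i : ℕ, ¬ C (k + i) := by
    obtain ⟨l, hl, -, hC⟩ := h.interval k
    exact ⟨(l - k).toNat, by rwa [show k + ((l - k).toNat : ℤ) = l by omega]⟩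
  have hl : ∃ i : ℕ, ¬ C (k - i) := by
    obtain ⟨l, hl, hl', hC⟩ := h.interval (k - M)
    exact ⟨(k - l).toNat, by rwa [show k - ((k - l).toNat : ℤ) = l by omega]⟩
  let p := k - Nat.find hl + 1
  let q := k + Nat.find hr
  have hm : ∃ i : ℕ, ¬ E (p - 1 - i) (q + i) := by
    obtain ⟨i, -, hi⟩ := h.cancel p q
    exact ⟨i, hi⟩
  have hr1 := Nat.find_spec hr
  have hl1 := Nat.find_spec hl
  have hr0 : Nat.find hr ≠ 0 := fun h0 => by rw [h0] at hr1; simp [hk] at hr1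
  have hl0 : Nat.find hl ≠ 0 := fun h0 => by rw [h0] at hl1; simp [hk] at hl1
  refine ⟨p, q, Nat.find hm, ⟨by omega, fun l h1 h2 => ?_, ?_, hr1, fun i hi => ?_,
    Nat.find_spec hm⟩, by omega, by omega⟩
  · rcases le_total k l with h3 | h3
    · have := Nat.find_min hr (m := (l - k).toNat) (by omega)
      rw [not_not] at this
      rwa [show k + ((l - k).toNat : ℤ) = l by omega] at this
    · have := Nat.find_min hl (m := (k - l).toNat) (by omega)
      rw [not_not] at this
      rwa [show k - ((k - l).toNat : ℤ) = l by omega] at this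
  · rwa [show p - 1 = k - Nat.find hl by omega]
  · exact not_not.1 (Nat.find_min hm hi)

theorem HasSparseBlocks.not_mem_of_kept (h : HasSparseBlocks C E M S) {k : ℤ} (hk : k ∈ keptSet C E) : ¬ C k := by
  intro hC
  obtain ⟨p, q, m, b, h1, h2⟩ := h.exists_isBlock hC
  rcases hk p q m b with h3 | h3 <;> omega

/-- Blocks are at least `2M` apart and are extended by less than `M` on each side. Extended blocks
are therefore disjoint and not even adjacent. -/
theorem HasSparseBlocks.end_mem_kept (h : HasSparseBlocks C E M S) (hS : 2 * M ≤ S) (b : IsBlock C E p q m) :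
    q + m ∈ keptSet C E := by
  intro p' q' m' b'
  have hm := h.cancel_lt b
  have hm' := h.cancel_lt b'
  have hlt := b.lt
  have hlt' := b'.lt
  rcases lt_trichotomy p p' with hp | hp | hp
  · have := h.separated b b' hp
    omega
  · subst hp
    obtain ⟨rfl, rfl⟩ := b.unique b'
    omega
  · have := h.separated b' b hp
    omega

theorem HasSparseBlocks.next_kept (h : HasSparseBlocks C E M S) (hS : 2 * M ≤ S) {k k' : ℤ} (hk : k ∈ keptSet C E)
    (hk' : k' ∈ keptSet C E) (hlt : k < k') (hno : ∀ l, k < l → l < k' → l ∉ keptSet C E) :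
    k' = k + 1 ∨ ∃ p q m, IsBlock C E p q m ∧ p - m = k + 1 ∧ q + m = k' := by
  by_cases h1 : k' = k + 1
  · exact Or.inl h1
  · right
    have h2 : k + 1 ∉ keptSet C E := hno _ (by omega) (by omega)
    simp only [keptSet, mem_ofPred_eq, not_forall, not_or, not_lt, not_le] at h2
    obtain ⟨p, q, m, b, h3, h4⟩ := h2
    have h5 := hk p q m b
    have h6 := hk' p q m b
    have h7 : ¬ q + m < k' := fun h8 => hno _ (by omega) h8 (h.end_mem_kept hS b)
    exact ⟨p, q, m, b, by omega, by omega⟩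

theorem HasSparseBlocks.exists_kept (h : HasSparseBlocks C E M S) (hS : 2 * M ≤ S) : (keptSet C E).Nonempty := by
  by_cases h0 : (0 : ℤ) ∈ keptSet C E
  · exact ⟨0, h0⟩
  · simp only [keptSet, mem_ofPred_eq, not_forall] at h0
    obtain ⟨p, q, m, b, -⟩ := h0
    exact ⟨_, h.end_mem_kept hS b⟩

theorem IsBlock.shift {c : ℤ} (hC : ∀ k, C (k + c) ↔ C k) (hE : ∀ x y, E (x + c) (y + c) ↔ E x y)
    (b : IsBlock C E p q m) : IsBlock C E (p + c) (q + c) m where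
  lt := by have := b.lt; omega
  mem k h1 h2 := by
    have := (hC _).2 (b.mem (k - c) (by omega) (by omega))
    rwa [sub_add_cancel] at this
  left := by
    rw [show p + c - 1 = p - 1 + c by ring, hC]
    exact b.left
  right := by
    rw [hC]
    exact b.right
  cancel i hi := by
    rw [show p + c - 1 - i = p - 1 - i + c by ring, show q + c + i = q + i + c by ring, hE]
    exact b.cancel i hi
  maximal := by
    rw [show p + c - 1 - m = p - 1 - m + c by ring, show q + c + m = q + m + c by ring, hE]
    exact b.maximal

/-- The increasing enumeration `m` of the integers that remain after the deletion of the extended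
blocks. -/
structure IsBlockDeletion (C : ℤ → Prop) (E : ℤ → ℤ → Prop) (M N N' : ℕ) (m : ℤ → ℤ) : Prop where
  pos : 0 < N'
  strictMono : StrictMono m
  add : ∀ k, m (k + N') = m k + N
  not_mem : ∀ k, ¬ C (m k)
  reduced : ∀ k, ¬ E (m k) (m (k + 1))
  gap : ∀ k, ∃ i j : ℤ, m k + 1 ≤ i ∧ i ≤ j ∧ i - (m k + 1) = m (k + 1) - j ∧
    (∀ l, i ≤ l → l < j → C l) ∧ ∀ s, 0 ≤ s → s < m (k + 1) - j → E (i - 1 - s) (j + s)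
  le : ∀ k, m (k + 1) ≤ m k + 3 * M
  spaced : ∀ k l, k < l → m (k + 1) ≠ m k + 1 → m (l + 1) ≠ m l + 1 → k + 3 * M < l

/-- The blocks, and with them the kept set, are invariant under the shift by `N`, so
`exists_enumeration` applies. Each jump passes over exactly one extended block, of fewer than `3M`
letters, and the maximality of the cancellation makes the remaining word reduced. The size of `S`
keeps jumps far apart even when counted in kept positions, of which there may be `3M` times fewer.
-/
theorem HasSparseBlocks.exists_isBlockDeletion (h : HasSparseBlocks C E M S) (hS : 9 * M * M + 2 * M + 1 ≤ S) {N : ℕ}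
    (hN : 0 < N) (hC : ∀ k, C (k + N) ↔ C k) (hE : ∀ x y, E (x + N) (y + N) ↔ E x y)
    (hred : ∀ k, ¬ E k (k + 1)) : ∃ N' m, IsBlockDeletion C E M N N' m := by
  have hS' : 2 * M ≤ S := by
    have : 0 ≤ 9 * M * M := Nat.zero_le _
    omega
  have hC' : ∀ k, C (k + -N) ↔ C k := fun k => by
    rw [← hC (k + -N), neg_add_cancel_right]
  have hE' : ∀ x y, E (x + -N) (y + -N) ↔ E x y := fun x y => by
    rw [← hE (x + -N), neg_add_cancel_right, neg_add_cancel_right]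
  obtain ⟨N', m, hN', hmono, hrange, hadd⟩ := exists_enumeration (h.exists_kept hS') hN
    (fun k => by
      constructor
      · intro hk p q m b
        have := hk _ _ _ (b.shift hC hE)
        omega
      · intro hk p q m b
        have := hk _ _ _ (b.shift hC' hE')
        omega)
  have hkept : ∀ k, m k ∈ keptSet C E := fun k => hrange ▸ mem_range_self k
  have hM : 1 ≤ M := by
    obtain ⟨k, h1, h2, -⟩ := h.interval 0
    omega
  have hnext : ∀ k, m (k + 1) = m k + 1 ∨
      ∃ p q c, IsBlock C E p q c ∧ p - c = m k + 1 ∧ q + c = m (k + 1) := fun k =>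
    h.next_kept hS' (hkept k) (hkept _) (hmono (by omega)) fun l h1 h2 hl => by
      rw [← hrange] at hl
      obtain ⟨x, rfl⟩ := hl
      have := hmono.lt_iff_lt.1 h1
      have := hmono.lt_iff_lt.1 h2
      omega
  have hle : ∀ k, m (k + 1) ≤ m k + 3 * M := by
    intro k
    rcases hnext k with h1 | ⟨p, q, c, b, h1, h2⟩
    · omega
    · have := h.length_lt b
      have := h.cancel_lt b
      omega
  refine ⟨N', m, hN', hmono, hadd, fun k => h.not_mem_of_kept (hkept k), fun k => ?_, fun k => ?_,
    hle, fun k l hkl hk hl => ?_⟩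
  · rcases hnext k with h1 | ⟨p, q, c, b, h1, h2⟩
    · rw [h1]
      exact hred _
    · rw [← h2, show m k = p - 1 - c by omega]
      exact b.maximal
  · rcases hnext k with h1 | ⟨p, q, c, b, h1, h2⟩
    · exact ⟨m k + 1, m k + 1, le_rfl, le_rfl, by omega, fun l _ _ => by omega,
        fun s _ _ => by omega⟩
    · refine ⟨p, q, by omega, b.lt.le, by omega, b.mem, fun s hs hs' => ?_⟩
      have := b.cancel s.toNat (by omega)
      rwa [Int.toNat_of_nonneg hs] at this
  · obtain ⟨p, q, c, b, h1, h2⟩ := (hnext k).resolve_left hk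
    obtain ⟨p', q', c', b', h1', h2'⟩ := (hnext l).resolve_left hl
    have h3 := h.cancel_lt b
    have h4 := h.cancel_lt b'
    have h5 : m (k + 1) ≤ m l := hmono.monotone (by omega)
    have hlt := b.lt
    have hlt' := b'.lt
    have h6 : p < p' := by
      rcases lt_trichotomy p p' with hp | hp | hp
      · exact hp
      · subst hp
        obtain ⟨rfl, rfl⟩ := b.unique b'
        omega
      · have := h.separated b' b hp
        omega
    have h7 := h.separated b b' h6
    have h8 := apply_add_le hle (k + 1) (l - (k + 1)).toNat
    rw [Int.toNat_of_nonneg (by omega), add_sub_cancel] at h8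
    -- At most `3M - 1` steps of size at most `3M` would lead from the end of the first extended
    -- block to the start of the second one. Together with the two cancellations, each shorter than
    -- `M`, this stays below the distance `S`.
    by_contra! h9
    have h10 : 3 * (M : ℤ) * (l - (k + 1)) ≤ 3 * M * (3 * M - 1) := by
      refine mul_le_mul_of_nonneg_left (by omega) (by omega)
    have h11 : (9 * M * M + 2 * M + 1 : ℤ) ≤ S := by exact_mod_cast hS
    have : 3 * (M : ℤ) * (3 * M - 1) = 9 * M * M - 3 * M := by ring
    omega

end Blocks

/-! ### Short cells in a graph without branching -/

namespace OrGraph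

variable {G : OrGraph.{u}}

/-- Every directed edge supported by `A` can be continued in `A` without backtracking. -/
def NoDeadEnds (A : Finset G.E) : Prop :=
  ∀ d : G.Dart, d.1 ∈ A → ∃ d' : G.Dart, d'.1 ∈ A ∧ G.tail d' = G.head d ∧ d' ≠ G.rev d

/-- Two reduced edge paths in a graph without branching that have the same first edge agree. -/
theorem NoBranching.eq_of_eq_zero {R : ℕ} (hG : G.NoBranching R) {A : Finset G.E}
    (hA : A.card ≤ R) (hdead : G.NoDeadEnds A) {a b : ℕ → G.Dart} (ha : ∀ k, (a k).1 ∈ A)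
    (hb : ∀ k, (b k).1 ∈ A) (hca : ∀ k, G.head (a k) = G.tail (a (k + 1)))
    (hcb : ∀ k, G.head (b k) = G.tail (b (k + 1))) (hra : ∀ k, a (k + 1) ≠ G.rev (a k))
    (hrb : ∀ k, b (k + 1) ≠ G.rev (b k)) (h0 : a 0 = b 0) (k : ℕ) : a k = b k := by
  induction k with
  | zero => exact h0
  | succ k ih =>
    rcases hG A hA hdead (G.rev (a k)) (a (k + 1)) (b (k + 1)) (ha k) (ha _) (hb _)
      (by rw [tail_rev, hca]) (by rw [tail_rev, ih, hcb]) with h | h | h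
    · exact absurd h.symm (hra k)
    · exact h
    · rw [ih] at h
      exact absurd h.symm (hrb k)

end OrGraph

namespace PolygonalComplex

variable {W : PolygonalComplex.{u}}

theorem head_readFrom (f : W.F) (j : ℤ) (pos : Bool) (k : ℕ) :
    W.head (W.readFrom f j pos k) = W.tail (W.readFrom f j pos (k + 1)) := by
  cases pos
  · simp only [readFrom, Bool.false_eq_true, if_false, OrGraph.head_rev, OrGraph.tail_rev]
    rw [W.bd_chain]
    congr 2
    push_cast
    ring
  · simp only [readFrom, if_true]
    rw [W.bd_chain]
    congr 2
    push_cast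
    ring

theorem IsReduced.readFrom_succ_ne (hred : W.IsReduced) (f : W.F) (j : ℤ) (pos : Bool) (k : ℕ) :
    W.readFrom f j pos (k + 1) ≠ W.rev (W.readFrom f j pos k) := by
  cases pos
  · simp only [readFrom, Bool.false_eq_true, if_false]
    intro h
    refine hred f (j - 1 - (k + 1 : ℕ)) ?_
    rw [h, OrGraph.rev_rev]
    congr 1
    push_cast
    ring
  · simp only [readFrom, if_true]
    intro h
    refine hred f (j + k) ?_
    rw [← h]
    congr 1
    push_cast
    ring

theorem exists_eq_readFrom {f : W.F} {i : ℤ} {d : W.Dart} (h : (W.bd f i).1 = d.1) :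
    ∃ j pos, d = W.readFrom f j pos 0 := by
  rcases OrGraph.eq_or_eq_rev_of_fst_eq h.symm with h | h
  · exact ⟨i, true, by simp [readFrom, h]⟩
  · exact ⟨i + 1, false, by simp [readFrom, h]⟩

open Classical in
variable (W) in
/-- The edges on the boundary of a cell. -/
noncomputable def cellEdges (f : W.F) : Finset W.E :=
  (Finset.range (W.len f)).image fun k : ℕ => (W.bd f k).1

theorem mem_cellEdges {f : W.F} {e : W.E} : e ∈ W.cellEdges f ↔ ∃ i : ℤ, (W.bd f i).1 = e := by
  simp only [cellEdges, Finset.mem_image, Finset.mem_range]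
  constructor
  · rintro ⟨k, -, h⟩
    exact ⟨k, h⟩
  · rintro ⟨i, h⟩
    have hl : (0 : ℤ) < W.len f := by exact_mod_cast W.len_pos f
    have h1 := Int.emod_nonneg i hl.ne'
    have h2 := Int.emod_lt_of_pos i hl
    refine ⟨(i % W.len f).toNat, by omega, ?_⟩
    rw [Int.toNat_of_nonneg h1, bd_emod, h]

theorem card_cellEdges_le (f : W.F) : (W.cellEdges f).card ≤ W.len f := by
  classical
  unfold cellEdges
  exact Finset.card_image_le.trans (Finset.card_range _).le

theorem readFrom_mem_cellEdges (f : W.F) (j : ℤ) (pos : Bool) (k : ℕ) :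
    (W.readFrom f j pos k).1 ∈ W.cellEdges f := by
  rw [mem_cellEdges]
  cases pos
  · exact ⟨j - 1 - k, rfl⟩
  · exact ⟨j + k, rfl⟩

theorem IsReduced.exists_continuation (hred : W.IsReduced) {f : W.F} {d : W.Dart}
    (hd : d.1 ∈ W.cellEdges f) :
    ∃ d' : W.Dart, d'.1 ∈ W.cellEdges f ∧ W.tail d' = W.head d ∧ d' ≠ W.rev d := by
  obtain ⟨i, hi⟩ := mem_cellEdges.1 hd
  obtain ⟨j, pos, rfl⟩ := exists_eq_readFrom hi
  exact ⟨_, readFrom_mem_cellEdges f j pos 1, (head_readFrom f j pos 0).symm,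
    hred.readFrom_succ_ne f j pos 0⟩

/-- In a complex without branching, short cells have disjoint embedded boundaries. -/
theorem AgreementBound.disjointCycles {M R K : ℕ} (hM : W.AgreementBound M) (hred : W.IsReduced)
    (hR : W.NoBranching R) {S : Set W.F} (hS : ∀ f ∈ S, W.len f ≤ K) (hK : 2 * K ≤ R) :
    W.DisjointCycles S := by
  classical
  intro f hf g hg i j hij
  have hA : (W.cellEdges f ∪ W.cellEdges g).card ≤ R := by
    have := Finset.card_union_le (W.cellEdges f) (W.cellEdges g)
    have := card_cellEdges_le f
    have := card_cellEdges_le g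
    have := hS f hf
    have := hS g hg
    omega
  have hdead : W.NoDeadEnds (W.cellEdges f ∪ W.cellEdges g) := by
    intro d hd
    rcases Finset.mem_union.1 hd with hd | hd
    · obtain ⟨d', h1, h2⟩ := hred.exists_continuation hd
      exact ⟨d', Finset.mem_union_left _ h1, h2⟩
    · obtain ⟨d', h1, h2⟩ := hred.exists_continuation hd
      exact ⟨d', Finset.mem_union_right _ h1, h2⟩
  have hfm : ∀ pos k, (W.readFrom f i pos k).1 ∈ W.cellEdges f ∪ W.cellEdges g := fun pos k =>
    Finset.mem_union_left _ (readFrom_mem_cellEdges _ _ _ _)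
  have hgm : ∀ pos k, (W.readFrom g j pos k).1 ∈ W.cellEdges f ∪ W.cellEdges g := fun pos k =>
    Finset.mem_union_right _ (readFrom_mem_cellEdges _ _ _ _)
  have key : ∀ pos, W.readFrom g j true 0 = W.readFrom f i pos 0 →
      f = g ∧ i ≡ j [ZMOD W.len f] := by
    intro pos h0
    have h1 := hR.eq_of_eq_zero hA hdead (hgm true) (hfm pos) (head_readFrom _ _ _)
      (head_readFrom _ _ _) (hred.readFrom_succ_ne _ _ _) (hred.readFrom_succ_ne _ _ _) h0
    obtain ⟨rfl, -, h2⟩ := hM g j f i pos fun k _ => (show _ = _ from h1 k)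
    exact ⟨rfl, h2.symm⟩
  have t1 : W.tail (W.readFrom f i true 0) = W.tail (W.bd f i) := by simp [readFrom]
  have t2 : W.tail (W.readFrom f i false 0) = W.tail (W.bd f i) := by
    simp [readFrom, OrGraph.tail_rev, W.bd_chain]
  have t3 : W.tail (W.readFrom g j true 0) = W.tail (W.bd f i) := by simp [readFrom, hij]
  -- Three directed edges start at the common vertex: two along `f`, one in each direction, and one
  -- along `g`. Two of the three coincide. Those along `f` are distinct because `f` is reduced, so
  -- `g` follows `f` in one of its directions, and it does so forever.
  rcases hR _ hA hdead (W.readFrom f i true 0) (W.readFrom f i false 0) (W.readFrom g j true 0)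
    (hfm _ _) (hfm _ _) (hgm _ _) (t1.trans t2.symm) (t1.trans t3.symm) with h | h | h
  · exfalso
    simp only [readFrom, Nat.cast_zero, add_zero, sub_zero, Bool.false_eq_true, if_true,
      if_false] at h
    refine hred f (i - 1) ?_
    rw [sub_add_cancel, h]
  · exact key false h.symm
  · exact key true h.symm

section Line

variable {S : Set W.F} {M R K N₀ : ℕ} (hM : W.AgreementBound M) (hred : W.IsReduced)
  (hS : W.DisjointCycles S)

/-- By disjointness the only collapsed edges at a vertex of a short cycle are those of the cycle
itself. A path in collapsed edges that does not backtrack has to follow the cycle. -/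
theorem DisjointCycles.eq_readFrom (hS : W.DisjointCycles S) {f : W.F} (hf : f ∈ S) {j : ℤ}
    {pos : Bool} {k : ℕ} {d : W.Dart} (hd : W.IsCollapsed S d.1)
    (htail : W.tail d = W.head (W.readFrom f j pos k)) (hne : d ≠ W.rev (W.readFrom f j pos k)) :
    d = W.readFrom f j pos (k + 1) := by
  obtain ⟨g, hg, y, hy⟩ := hd
  cases pos
  · simp only [readFrom, Bool.false_eq_true, if_false, OrGraph.head_rev, OrGraph.rev_rev]
      at htail hne ⊢
    rcases OrGraph.eq_or_eq_rev_of_fst_eq hy.symm with rfl | rfl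
    · obtain ⟨rfl, h⟩ := hS g hg f hf _ _ htail
      exact absurd (bd_eq_of_modEq h) hne
    · rw [OrGraph.tail_rev, W.bd_chain] at htail
      obtain ⟨rfl, h⟩ := hS g hg f hf _ _ htail
      congr 1
      refine bd_eq_of_modEq ?_
      have := h.sub_right 1
      rw [add_sub_cancel_right] at this
      convert this using 1
      push_cast
      ring
  · simp only [readFrom, if_true] at htail hne ⊢
    rw [W.bd_chain] at htail
    rcases OrGraph.eq_or_eq_rev_of_fst_eq hy.symm with rfl | rfl
    · obtain ⟨rfl, h⟩ := hS g hg f hf _ _ htail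
      refine bd_eq_of_modEq ?_
      convert h using 1
      push_cast
      ring
    · rw [OrGraph.tail_rev, W.bd_chain] at htail
      obtain ⟨rfl, h⟩ := hS g hg f hf _ _ htail
      refine absurd (congrArg W.rev (bd_eq_of_modEq ?_)) hne
      have := h.sub_right 1
      rwa [add_sub_cancel_right, add_sub_cancel_right] at this

/-- By `eq_readFrom`, `M` consecutive collapsed edges would all follow one cell `g ∈ S`. The
agreement bound then gives `f = g`, although `f ∉ S`. -/
theorem DisjointCycles.exists_not_isCollapsed (hS : W.DisjointCycles S) (hred : W.IsReduced)
    (hM : W.AgreementBound M) {f : W.F} (hf : f ∉ S) (i : ℤ) :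
    ∃ k, i ≤ k ∧ k < i + M ∧ ¬ W.IsCollapsed S (W.bd f k).1 := by
  by_contra! hall
  have hM0 : 0 < M := by
    by_contra h0
    have := (hM f 0 f 0 false fun k hk => by omega).2.1
    exact Bool.false_ne_true this
  obtain ⟨g, hg, y, hy⟩ := hall i le_rfl (by omega)
  obtain ⟨j, pos, hj⟩ := exists_eq_readFrom hy
  have key : ∀ k : ℕ, k < M → W.bd f (i + k) = W.readFrom g j pos k := by
    intro k
    induction k with
    | zero => intro _; simpa using hj
    | succ k ih =>
      intro hk
      have h1 := ih (by omega)
      have h2 : i + ((k + 1 : ℕ) : ℤ) = i + k + 1 := by push_cast; ring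
      refine hS.eq_readFrom hg (hall _ (by omega) (by omega)) ?_ ?_
      · rw [← h1, W.bd_chain, h2]
      · rw [← h1, h2]
        exact hred _ _
  obtain ⟨rfl, -⟩ := hM f i g j pos key
  exact hf hg

/-- If the path returned too early, its stretch from `q` to `p` and the two cycles at its ends would
form a graph with at most `2K + N₀` edges and no dead ends. This graph branches where the path
leaves the first cycle. -/
theorem DisjointCycles.collapsed_spaced (hred : W.IsReduced) (hR : W.NoBranching R)
    (hK : ∀ f ∈ S, W.len f ≤ K) (hKR : 2 * K + N₀ ≤ R) (f : W.F) {q p : ℤ} (hqp : q < p)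
    (hq' : W.IsCollapsed S (W.bd f (q - 1)).1) (hq : ¬ W.IsCollapsed S (W.bd f q).1)
    (hp : W.IsCollapsed S (W.bd f p).1) : q + N₀ ≤ p := by
  classical
  by_contra! hlt
  obtain ⟨g, hg, y, hy⟩ := hq'
  obtain ⟨g', hg', hgp⟩ := hp
  have hgp' := mem_cellEdges.2 hgp
  let P : Finset W.E := (Finset.range (p - q).toNat).image fun k : ℕ => (W.bd f (q + k)).1
  have hP : ∀ k, q ≤ k → k < p → (W.bd f k).1 ∈ P := fun k h1 h2 =>
    Finset.mem_image.2 ⟨(k - q).toNat, Finset.mem_range.2 (by omega), by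
      rw [show q + ((k - q).toNat : ℤ) = k by omega]⟩
  let A := W.cellEdges g ∪ W.cellEdges g' ∪ P
  have hgA : ∀ e ∈ W.cellEdges g, e ∈ A := fun e h =>
    Finset.mem_union_left _ (Finset.mem_union_left _ h)
  have hgA' : ∀ e ∈ W.cellEdges g', e ∈ A := fun e h =>
    Finset.mem_union_left _ (Finset.mem_union_right _ h)
  have hPA : ∀ e ∈ P, e ∈ A := fun e h => Finset.mem_union_right _ h
  have hA : A.card ≤ R := by
    have h1 : A.card ≤ _ := Finset.card_union_le (W.cellEdges g ∪ W.cellEdges g') P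
    have h2 := Finset.card_union_le (W.cellEdges g) (W.cellEdges g')
    have h3 : P.card ≤ (p - q).toNat := Finset.card_image_le.trans (Finset.card_range _).le
    have := card_cellEdges_le g
    have := card_cellEdges_le g'
    have := hK g hg
    have := hK g' hg'
    omega
  have hmem : ∀ k, q - 1 ≤ k → k ≤ p → (W.bd f k).1 ∈ A := by
    intro k h1 h2
    rcases h1.eq_or_lt with rfl | h1
    · exact hgA _ (mem_cellEdges.2 ⟨y, hy⟩)
    rcases h2.eq_or_lt with rfl | h2
    · exact hgA' _ hgp'
    exact hPA _ (hP k (by omega) h2)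
  have hdead : W.NoDeadEnds A := by
    intro d hd
    rcases Finset.mem_union.1 hd with hd | hd
    · rcases Finset.mem_union.1 hd with hd | hd
      · obtain ⟨d', h1, h2⟩ := hred.exists_continuation hd
        exact ⟨d', hgA _ h1, h2⟩
      · obtain ⟨d', h1, h2⟩ := hred.exists_continuation hd
        exact ⟨d', hgA' _ h1, h2⟩
    · obtain ⟨k, hk, hkd⟩ := Finset.mem_image.1 hd
      rw [Finset.mem_range] at hk
      rcases OrGraph.eq_or_eq_rev_of_fst_eq hkd.symm with rfl | rfl
      · exact ⟨W.bd f (q + k + 1), hmem _ (by omega) (by omega), (W.bd_chain _ _).symm,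
          hred _ _⟩
      · refine ⟨W.rev (W.bd f (q + k - 1)), hmem _ (by omega) (by omega), ?_, fun h => ?_⟩
        · rw [OrGraph.tail_rev, OrGraph.head_rev, W.bd_chain, sub_add_cancel]
        · rw [OrGraph.rev_rev] at h
          refine hred f (q + k - 1) ?_
          rw [sub_add_cancel, h]
  obtain ⟨j, pos, hj⟩ := exists_eq_readFrom hy
  have hcol : W.IsCollapsed S (W.readFrom g j pos 1).1 := by
    obtain ⟨i, hi⟩ := mem_cellEdges.1 (readFrom_mem_cellEdges g j pos 1)
    exact ⟨g, hg, i, hi⟩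
  have ht : W.head (W.bd f (q - 1)) = W.tail (W.bd f q) := by rw [W.bd_chain, sub_add_cancel]
  -- The branching vertex: the edge that leaves the cycle, the reverse of the cycle edge just
  -- traversed, and the next edge of the cycle.
  rcases hR A hA hdead (W.bd f q) (W.rev (W.bd f (q - 1))) (W.readFrom g j pos 1)
    (hmem _ (by omega) hqp.le) (hmem (q - 1) le_rfl (by omega))
    (hgA _ (readFrom_mem_cellEdges _ _ _ _)) (by rw [OrGraph.tail_rev, ht])
    (by rw [← ht, hj, head_readFrom]) with h | h | h
  · refine hred f (q - 1) ?_
    rw [sub_add_cancel, h]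
  · rw [hj] at h
    exact hred.readFrom_succ_ne _ _ _ _ h.symm
  · rw [h] at hq
    exact hq hcol

theorem DisjointCycles.hasSparseBlocks (hS : W.DisjointCycles S) (hred : W.IsReduced)
    (hM : W.AgreementBound M) (hR : W.NoBranching R) (hK : ∀ f ∈ S, W.len f ≤ K)
    (hKR : 2 * K + N₀ ≤ R) {f : W.F} (hf : f ∉ S) :
    HasSparseBlocks (fun k => W.IsCollapsed S (W.bd f k).1)
      (fun x y => W.bd f y = W.rev (W.bd f x)) M N₀ where
  interval i := hS.exists_not_isCollapsed hred hM hf i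
  -- If `M` pairs cancelled, the boundary line of `f` would agree with its own reverse along `M`
  -- edges.
  cancel p q := by
    by_contra! hall
    have := (hM f q f p false fun k hk => hall k hk).2.1
    exact Bool.false_ne_true this
  spaced q p hqp h1 h2 h3 := collapsed_spaced hred hR hK hKR f hqp h1 h2 h3

end Line

end PolygonalComplex

/-! ### Tightening the attaching maps -/

/-- Each of `P` and `Q` holds at most once in `[0, 3M)`, so one of the three windows `[0, M)`, `[M,
2M)`, `[2M, 3M)` is free of both. `P` and `Q` will mark the jumps in two tightened words. -/
theorem exists_window {P Q : ℤ → Prop} {M : ℕ} (hP : ∀ x y, x < y → P x → P y → x + 3 * M < y)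
    (hQ : ∀ x y, x < y → Q x → Q y → x + 3 * M < y) :
    ∃ t : ℕ, t ≤ 2 * M ∧ (∀ x, (t : ℤ) ≤ x → x < t + M → ¬ P x) ∧
      ∀ x, (t : ℤ) ≤ x → x < t + M → ¬ Q x := by
  by_contra! hno
  have key : ∀ t : ℕ, t ≤ 2 * M → ∃ x, (t : ℤ) ≤ x ∧ x < t + M ∧ (P x ∨ Q x) := by
    intro t ht
    by_contra! hall
    obtain ⟨x, h1, h2, h3⟩ := hno t ht fun x h1 h2 => (hall x h1 h2).1
    exact (hall x h1 h2).2 h3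
  obtain ⟨x, hx, hx', h1⟩ := key 0 (by omega)
  obtain ⟨y, hy, hy', h2⟩ := key M (by omega)
  obtain ⟨z, hz, hz', h3⟩ := key (2 * M) le_rfl
  push_cast at hx hx' hy hy' hz hz'
  rcases h1 with h1 | h1 <;> rcases h2 with h2 | h2 <;> rcases h3 with h3 | h3
  · have := hP x y (by omega) h1 h2; omega
  · have := hP x y (by omega) h1 h2; omega
  · have := hP x z (by omega) h1 h3; omega
  · have := hQ y z (by omega) h2 h3; omega
  · have := hP y z (by omega) h2 h3; omega
  · have := hQ x z (by omega) h1 h3; omega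
  · have := hQ x y (by omega) h1 h2; omega
  · have := hQ x y (by omega) h1 h2; omega

theorem apply_add_eq {m : ℤ → ℤ} {k : ℤ} {M : ℕ}
    (hk : ∀ x, k ≤ x → x < k + M → m (x + 1) = m x + 1) (s : ℕ) (hs : s ≤ M) :
    m (k + s) = m k + s := by
  induction s with
  | zero => simp
  | succ s ih =>
    push_cast
    rw [← add_assoc, hk _ (by omega) (by omega), ih (by omega)]
    ring

theorem apply_sub_eq {m : ℤ → ℤ} {k : ℤ} {M : ℕ}
    (hk : ∀ x, k - M ≤ x → x < k → m (x + 1) = m x + 1) (s : ℕ) (hs : s ≤ M) :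
    m (k - s) = m k - s := by
  induction s with
  | zero => simp
  | succ s ih =>
    have := hk (k - (s + 1 : ℕ)) (by omega) (by omega)
    rw [show k - ((s + 1 : ℕ) : ℤ) + 1 = k - s by push_cast; ring, ih (by omega)] at this
    push_cast at this ⊢
    linarith

theorem IsBlockDeletion.add_mul {C : ℤ → Prop} {E : ℤ → ℤ → Prop} {M N N' : ℕ} {m : ℤ → ℤ}
    (h : IsBlockDeletion C E M N N' m) (k c : ℤ) : m (k + c * N') = m k + c * N := by
  induction c using Int.induction_on with
  | zero => simp
  | succ i ih => rw [add_one_mul, ← add_assoc, h.add, ih]; ring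
  | pred i ih =>
    have := h.add (k + (-(i : ℤ) - 1) * N')
    rw [show k + (-(i : ℤ) - 1) * N' + N' = k + -i * N' by ring, ih] at this
    linarith

namespace PolygonalComplex

variable {W : PolygonalComplex.{u}} {S : Set W.F} {M : ℕ}

variable (S) in
/-- A directed edge that survives in the collapsed graph. -/
def collapsedDart (d : W.Dart) (h : ¬ W.IsCollapsed S d.1) : (W.collapseGraph S).Dart :=
  (⟨d.1, h⟩, d.2)

theorem tail_collapsedDart (d : W.Dart) (h : ¬ W.IsCollapsed S d.1) :
    (W.collapseGraph S).tail (collapsedDart S d h) = Quot.mk _ (W.tail d) := by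
  unfold OrGraph.tail collapsedDart
  split_ifs <;> rfl

theorem head_collapsedDart (d : W.Dart) (h : ¬ W.IsCollapsed S d.1) :
    (W.collapseGraph S).head (collapsedDart S d h) = Quot.mk _ (W.head d) := by
  unfold OrGraph.head collapsedDart
  split_ifs <;> rfl

/-- The directed edge from which a directed edge of the collapsed graph comes. -/
def uncollapse (d : (W.collapseGraph S).Dart) : W.Dart := (d.1.1, d.2)

theorem collapsedDart_congr {d d' : W.Dart} (h : d = d') (hd : ¬ W.IsCollapsed S d.1)
    (hd' : ¬ W.IsCollapsed S d'.1) : collapsedDart S d hd = collapsedDart S d' hd' := by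
  subst h
  rfl

theorem quot_tail_eq_of_isCollapsed (f : W.F) {i l : ℤ} (hil : i ≤ l)
    (h : ∀ x, i ≤ x → x < l → W.IsCollapsed S (W.bd f x).1) :
    Quot.mk (W.CollapseRel S) (W.tail (W.bd f l)) =
      Quot.mk (W.CollapseRel S) (W.tail (W.bd f i)) := by
  induction l, hil using Int.leInduction with
  | base => rfl
  | succ l hl ih =>
    rw [← ih fun x h1 h2 => h x h1 (by omega), ← W.bd_chain]
    have := (h l (by omega) (by omega)).mk_src_eq_tgt
    unfold OrGraph.head OrGraph.tail
    split_ifs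
    · exact this.symm
    · exact this

/-- The collapsing and cancelling positions on the boundary of a cell outside `S`. -/
abbrev IsCellDeletion (S : Set W.F) (M : ℕ) (f : W.F) (N' : ℕ) (m : ℤ → ℤ) : Prop :=
  IsBlockDeletion (fun k => W.IsCollapsed S (W.bd f k).1)
    (fun x y => W.bd f y = W.rev (W.bd f x)) M (W.len f) N' m

/-- A deleted stretch is closed in the collapsed graph: either its first and last edges are inverse
to each other, or nothing cancels and it consists of collapsed edges only. -/
theorem IsCellDeletion.quot_head_eq {f : W.F} {N' : ℕ} {m : ℤ → ℤ}
    (h : IsCellDeletion S M f N' m) (k : ℤ) :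
    Quot.mk (W.CollapseRel S) (W.head (W.bd f (m k))) =
      Quot.mk (W.CollapseRel S) (W.tail (W.bd f (m (k + 1)))) := by
  obtain ⟨i, j, h1, h2, h3, h4, h5⟩ := h.gap k
  rw [W.bd_chain]
  rcases (show 0 ≤ m (k + 1) - j by omega).eq_or_lt with h0 | h0
  · rw [show m k + 1 = i by omega, show m (k + 1) = j by omega]
    exact (quot_tail_eq_of_isCollapsed f h2 h4).symm
  · have h6 := h5 (m (k + 1) - j - 1) (by omega) (by omega)
    rw [show j + (m (k + 1) - j - 1) = m (k + 1) - 1 by ring,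
      show i - 1 - (m (k + 1) - j - 1) = m k + 1 by omega] at h6
    have h7 := W.bd_chain f (m (k + 1) - 1)
    rw [h6, OrGraph.head_rev, sub_add_cancel] at h7
    rw [h7]

/-- The complex obtained by collapsing the closed cells in `S` and tightening the attaching maps
of the other cells. -/
def tighten (S : Set W.F) (M : ℕ) (N' : {f : W.F // f ∉ S} → ℕ) (m : {f : W.F // f ∉ S} → ℤ → ℤ)
    (h : ∀ f, IsCellDeletion S M f.1 (N' f) (m f)) : PolygonalComplex.{u} where
  toOrGraph := W.collapseGraph S
  F := {f : W.F // f ∉ S}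
  len := N'
  len_pos f := (h f).pos
  bd f k := collapsedDart S (W.bd f.1 (m f k)) ((h f).not_mem k)
  bd_periodic f k := by
    refine collapsedDart_congr ?_ _ _
    rw [(h f).add, W.bd_periodic]
  bd_chain f k := by
    rw [head_collapsedDart, tail_collapsedDart]
    exact IsCellDeletion.quot_head_eq (h f) k

section Tighten

variable {N' : {f : W.F // f ∉ S} → ℕ} {m : {f : W.F // f ∉ S} → ℤ → ℤ}
  {h : ∀ f, IsCellDeletion S M f.1 (N' f) (m f)}

theorem collapseAttach_homotopic (f : {f : W.F // f ∉ S}) :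
    (collapseAttach S f).Homotopic ((tighten S M N' m h).attach f) := by
  refine circle_homotopic_of_reduction (W.len_pos f.1) (h f).pos
    (p := fun k t => collapseMap S (W.dartPoint (W.bd f.1 k) t))
    (p' := fun k t => (tighten S M N' m h).dartPoint ((tighten S M N' m h).bd f k) t)
    (fun k t => ?_) (fun k t => ?_) (m f) (h f).add (fun k => ?_) fun k => ?_
  · exact congrArg (collapseMap S) (attach_div_add f.1 k t)
  · exact attach_div_add (X := tighten S M N' m h) f k t
  · funext t
    exact collapseMap_dartPoint_of_not S ((h f).not_mem k) t
  · obtain ⟨i, j, h1, h2, h3, h4, h5⟩ := (h f).gap k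
    refine ⟨i, j, h1, h2, h3, ⟨(W.collapseGraph S).vertexPoint
      (Quot.mk _ (W.tail (W.bd f.1 i))), fun l hl hl' t => ?_⟩, fun s hs hs' t => ?_⟩
    · rw [collapseMap_dartPoint_of_isCollapsed S (h4 l hl hl'),
        quot_tail_eq_of_isCollapsed f.1 hl fun x hx hx' => h4 x hx (by omega)]
    · rw [h5 s hs hs', OrGraph.dartPoint_rev]

theorem nonempty_homotopyEquiv_tighten (hS : W.DisjointCycles S) (hred : W.IsReduced) :
    Nonempty (ContinuousMap.HomotopyEquiv W.Realization (tighten S M N' m h).Realization) := by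
  obtain ⟨e⟩ := nonempty_homotopyEquiv_collapse hS hred
  let ψ : {f : W.F // f ∉ S} → C(UnitAddCircle, (W.collapseGraph S).Skeleton) :=
    fun f => (tighten S M N' m h).attach f
  obtain ⟨e'⟩ := Attachment.homotopyEquiv_of_homotopic (ψ := ψ)
    (collapseAttach_homotopic (h := h))
  have e'' : ContinuousMap.HomotopyEquiv (Attachment ψ) (tighten S M N' m h).Realization :=
    (tighten S M N' m h).realizationHomeomorph.symm.toHomotopyEquiv
  exact ⟨(e.trans e').trans e''⟩

theorem isReduced_tighten : (tighten S M N' m h).IsReduced := by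
  intro f k hk
  exact (h f).reduced k (congrArg uncollapse hk)

/-- A common path of `3M` edges would contain, by `exists_window`, `M` edges that are consecutive in
both original words. The agreement bound for `W` then gives the same cell, the same direction and
congruent positions. As `m` is injective and quasi-periodic, the positions in the tightened word are
congruent too, which the definition of a subpiece excludes. -/
theorem smallCancellation_tighten (hM : W.AgreementBound M) {r : ℝ}
    (hr : ∀ f, (3 * M : ℝ) ≤ r * N' f) : (tighten S M N' m h).SmallCancellation r := by
  refine ⟨isReduced_tighten, fun f i g j pos l hsub => ?_⟩
  obtain ⟨-, -, hne, hag⟩ := hsub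
  refine lt_of_lt_of_le ?_ (hr f)
  suffices hl : ¬ 3 * M ≤ l by exact_mod_cast not_le.1 hl
  intro hl
  cases pos with
  | true =>
    have hag' : ∀ k < l, W.bd f.1 (m f (i + k)) = W.bd g.1 (m g (j + k)) := fun k hk =>
      congrArg uncollapse (hag k hk)
    obtain ⟨t, ht, hP, hQ⟩ := exists_window (M := M)
      (P := fun x => m f (i + x + 1) ≠ m f (i + x) + 1)
      (Q := fun x => m g (j + x + 1) ≠ m g (j + x) + 1)
      (fun x y hxy hx hy => by have := (h f).spaced _ _ (by omega) hx hy; omega)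
      (fun x y hxy hx hy => by have := (h g).spaced _ _ (by omega) hx hy; omega)
    have hf : ∀ s : ℕ, s ≤ M → m f (i + t + s) = m f (i + t) + s :=
      apply_add_eq fun x h1 h2 => by
        have := not_not.1 (hP (x - i) (by omega) (by omega))
        rwa [add_sub_cancel] at this
    have hg : ∀ s : ℕ, s ≤ M → m g (j + t + s) = m g (j + t) + s :=
      apply_add_eq fun x h1 h2 => by
        have := not_not.1 (hQ (x - j) (by omega) (by omega))
        rwa [add_sub_cancel] at this
    obtain ⟨hfg, -, hmod⟩ := hM f.1 (m f (i + t)) g.1 (m g (j + t)) true fun k hk => by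
      have := hag' (t + k) (by omega)
      rw [Nat.cast_add, ← add_assoc, ← add_assoc, hf k hk.le, hg k hk.le] at this
      exact this
    obtain rfl : f = g := Subtype.ext hfg
    refine hne rfl rfl ?_
    obtain ⟨c, hc⟩ := hmod.dvd
    have h1 : m f (i + t + c * N' f) = m f (j + t) := by
      rw [(h f).add_mul]
      linarith [mul_comm c (W.len f.1 : ℤ)]
    have h2 := (h f).strictMono.injective h1
    refine Int.modEq_iff_dvd.2 ⟨c, ?_⟩
    change j - i = (N' f : ℤ) * c
    linarith [mul_comm c (N' f : ℤ)]
  | false =>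
    have hag' : ∀ k < l, W.bd f.1 (m f (i + k)) = W.rev (W.bd g.1 (m g (j - 1 - k))) :=
      fun k hk => congrArg uncollapse (hag k hk)
    obtain ⟨t, ht, hP, hQ⟩ := exists_window (M := M)
      (P := fun x => m f (i + x + 1) ≠ m f (i + x) + 1)
      -- The second word is read backwards: its edges number `x` and `x + 1` are at `j - 1 - x` and
      -- `j - 2 - x`, and the jump between them is tested from the lower position.
      (Q := fun x => m g (j - 2 - x + 1) ≠ m g (j - 2 - x) + 1)
      (fun x y hxy hx hy => by have := (h f).spaced _ _ (by omega) hx hy; omega)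
      (fun x y hxy hx hy => by have := (h g).spaced _ _ (by omega) hy hx; omega)
    have hf : ∀ s : ℕ, s ≤ M → m f (i + t + s) = m f (i + t) + s :=
      apply_add_eq fun x h1 h2 => by
        have := not_not.1 (hP (x - i) (by omega) (by omega))
        rwa [add_sub_cancel] at this
    have hg : ∀ s : ℕ, s ≤ M → m g (j - 1 - t - s) = m g (j - 1 - t) - s :=
      apply_sub_eq fun x h1 h2 => by
        have := not_not.1 (hQ (j - 2 - x) (by omega) (by omega))
        rwa [sub_sub_cancel] at this
    have := (hM f.1 (m f (i + t)) g.1 (m g (j - 1 - t) + 1) false fun k hk => by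
      have := hag' (t + k) (by omega)
      rw [Nat.cast_add, ← add_assoc, ← sub_sub, hf k hk.le, hg k hk.le] at this
      rw [this]
      simp [readFrom]).2.1
    exact Bool.false_ne_true this

end Tighten

end PolygonalComplex

/-! ### Small cancellation in random branched covers -/

namespace PolygonalComplex

theorem tighten_isFinite {W : PolygonalComplex.{u}} (hW : W.IsFinite) {S : Set W.F} {M : ℕ}
    {N' : {f : W.F // f ∉ S} → ℕ} {m : {f : W.F // f ∉ S} → ℤ → ℤ}
    {h : ∀ f, IsCellDeletion S M f.1 (N' f) (m f)} : (tighten S M N' m h).IsFinite := by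
  obtain ⟨hV, hE, hF⟩ := hW
  refine ⟨?_, ?_, ?_⟩
  · exact inferInstanceAs (Finite (Quot _))
  · exact inferInstanceAs (Finite {e // _})
  · exact inferInstanceAs (Finite {f // _})

/-- A reduced complex whose cells share only short boundary paths and whose 1-skeleton does not
branch at a small scale is homotopy equivalent to a small cancellation complex. -/
theorem exists_smallCancellation {M : ℕ} (hM0 : 0 < M) {r : ℝ} (hr : 0 < r) :
    ∃ R, ∀ W : PolygonalComplex.{u}, W.IsFinite → W.IsReduced → W.AgreementBound M →
      W.NoBranching R → ∃ Y : PolygonalComplex.{u}, Y.IsFinite ∧ Y.SmallCancellation r ∧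
        Nonempty (ContinuousMap.HomotopyEquiv W.Realization Y.Realization) := by
  -- A surviving cell has perimeter at least `K` and keeps at least `K / (3M)` of it. This `K` makes
  -- `r` times the new perimeter at least `3M`, the bound for pieces.
  let K : ℕ := ⌈9 * M * M / r⌉₊
  -- Room for two short cycles and for a connecting path of the length that `exists_isBlockDeletion`
  -- demands between blocks.
  refine ⟨2 * K + (9 * M * M + 2 * M + 1), fun W hfin hred hM hR => ?_⟩
  let S : Set W.F := {f | W.len f < K}
  have hS : W.DisjointCycles S :=
    hM.disjointCycles hred hR (fun f hf => (show W.len f < K from hf).le) (by omega)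
  have hex : ∀ f : {f : W.F // f ∉ S}, ∃ N' m, IsCellDeletion S M f.1 N' m := fun f => by
    refine (hS.hasSparseBlocks hred hM hR (fun f hf => (show W.len f < K from hf).le) le_rfl
      f.2).exists_isBlockDeletion le_rfl (W.len_pos f.1) (fun k => ?_) (fun x y => ?_) fun k => ?_
    · rw [W.bd_periodic]
    · rw [W.bd_periodic, W.bd_periodic]
    · exact hred _ _
  choose N' m h using hex
  refine ⟨tighten S M N' m h, tighten_isFinite hfin, smallCancellation_tighten hM fun f => ?_,
    nonempty_homotopyEquiv_tighten hS hred⟩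
  have h1 := apply_add_le (h f).le 0 (N' f)
  rw [(h f).add] at h1
  have h2 : W.len f.1 ≤ 3 * M * N' f := by
    have : (W.len f.1 : ℤ) ≤ 3 * M * N' f := by linarith
    exact_mod_cast this
  have h3 : K ≤ W.len f.1 := not_lt.1 f.2
  have h4 : 9 * M * M / r ≤ (K : ℝ) := Nat.le_ceil _
  have h5 : (K : ℝ) ≤ 3 * M * N' f := by exact_mod_cast h3.trans h2
  rw [div_le_iff₀ hr] at h4
  have h6 : (K : ℝ) * r ≤ 3 * M * N' f * r := mul_le_mul_of_nonneg_right h5 hr.le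
  have hMr : (0 : ℝ) < 3 * M := by positivity
  refine le_of_mul_le_mul_left ?_ hMr
  linarith

theorem IsFinite.branchedCover {X : PolygonalComplex.{u}} (h : X.IsFinite) {n : ℕ}
    (σ : X.E → Equiv.Perm (Fin n)) : (X.branchedCover σ).IsFinite := by
  obtain ⟨hV, hE, hF⟩ := h
  refine ⟨?_, ?_, ?_⟩
  · exact inferInstanceAs (Finite (X.V × Fin n))
  · exact inferInstanceAs (Finite (X.E × Fin n))
  · exact inferInstanceAs
      (Finite (Σ f : X.F, Quotient (Equiv.Perm.SameCycle.setoid (X.monodromy σ f))))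

/-- The reduction takes place in `X`, before `n` is chosen. Hence `M`, and with it the scale `R` of
sparseness, depends only on `X` and `r`. -/
theorem exists_forall_isSparse {X : PolygonalComplex.{u}} (hfin : X.IsFinite)
    (hX : X.IsIndependent) {T : Set X.E} (hT : X.IsSpanningTree T) {r : ℝ} (hr : 0 < r) :
    ∃ R, ∀ (n : ℕ) (τ : {e : X.E // e ∉ T} → Equiv.Perm (Fin n)), IsSparse R τ →
      ∃ Y : PolygonalComplex.{u}, Y.IsFinite ∧ Y.SmallCancellation r ∧
        Nonempty (ContinuousMap.HomotopyEquiv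
          (X.branchedCover (X.extendByOne T τ)).Realization Y.Realization) := by
  obtain ⟨hV, hE, hF⟩ := hfin
  have : Fintype X.F := Fintype.ofFinite _
  let D : BoundaryData X.toOrGraph X.F := ⟨X.len, X.len_pos, X.bd, X.bd_periodic, X.bd_chain⟩
  obtain ⟨D', hD', hred, hD⟩ := D.exists_isReduced hX
  obtain ⟨L, hL⟩ : ∃ L, ∀ f, D'.toComplex.len f ≤ L :=
    ⟨Finset.univ.sup D'.toComplex.len, fun f => Finset.le_sup (Finset.mem_univ f)⟩
  -- `L + 1` instead of `L` keeps the bound positive when there are no cells.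
  have hag := hD'.agreementBound hred (L := L + 1) fun f => (hL f).trans (Nat.le_succ L)
  obtain ⟨R, hR⟩ := exists_smallCancellation.{u} (show 0 < 2 * (L + 1) by omega) hr
  refine ⟨2 * R, fun n τ hτ => ?_⟩
  obtain ⟨Y, hY, hY', ⟨e⟩⟩ := hR (D'.toComplex.branchedCover (X.extendByOne T τ))
    (IsFinite.branchedCover (X := D'.toComplex) ⟨hV, hE, hF⟩ _) hred.branchedCover
    (hag.branchedCover (by omega)) (X.noBranching_coverGraph hT hτ)
  obtain ⟨e'⟩ := hD n (X.extendByOne T τ)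
  exact ⟨Y, hY, hY', ⟨e'.trans e⟩⟩

end PolygonalComplex

theorem theorem1p1 (X : PolygonalComplex.{u}) (hfin : X.IsFinite) (hX : X.IsAcceptable)
    (T : Set X.E) (hT : X.IsSpanningTree T) (r : ℝ) (hr : 0 < r) :
    Tendsto
      (fun n : ℕ =>
        uniformProb ({e : X.E // e ∉ T} → Equiv.Perm (Fin n))
          {τ | ∃ Y : PolygonalComplex.{u}, Y.IsFinite ∧ Y.SmallCancellation r ∧
            Nonempty (ContinuousMap.HomotopyEquiv
              (X.branchedCover (X.extendByOne T τ)).Realization Y.Realization)})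
      atTop (𝓝 1) := by
  obtain ⟨R, hR⟩ := PolygonalComplex.exists_forall_isSparse hfin hX.isIndependent hT hr
  have := hfin.2.1
  refine tendsto_of_tendsto_of_tendsto_of_le_of_le
    (tendsto_uniformProb_isSparse {e : X.E // e ∉ T} R) tendsto_const_nhds
    (fun n => uniformProb_mono fun τ hτ => hR n τ hτ) fun n => uniformProb_le_one _
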